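/- **Setting.** Points of space-time are $(\tau,z)\in\mathbb R\times\mathbb R^d=\mathbb R^{d+1}$; $\mathcal H^d$ is the $d$-dimensional Hausdorff measure for the Euclidean distance. Let $\beta>0$ and let $J:\mathbb R^d\to[0,\infty)$ be integrable with $\int|h|J(h)\,dh<\infty$ and $\beta\hat J>1$, where $\hat J=\int_{\mathbb R^d} J$. Put $\mathfrak s=\sqrt{1-\beta^{-2}\hat J^{-2}}$, $J^\lambda(x)=\lambda^{-d}J(x/\lambda)$, $$\mathcal W_\beta(S)=-\tfrac1\beta\sqrt{1-S^2}-\tfrac{\hat J}2S^2+\tfrac{\hat J}2+\tfrac1{2\beta^2\hat J},\qquad \Psi(S,V)=\tfrac12\int_0^V\frac{V-Z}{\sqrt{Z^2+(1-S)(1+S)}}\,dZ,\qquad \Psi_0(V)=\Psi(0,V).$$ For $A\subset\mathbb R^{d+1}$ let $A_\tau=\{z:(\tau,z)\in A\}$ and, for $u:A\to[-\mathfrak s,\mathfrak s]$ with locally integrable weak time derivative $\partial_\tau u$ on $A$, $$\mathcal G^\lambda_{loc}(u;A)=\frac1\lambda\int_{\mathbb R}\int_{A_\tau}\Big[\mathcal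 W_\beta(u)+\frac1{2\beta}\Psi(u,\lambda\,\partial_\tau u)\Big]dz\,d\tau,$$ $$\mathcal N^\lambda(u;A,A')=\frac1{4\lambda}\int_{\mathbb R}\int_{A_\tau}\int_{A'_\tau}J^\lambda(z-w)\big(u(\tau,z)-u(\tau,w)\big)^2dw\,dz\,d\tau,$$ and $\mathcal G^\lambda(u;A)=\mathcal G^\lambda_{loc}(u;A)+\mathcal N^\lambda(u;A,A)$. For a set $\Sigma$ let $\mathfrak t((\tau,z),\Sigma)=\inf\{|\sigma|:(\tau+\sigma,z)\in\Sigma\}$ (with $\inf\emptyset=+\infty$). **Proposition 4.7 (Defect estimate).** Let $\Sigma\subset\mathbb R^{d+1}$ be a finite union of (measurable) subsets of affine $d$-dimensional planes, with unit normal $\nu=(\nu_t,\nu_x)$ defined $\mathcal H^d$-a.e. on $\Sigma$. There is a constant $C$, depending only on $d,\beta,J$ and $\Sigma$, such that the following holds for every $\lambda>0$, every open $A\subset\mathbb R^{d+1}$ and every $u:A\to[-\mathfrak s,\mathfrak s]$ with weak time derivative as above and $\mathcal G^\lambda(u;A)<\infty$. Write $D=(A\cup\Sigma)^\circ$. At $\mathcal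 H^d$-a.e. point of $\Sigma\cap D\cap\{\nu_t\neq0\}$ the two one-sided traces $u_\pm$ of $u$ exist, as essential limits along the time line through the point, from the future and from the past. Moreover there is $\tilde u:D\to[-\mathfrak s,\mathfrak s]$, with a locally integrable weak time derivative on $D$, such that $\tilde u=u$ at all points of $D$ with $\mathfrak t(\cdot,\Sigma)\ge\lambda$, and for every $\delta>0$ and every measurable $B\subset A$ $$\mathcal G^\lambda_{loc}(\tilde u;D)-\mathcal G^\lambda_{loc}(u;A)+\big|\mathcal N^\lambda(\tilde u;B,B)-\mathcal N^\lambda(u;B,B)\big|$$ $$\le C\int_{\Sigma\cap D}\big\{|u_+-u_-|+\lambda+\delta\big\}\,|\nu_t|\,d\mathcal H^d+C\,\delta^{-1}\,\frac1\lambda\int_{A\cap\{0<\mathfrak t((\tau,z),\Sigma)\le\lambda\}}\Psi_0(\lambda\,\partial_\tau u)\,d\tau\,dz .$$ -/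

import Mathlib

open MeasureTheory Filter Topology
open scoped ENNReal NNReal ContDiff

noncomputable section

namespace SpinPatch

/-- Space `ℝ^d` with its Euclidean norm. -/
abbrev Space (d : ℕ) : Type := EuclideanSpace ℝ (Fin d)

/-- Space-time `ℝ × ℝ^d`; a point is `(τ, z)`. -/
abbrev SpaceTime (d : ℕ) : Type := ℝ × Space d

/-- Space-time with the Euclidean inner product of `ℝ^(d+1)`; normals live here. -/
abbrev Normal (d : ℕ) : Type := WithLp 2 (ℝ × Space d)

/-- The `d`-dimensional Hausdorff measure on space-time, for the Euclidean distance of `ℝ^(d+1)`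
(the product type `ℝ × ℝ^d` itself carries the maximum distance, hence the transport). -/
def hausdorff (d : ℕ) : Measure (SpaceTime d) :=
  (Measure.euclideanHausdorffMeasure d : Measure (Normal d)).map WithLp.ofLp

/-! ### The potentials -/

/-- Total mass of the interaction kernel. -/
def mass {d : ℕ} (J : Space d → ℝ) : ℝ := ∫ x, J x

/-- The stationary cost. -/
def statCost (β Jhat : ℝ) : ℝ := -Jhat / 2 - 1 / (2 * β ^ 2 * Jhat)

/-- The double-well potential. -/
def wellPotential (β Jhat S : ℝ) : ℝ :=
  -(1 / β) * Real.sqrt (1 - S ^ 2) - Jhat / 2 * S ^ 2 - statCost β Jhat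

/-- The positive minimizer of the double-well potential. -/
def spinEq (β Jhat : ℝ) : ℝ := Real.sqrt (1 - 1 / (β ^ 2 * Jhat ^ 2))

/-- The convex temporal Dirichlet-like energy density. -/
def Psi (S V : ℝ) : ℝ :=
  (1 / 2) * ∫ Z in (0 : ℝ)..V, (V - Z) / Real.sqrt (Z ^ 2 + (1 - S) * (1 + S))

/-- `Ψ₀ = Ψ(0, ·)`. -/
def Psi0 (V : ℝ) : ℝ := Psi 0 V

/-! ### The energies

All integrands are non-negative for spins in `[-𝔰, 𝔰]`, so the energies are `[0, ∞]`-valued. -/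

/-- The rescaled kernel `λ^(-d) J(x / λ)`. -/
def scaledKernel {d : ℕ} (J : Space d → ℝ) (lam : ℝ) (x : Space d) : ℝ :=
  (lam ^ d)⁻¹ * J (lam⁻¹ • x)

/-- Local spatial energy of a spin field `s` with velocity `v` on `A ⊆ ℝ^d`. -/
def localEnergySlice {d : ℕ} (β Jhat lam : ℝ) (s v : Space d → ℝ) (A : Set (Space d)) : ℝ≥0∞ :=
  ∫⁻ z in A, ENNReal.ofReal
    (lam⁻¹ * (wellPotential β Jhat (s z) + 1 / (2 * β) * Psi (s z) (lam * v z)))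

/-- The spatial locality defect of `A, A' ⊆ ℝ^d`. -/
def defectSlice {d : ℕ} (J : Space d → ℝ) (lam : ℝ) (s : Space d → ℝ) (A A' : Set (Space d)) :
    ℝ≥0∞ :=
  ∫⁻ z in A, ∫⁻ w in A', ENNReal.ofReal
    (1 / (4 * lam) * scaledKernel J lam (z - w) * (s z - s w) ^ 2)

/-- Time slice `A_τ` of a space-time set. -/
def slice {d : ℕ} (A : Set (SpaceTime d)) (τ : ℝ) : Set (Space d) := {z | (τ, z) ∈ A}

/-- Time-integrated local energy; `v` stands for `∂_τ u`. -/
def localEnergy {d : ℕ} (β : ℝ) (J : Space d → ℝ) (lam : ℝ) (u v : SpaceTime d → ℝ)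
    (A : Set (SpaceTime d)) : ℝ≥0∞ :=
  ∫⁻ τ : ℝ, localEnergySlice β (mass J) lam (fun z => u (τ, z)) (fun z => v (τ, z)) (slice A τ)

/-- Time-integrated nonlocal term. -/
def defect {d : ℕ} (J : Space d → ℝ) (lam : ℝ) (u : SpaceTime d → ℝ)
    (A A' : Set (SpaceTime d)) : ℝ≥0∞ :=
  ∫⁻ τ : ℝ, defectSlice J lam (fun z => u (τ, z)) (slice A τ) (slice A' τ)

/-- Time-integrated full localized energy: local part plus nonlocal part of `A` with itself. -/
def energy {d : ℕ} (β : ℝ) (J : Space d → ℝ) (lam : ℝ) (u v : SpaceTime d → ℝ)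
    (A : Set (SpaceTime d)) : ℝ≥0∞ :=
  localEnergy β J lam u v A + defect J lam u A A

/-! ### Weak time derivative, traces, temporal distance, surfaces -/

/-- `v` is the weak time derivative of `u` on the open set `A` (both locally integrable on `A`). -/
structure HasWeakTimeDeriv {d : ℕ} (u v : SpaceTime d → ℝ) (A : Set (SpaceTime d)) : Prop where
  locInt : LocallyIntegrableOn u A
  locInt_deriv : LocallyIntegrableOn v A
  integral_eq : ∀ φ : SpaceTime d → ℝ, ContDiff ℝ ∞ φ → HasCompactSupport φ → tsupport φ ⊆ A →
    ∫ p in A, u p * fderiv ℝ φ p (1, 0) = -∫ p in A, v p * φ p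

/-- Essential limits at the time of `p` from the future, along the time line through `p`. -/
def futureFilter {d : ℕ} (p : SpaceTime d) : Filter ℝ := 𝓝[>] p.1 ⊓ ae volume

/-- Essential limits at the time of `p` from the past, along the time line through `p`. -/
def pastFilter {d : ℕ} (p : SpaceTime d) : Filter ℝ := 𝓝[<] p.1 ⊓ ae volume

/-- The trace of `u` at `p` from the future. -/
def futureTrace {d : ℕ} (u : SpaceTime d → ℝ) (p : SpaceTime d) : ℝ :=
  limUnder (futureFilter p) (fun t => u (t, p.2))

/-- The trace of `u` at `p` from the past. -/
def pastTrace {d : ℕ} (u : SpaceTime d → ℝ) (p : SpaceTime d) : ℝ :=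
  limUnder (pastFilter p) (fun t => u (t, p.2))

/-- The two one-sided traces of `u` at `p` exist. -/
def HasTraces {d : ℕ} (u : SpaceTime d → ℝ) (p : SpaceTime d) : Prop :=
  (∃ a : ℝ, Tendsto (fun t => u (t, p.2)) (futureFilter p) (𝓝 a)) ∧
    ∃ b : ℝ, Tendsto (fun t => u (t, p.2)) (pastFilter p) (𝓝 b)

/-- The purely temporal distance from `p` to `S` (`∞` if the time line of `p` misses `S`). -/
def timeDist {d : ℕ} (p : SpaceTime d) (S : Set (SpaceTime d)) : ℝ≥0∞ :=
  ⨅ (σ : ℝ) (_ : (p.1 + σ, p.2) ∈ S), ENNReal.ofReal |σ|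

/-- `S` is a finite union of (measurable) subsets of affine `d`-planes, and `ν` is a unit normal
field of `S`, defined almost everywhere for the `d`-dimensional Hausdorff measure on `S`. -/
def IsPlanarUnion {d : ℕ} (S : Set (SpaceTime d)) (ν : SpaceTime d → Normal d) : Prop :=
  ∃ (k : ℕ) (P : Fin k → Set (SpaceTime d)) (n : Fin k → Normal d) (c : Fin k → ℝ),
    S = ⋃ i, P i ∧
    ∀ i, MeasurableSet (P i) ∧ ‖n i‖ = 1 ∧
      (∀ p ∈ P i, inner ℝ (n i) (WithLp.toLp 2 p) = c i) ∧
      ∀ᵐ p ∂(hausdorff d).restrict (P i), ν p = n i ∨ ν p = -n i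

/-- `|a - b|` for extended non-negative reals. -/
def absDiff (a b : ℝ≥0∞) : ℝ≥0∞ := max (a - b) (b - a)

end SpinPatch

end

noncomputable section

namespace SpinPatch

variable {d : ℕ}

/-! Almost every time line meets the surface at finitely many times only, since vertical planes
project to null sets. Off these times `u` is a primitive of `v = ∂_τ u` along the line. The jumps
are removed by truncation from above: at each meeting time stands a cone of slope `2 / λ` whose
vertex is the lower of the two traces, and the new field is the minimum of `u` and all cones. This
barrier lies below both traces at every exceptional time, so the minimum is continuous there and
becomes a primitive on the whole line inside `D` (`IsPiecewisePrimitive.min_barrier`). As `|u| ≤ 1`,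
a cone has risen above `u` after time `λ`, so nothing changes farther away.

Let `E` be the set where the barrier is active. There the new velocity `V` satisfies `|λ V| ≤ 2`, so
the local density is at most `Ĵ / λ`, and the nonlocal term changes by at most `2 Ĵ |E| / λ`
(`localEnergy_le`, `absDiff_defect_le`). It remains to bound `|E| / λ`. If the cone at time `t` is
active at `τ`, then `(2 / λ) |τ - t|` is at most the variation of `u` between `t` and `τ` plus the
jumps. Hence each cone is active for a duration at most `λ` times the jumps plus the integral of
`|v|` near the slits (`ae_volume_timeLine_cutSet_le`). After integration over space, `|V| ≤ δ + 8
δ⁻¹ Ψ₀(V)` with `V = λ v` turns the velocity into the two terms of the claim when `δ ≤ 1`; for `δ >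
1` the trivial duration `2 λ` suffices (`abs_le_add_Psi0`, `volume_cutSet_le`). Integrals over the
projection of a slit are dominated by surface integrals because projection does not increase
Hausdorff measure; the factor `|ν_t|` costs a constant depending on the planes
(`lintegral_planeSlit_le`).

The bridge between weak derivatives in space-time and primitives on lines is the identity `u(p + h)
- u(p) = ∫ v` along almost all time segments, which is equivalent to `v` being the weak derivative
(`HasWeakTimeDeriv.ae_incrementDefect_eq_zero`, `hasWeakTimeDeriv_of_ae`). -/

/-! ### Primitives of locally integrable functions on the line -/

/-- `f` is a primitive of `g` along every segment contained in `U`. -/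
def IsPrimitiveOn (f g : ℝ → ℝ) (U : Set ℝ) : Prop :=
  ∀ x y, Set.uIcc x y ⊆ U →
    IntervalIntegrable g volume x y ∧ ∫ t in x..y, g t = f y - f x

/-- Two dominating functions are allowed because the increments of a minimum are controlled only by
those of both arguments together. -/
theorem absolutelyContinuousOnInterval_of_dist_le {f F G : ℝ → ℝ} {a b : ℝ}
    (hF : AbsolutelyContinuousOnInterval F a b) (hG : AbsolutelyContinuousOnInterval G a b)
    (h : ∀ s ∈ Set.uIcc a b, ∀ t ∈ Set.uIcc a b,
      dist (f s) (f t) ≤ dist (F s) (F t) + dist (G s) (G t)) :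
    AbsolutelyContinuousOnInterval f a b := by
  rw [absolutelyContinuousOnInterval_iff] at *
  intro ε hε
  obtain ⟨δ₁, hδ₁, h₁⟩ := hF (ε / 2) (half_pos hε)
  obtain ⟨δ₂, hδ₂, h₂⟩ := hG (ε / 2) (half_pos hε)
  refine ⟨min δ₁ δ₂, lt_min hδ₁ hδ₂, fun E hE hlt => ?_⟩
  have e₁ := h₁ E hE (hlt.trans_le (min_le_left _ _))
  have e₂ := h₂ E hE (hlt.trans_le (min_le_right _ _))
  have : ∑ i ∈ Finset.range E.1, dist (f (E.2 i).1) (f (E.2 i).2) ≤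
      ∑ i ∈ Finset.range E.1,
        (dist (F (E.2 i).1) (F (E.2 i).2) + dist (G (E.2 i).1) (G (E.2 i).2)) :=
    Finset.sum_le_sum fun i hi => h _ (hE.1 i hi).1 _ (hE.1 i hi).2
  rw [Finset.sum_add_distrib] at this
  linarith

namespace IsPrimitiveOn

variable {f g f₁ g₁ f₂ g₂ : ℝ → ℝ} {U V : Set ℝ}

theorem mono (h : IsPrimitiveOn f g U) (hV : V ⊆ U) : IsPrimitiveOn f g V :=
  fun x y hxy => h x y (hxy.trans hV)

theorem absolutelyContinuousOnInterval (h : IsPrimitiveOn f g U) {x y : ℝ}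
    (hxy : Set.uIcc x y ⊆ U) : AbsolutelyContinuousOnInterval f x y := by
  have hI := (h x y hxy).1.absolutelyContinuousOnInterval_intervalIntegral Set.left_mem_uIcc
  refine absolutelyContinuousOnInterval_of_dist_le hI hI fun s hs t ht => ?_
  have e₁ := (h x s ((Set.uIcc_subset_uIcc_left hs).trans hxy)).2
  have e₂ := (h x t ((Set.uIcc_subset_uIcc_left ht).trans hxy)).2
  rw [e₁, e₂, dist_sub_right]
  linarith [dist_nonneg (x := f s) (y := f t)]

theorem continuousOn (h : IsPrimitiveOn f g U) (hU : IsOpen U) : ContinuousOn f U := by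
  intro x hx
  obtain ⟨ε, hε, hb⟩ := Metric.nhds_basis_closedBall.mem_iff.1 (hU.mem_nhds hx)
  rw [Real.closedBall_eq_Icc, ← Set.uIcc_of_le (by linarith)] at hb
  have := (h.absolutelyContinuousOnInterval hb).continuousOn
  refine (this.continuousAt ?_).continuousWithinAt
  rw [Set.uIcc_of_le (by linarith)]
  exact Icc_mem_nhds (by linarith) (by linarith)

theorem ae_hasDerivAt (h : IsPrimitiveOn f g U) {x y : ℝ} (hxy : Set.uIcc x y ⊆ U) :
    ∀ᵐ t, t ∈ Set.uIcc x y → HasDerivAt f (g t) t := by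
  have h₁ : ∀ᵐ t : ℝ, t ≠ x := by simp [ae_iff, measure_singleton]
  have h₂ : ∀ᵐ t : ℝ, t ≠ y := by simp [ae_iff, measure_singleton]
  -- Lebesgue differentiation of the integral. The endpoints are discarded because `f` is known to
  -- be a primitive only inside the segment.
  filter_upwards [(h x y hxy).1.ae_hasDerivAt_integral, h₁, h₂] with t ht n₁ n₂ htm
  have hd := (ht htm x Set.left_mem_uIcc).const_add (f x)
  refine hd.congr_of_eventuallyEq ?_
  have : Set.uIcc x y ∈ 𝓝 t := by
    rw [Set.mem_uIcc] at htm
    rcases htm with ⟨a, b⟩ | ⟨a, b⟩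
    · rw [Set.uIcc_of_le (a.trans b)]
      exact Icc_mem_nhds (lt_of_le_of_ne a n₁.symm) (lt_of_le_of_ne b n₂)
    · rw [Set.uIcc_of_ge (a.trans b)]
      exact Icc_mem_nhds (lt_of_le_of_ne a n₂.symm) (lt_of_le_of_ne b n₁)
  filter_upwards [this] with s hs
  rw [(h x s ((Set.uIcc_subset_uIcc_left hs).trans hxy)).2]
  ring

/-- The minimum of two primitives is a primitive. -/
theorem min (h₁ : IsPrimitiveOn f₁ g₁ U) (h₂ : IsPrimitiveOn f₂ g₂ U) :
    IsPrimitiveOn (fun t => min (f₁ t) (f₂ t)) (fun t => if f₁ t ≤ f₂ t then g₁ t else g₂ t) U := by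
  intro x y hxy
  have hac : AbsolutelyContinuousOnInterval (fun t => Min.min (f₁ t) (f₂ t)) x y := by
    refine absolutelyContinuousOnInterval_of_dist_le (h₁.absolutelyContinuousOnInterval hxy)
      (h₂.absolutelyContinuousOnInterval hxy) fun s _ t _ => ?_
    simp only [Real.dist_eq]
    refine (abs_min_sub_min_le_max _ _ _ _).trans ?_
    exact max_le (by linarith [abs_nonneg (f₂ s - f₂ t)]) (by linarith [abs_nonneg (f₁ s - f₁ t)])
  have hc₁ := (h₁.absolutelyContinuousOnInterval hxy).continuousOn
  have hc₂ := (h₂.absolutelyContinuousOnInterval hxy).continuousOn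
  have hae : ∀ᵐ t, t ∈ Set.uIcc x y →
      deriv (fun t => Min.min (f₁ t) (f₂ t)) t = if f₁ t ≤ f₂ t then g₁ t else g₂ t := by
    filter_upwards [h₁.ae_hasDerivAt hxy, h₂.ae_hasDerivAt hxy, hac.ae_differentiableAt]
      with t d₁ d₂ dm ht
    have d₁ := d₁ ht
    have d₂ := d₂ ht
    have dm := dm ht
    rcases lt_trichotomy (f₁ t) (f₂ t) with hlt | heq | hgt
    · rw [if_pos hlt.le]
      refine HasDerivAt.deriv (d₁.congr_of_eventuallyEq ?_)
      filter_upwards [d₁.continuousAt.eventually_lt d₂.continuousAt hlt] with s hs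
      exact min_eq_left hs.le
    · rw [if_pos heq.le]
      -- At a tie, `f₁ - min f₁ f₂` is nonnegative and vanishes, so its derivative is zero; hence
      -- the choice of branch at ties does not matter.
      have hmin : IsLocalMin (fun s => f₁ s - Min.min (f₁ s) (f₂ s)) t := by
        filter_upwards with s
        simp [heq]
      have := hmin.hasDerivAt_eq_zero (d₁.sub dm.hasDerivAt)
      linarith
    · rw [if_neg (not_le.2 hgt)]
      refine HasDerivAt.deriv (d₂.congr_of_eventuallyEq ?_)
      filter_upwards [d₂.continuousAt.eventually_lt d₁.continuousAt hgt] with s hs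
      exact min_eq_right hs.le
  have hae' : ∀ᵐ t, t ∈ Set.uIoc x y →
      deriv (fun t => Min.min (f₁ t) (f₂ t)) t = if f₁ t ≤ f₂ t then g₁ t else g₂ t := by
    filter_upwards [hae] with t ht hm using ht (Set.uIoc_subset_uIcc hm)
  refine ⟨hac.intervalIntegrable_deriv.congr_ae ?_, ?_⟩
  · exact (ae_restrict_iff' measurableSet_uIoc).2 hae'
  · rw [← hac.integral_deriv_eq_sub]
    exact intervalIntegral.integral_congr_ae (by filter_upwards [hae'] with t ht hm using (ht hm).symm)

end IsPrimitiveOn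

/-! ### One-sided essential limits on the line -/

/-- The limit of the averages of `f` over `x + σ [0, 1 / (n + 1)]`. -/
def meanLim (σ : ℝ) (f : ℝ → ℝ) (x : ℝ) : ℝ :=
  limsup (fun n : ℕ => ∫ θ in (0 : ℝ)..1, f (x + σ * (θ / (n + 1)))) atTop

theorem ae_comp_affine {p : ℝ → Prop} (h : ∀ᵐ s, p s) (x : ℝ) {a : ℝ} (ha : a ≠ 0) :
    ∀ᵐ θ, p (x + a * θ) := by
  have h₁ : ∀ᵐ s, p (x + s) := (measurePreserving_add_left volume x).quasiMeasurePreserving.ae h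
  have hq : Measure.QuasiMeasurePreserving (fun θ : ℝ => a * θ) volume volume := by
    refine ⟨by fun_prop, ?_⟩
    have := Real.map_volume_mul_left ha
    rw [this]
    exact Measure.smul_absolutelyContinuous
  exact hq.ae h₁

/-- Averages do not see null sets, so they converge to the essential one-sided limit when it exists.
The explicit sequence of averages serves as a trace that is defined everywhere and depends
measurably on parameters. -/
theorem meanLim_eq {σ : ℝ} {f : ℝ → ℝ} (hf : Measurable f) {M : ℝ}
    (hM : ∀ t, |f t| ≤ M) {x c : ℝ}
    (h : ∀ ε > 0, ∃ η > 0, ∀ᵐ s, s ∈ Set.Ioo 0 η → |f (x + σ * s) - c| ≤ ε) :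
    meanLim σ f x = c := by
  refine Tendsto.limsup_eq ?_
  rw [Metric.tendsto_atTop]
  intro ε hε
  obtain ⟨η, hη, hae⟩ := h (ε / 2) (half_pos hε)
  obtain ⟨N, hN⟩ := exists_nat_one_div_lt hη
  refine ⟨N, fun n hn => ?_⟩
  have hn1 : (0 : ℝ) < 1 / (n + 1) := by positivity
  have hnη : (1 : ℝ) / (n + 1) < η := (one_div_le_one_div_of_le (by positivity)
    (by exact_mod_cast Nat.succ_le_succ hn)).trans_lt hN
  have hmeas : Measurable fun θ : ℝ => f (x + σ * (θ / (n + 1))) := hf.comp (by fun_prop)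
  have hint : IntervalIntegrable (fun θ : ℝ => f (x + σ * (θ / (n + 1)))) volume 0 1 :=
    (intervalIntegrable_const (c := M)).mono_fun hmeas.aestronglyMeasurable
      (ae_of_all _ fun θ => by
        simpa using (hM _).trans (le_abs_self M))
  have hsub : (∫ θ in (0 : ℝ)..1, f (x + σ * (θ / (n + 1)))) - c =
      ∫ θ in (0 : ℝ)..1, (f (x + σ * (θ / (n + 1))) - c) := by
    rw [intervalIntegral.integral_sub hint intervalIntegrable_const]
    simp
  rw [Real.dist_eq, hsub, ← Real.norm_eq_abs]
  have hb : ∀ᵐ θ : ℝ, θ ∈ Set.uIoc (0 : ℝ) 1 → ‖f (x + σ * (θ / (n + 1))) - c‖ ≤ ε / 2 := by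
    have := ae_comp_affine hae 0 hn1.ne'
    have h1 : ∀ᵐ t : ℝ, t ≠ 1 := by simp [ae_iff, measure_singleton]
    filter_upwards [this] with θ hθ hm
    rw [Set.uIoc_of_le zero_le_one] at hm
    have e : 0 + 1 / ((n : ℝ) + 1) * θ = θ / (n + 1) := by ring
    rw [e] at hθ
    refine hθ ⟨by have := hm.1; positivity, ?_⟩
    refine lt_of_le_of_lt ?_ hnη
    exact div_le_div_of_nonneg_right hm.2 (by positivity)
  have := intervalIntegral.norm_integral_le_of_norm_le_const_ae hb
  simp only [sub_zero, abs_one, mul_one] at this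
  linarith

theorem tendsto_future_iff {f : ℝ → ℝ} {x c : ℝ} :
    Tendsto f (𝓝[>] x ⊓ ae volume) (𝓝 c) ↔
      ∀ ε > 0, ∃ η > 0, ∀ᵐ t, t ∈ Set.Ioo x (x + η) → |f t - c| ≤ ε := by
  rw [Metric.nhds_basis_closedBall.tendsto_right_iff]
  refine forall₂_congr fun ε _ => ?_
  have hB : (𝓝[>] x).HasBasis (fun η : ℝ => 0 < η) fun η => Set.Ioo x (x + η) := by
    refine (nhdsGT_basis x).to_hasBasis (fun b hb => ⟨b - x, sub_pos.2 hb, by simp⟩)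
      fun η hη => ⟨x + η, by linarith, subset_rfl⟩
  rw [Filter.Eventually, mem_inf_iff_superset]
  constructor
  · rintro ⟨s, hs, t, ht, hst⟩
    obtain ⟨η, hη, hs'⟩ := hB.mem_iff.1 hs
    refine ⟨η, hη, ?_⟩
    filter_upwards [ht] with τ hτ hm
    have := hst ⟨hs' hm, hτ⟩
    simpa [Real.dist_eq] using this
  · rintro ⟨η, hη, h⟩
    refine ⟨_, hB.mem_of_mem hη, _, h, ?_⟩
    rintro τ ⟨h₁, h₂⟩
    simpa [Real.dist_eq] using h₂ h₁

theorem tendsto_past_iff {f : ℝ → ℝ} {x c : ℝ} :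
    Tendsto f (𝓝[<] x ⊓ ae volume) (𝓝 c) ↔
      ∀ ε > 0, ∃ η > 0, ∀ᵐ t, t ∈ Set.Ioo (x - η) x → |f t - c| ≤ ε := by
  rw [Metric.nhds_basis_closedBall.tendsto_right_iff]
  refine forall₂_congr fun ε _ => ?_
  have hB : (𝓝[<] x).HasBasis (fun η : ℝ => 0 < η) fun η => Set.Ioo (x - η) x := by
    refine (nhdsLT_basis x).to_hasBasis (fun b hb => ⟨x - b, sub_pos.2 hb, by simp⟩)
      fun η hη => ⟨x - η, by linarith, subset_rfl⟩
  rw [Filter.Eventually, mem_inf_iff_superset]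
  constructor
  · rintro ⟨s, hs, t, ht, hst⟩
    obtain ⟨η, hη, hs'⟩ := hB.mem_iff.1 hs
    refine ⟨η, hη, ?_⟩
    filter_upwards [ht] with τ hτ hm
    have := hst ⟨hs' hm, hτ⟩
    simpa [Real.dist_eq] using this
  · rintro ⟨η, hη, h⟩
    refine ⟨_, hB.mem_of_mem hη, _, h, ?_⟩
    rintro τ ⟨h₁, h₂⟩
    simpa [Real.dist_eq] using h₂ h₁

theorem inf_ae_neBot {l : Filter ℝ} (h : ∀ s ∈ l, volume s ≠ 0) : (l ⊓ ae (volume : Measure ℝ)).NeBot := by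
  rw [inf_neBot_iff]
  intro s hs t ht
  by_contra hne
  rw [Set.not_nonempty_iff_eq_empty] at hne
  refine h s hs (measure_mono_null ?_ (mem_ae_iff.1 ht))
  exact fun x hx hxt => (Set.eq_empty_iff_forall_notMem.1 hne x) ⟨hx, hxt⟩

instance futureFilter_neBot {d : ℕ} (p : SpaceTime d) : (futureFilter p).NeBot := by
  refine inf_ae_neBot fun s hs => ?_
  obtain ⟨b, hb, hsub⟩ := (nhdsGT_basis p.1).mem_iff.1 hs
  refine fun h0 => ?_
  have := measure_mono_null hsub h0
  simp at this
  linarith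

instance pastFilter_neBot {d : ℕ} (p : SpaceTime d) : (pastFilter p).NeBot := by
  refine inf_ae_neBot fun s hs => ?_
  obtain ⟨b, hb, hsub⟩ := (nhdsLT_basis p.1).mem_iff.1 hs
  refine fun h0 => ?_
  have := measure_mono_null hsub h0
  simp at this
  linarith

theorem meanLim_one_eq {f : ℝ → ℝ} (hf : Measurable f) {M : ℝ} (hM : ∀ t, |f t| ≤ M) {x c : ℝ}
    (h : Tendsto f (𝓝[>] x ⊓ ae volume) (𝓝 c)) : meanLim 1 f x = c := by
  refine meanLim_eq hf hM fun ε hε => ?_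
  obtain ⟨η, hη, hae⟩ := tendsto_future_iff.1 h ε hε
  refine ⟨η, hη, ?_⟩
  filter_upwards [ae_comp_affine hae x one_ne_zero] with s hs hm
  exact hs ⟨by linarith [hm.1], by linarith [hm.2]⟩

theorem meanLim_neg_one_eq {f : ℝ → ℝ} (hf : Measurable f) {M : ℝ} (hM : ∀ t, |f t| ≤ M)
    {x c : ℝ} (h : Tendsto f (𝓝[<] x ⊓ ae volume) (𝓝 c)) : meanLim (-1) f x = c := by
  refine meanLim_eq hf hM fun ε hε => ?_
  obtain ⟨η, hη, hae⟩ := tendsto_past_iff.1 h ε hε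
  refine ⟨η, hη, ?_⟩
  filter_upwards [ae_comp_affine hae x (a := -1) (by norm_num)] with s hs hm
  exact hs ⟨by linarith [hm.2], by linarith [hm.1]⟩

/-! ### Functions on a line which are primitives off finitely many points -/

/-- On the open set `D`, the function `f` is essentially bounded and, in the weak sense,
a primitive of `g` off the finite set `F`. -/
structure IsPiecewisePrimitive (f g : ℝ → ℝ) (D : Set ℝ) (F : Finset ℝ) : Prop where
  isOpen : IsOpen D
  measurable : Measurable f
  bounded : ∃ M, ∀ t, |f t| ≤ M
  intervalIntegrable : ∀ x y, Set.uIcc x y ⊆ D → IntervalIntegrable g volume x y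
  ae_ae : ∀ᵐ s, ∀ᵐ h, (∀ θ ∈ Set.Icc (0 : ℝ) 1, s + θ * h ∈ D \ F) →
    f (s + h) - f s = ∫ t in s..(s + h), g t

namespace IsPiecewisePrimitive

variable {f g : ℝ → ℝ} {D : Set ℝ} {F : Finset ℝ}

/-- One good base point `s` in the interval is enough: almost every increment from `s` reaches
almost every `τ`, all with the same constant. -/
theorem exists_const (H : IsPiecewisePrimitive f g D F) {a b : ℝ} (hab : a < b)
    (hD : Set.Icc a b ⊆ D) (hF : ∀ t ∈ F, t ∉ Set.Ioo a b) :
    ∃ c, ∀ᵐ τ, τ ∈ Set.Ioo a b → f τ = c + ∫ t in a..τ, g t := by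
  have hne : (ae (volume.restrict (Set.Ioo a b))).NeBot := by
    rw [ae_neBot]
    intro h0
    rw [Measure.restrict_eq_zero, Real.volume_Ioo, ENNReal.ofReal_eq_zero] at h0
    linarith
  obtain ⟨s, hs, hsm⟩ := ((ae_restrict_of_ae (s := Set.Ioo a b) H.ae_ae).and (ae_restrict_mem measurableSet_Ioo)).exists
  have hii : ∀ x ∈ Set.Icc a b, ∀ y ∈ Set.Icc a b, IntervalIntegrable g volume x y :=
    fun x hx y hy => H.intervalIntegrable x y ((Set.uIcc_subset_Icc hx hy).trans hD)
  refine ⟨f s - ∫ t in a..s, g t, ?_⟩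
  filter_upwards [ae_comp_affine hs (-s) one_ne_zero] with τ hτ hm
  have h1 := hτ fun θ hθ => by
    have : s + θ * (-s + 1 * τ) ∈ Set.Ioo a b := by
      have := (convex_Ioo a b).add_smul_sub_mem hsm hm hθ
      simp only [smul_eq_mul] at this
      convert this using 2
      ring
    exact ⟨hD (Set.Ioo_subset_Icc_self this), fun h => hF _ h this⟩
  have e : s + (-s + 1 * τ) = τ := by ring
  rw [e] at h1
  have := intervalIntegral.integral_add_adjacent_intervals
    (hii a ⟨le_rfl, hab.le⟩ s (Set.Ioo_subset_Icc_self hsm))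
    (hii s (Set.Ioo_subset_Icc_self hsm) τ (Set.Ioo_subset_Icc_self hm))
  linarith

/-- Only the open interval must avoid `F`, so `a` and `b` may be exceptional. This is how one-sided
limits at the jumps are obtained: the integral stays continuous up to the endpoints. -/
theorem exists_limits (H : IsPiecewisePrimitive f g D F) {a b : ℝ} (hab : a < b)
    (hD : Set.Icc a b ⊆ D) (hF : ∀ t ∈ F, t ∉ Set.Ioo a b) :
    ∃ c, (∀ᵐ τ, τ ∈ Set.Ioo a b → f τ = c + ∫ t in a..τ, g t) ∧
      (∀ s ∈ Set.Ico a b, Tendsto f (𝓝[>] s ⊓ ae volume) (𝓝 (c + ∫ t in a..s, g t))) ∧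
      ∀ s ∈ Set.Ioc a b, Tendsto f (𝓝[<] s ⊓ ae volume) (𝓝 (c + ∫ t in a..s, g t)) := by
  obtain ⟨c, hc⟩ := H.exists_const hab hD hF
  have hcont : ContinuousOn (fun τ => c + ∫ t in a..τ, g t) (Set.Icc a b) := by
    have := intervalIntegral.continuousOn_primitive_interval'
      (H.intervalIntegrable a b (by rwa [Set.uIcc_of_le hab.le])) Set.left_mem_uIcc
    rw [Set.uIcc_of_le hab.le] at this
    exact continuousOn_const.add this
  refine ⟨c, hc, fun s hs => ?_, fun s hs => ?_⟩
  · have h1 : Tendsto (fun τ => c + ∫ t in a..τ, g t) (𝓝[>] s)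
        (𝓝 (c + ∫ t in a..s, g t)) := by
      refine (hcont s ⟨hs.1, hs.2.le⟩).mono_left ?_
      rw [← nhdsWithin_Ioo_eq_nhdsGT hs.2]
      exact nhdsWithin_mono _ fun t ht => ⟨hs.1.trans ht.1.le, ht.2.le⟩
    refine (h1.mono_left inf_le_left).congr' ?_
    have m1 : Set.Ioo s b ∈ 𝓝[>] s ⊓ ae (volume : Measure ℝ) :=
      mem_inf_of_left (Ioo_mem_nhdsGT hs.2)
    filter_upwards [m1, mem_inf_of_right hc] with τ h h'
    exact (h' ⟨hs.1.trans_lt h.1, h.2⟩).symm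
  · have h1 : Tendsto (fun τ => c + ∫ t in a..τ, g t) (𝓝[<] s)
        (𝓝 (c + ∫ t in a..s, g t)) := by
      refine (hcont s ⟨hs.1.le, hs.2⟩).mono_left ?_
      rw [← nhdsWithin_Ioo_eq_nhdsLT hs.1]
      exact nhdsWithin_mono _ fun t ht => ⟨ht.1.le, ht.2.le.trans hs.2⟩
    refine (h1.mono_left inf_le_left).congr' ?_
    have m1 : Set.Ioo a s ∈ 𝓝[<] s ⊓ ae (volume : Measure ℝ) :=
      mem_inf_of_left (Ioo_mem_nhdsLT hs.1)
    filter_upwards [m1, mem_inf_of_right hc] with τ h h'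
    exact (h' ⟨h.1, h.2.trans_le hs.2⟩).symm

theorem exists_eq (H : IsPiecewisePrimitive f g D F) {a b : ℝ} (hab : a < b)
    (hD : Set.Icc a b ⊆ D) (hF : ∀ t ∈ F, t ∉ Set.Ioo a b) :
    (∀ᵐ τ, τ ∈ Set.Ioo a b → f τ = meanLim 1 f a + ∫ t in a..τ, g t) ∧
      (∀ s ∈ Set.Ico a b, Tendsto f (𝓝[>] s ⊓ ae volume) (𝓝 (meanLim 1 f s)) ∧
        meanLim 1 f s = meanLim 1 f a + ∫ t in a..s, g t) ∧
      ∀ s ∈ Set.Ioc a b, Tendsto f (𝓝[<] s ⊓ ae volume) (𝓝 (meanLim (-1) f s)) ∧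
        meanLim (-1) f s = meanLim 1 f a + ∫ t in a..s, g t := by
  obtain ⟨M, hM⟩ := H.bounded
  obtain ⟨c, hc, hr, hl⟩ := H.exists_limits hab hD hF
  have er := fun s hs => meanLim_one_eq H.measurable hM (hr s hs)
  have el := fun s hs => meanLim_neg_one_eq H.measurable hM (hl s hs)
  have ec : meanLim 1 f a = c := by simpa using er a ⟨le_rfl, hab⟩
  rw [ec]
  exact ⟨hc, fun s hs => ⟨by rw [er s hs]; exact hr s hs, er s hs⟩,
    fun s hs => ⟨by rw [el s hs]; exact hl s hs, el s hs⟩⟩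

/-- Every point of `D` has a punctured neighbourhood free of exceptional points. -/
theorem exists_Icc (H : IsPiecewisePrimitive f g D F) {x : ℝ} (hx : x ∈ D) :
    ∃ ε > 0, Set.Icc (x - ε) (x + ε) ⊆ D ∧ ∀ t ∈ F, t ∈ Set.Icc (x - ε) (x + ε) → t = x := by
  have h1 : D ∩ (↑(F.erase x) : Set ℝ)ᶜ ∈ 𝓝 x :=
    inter_mem (H.isOpen.mem_nhds hx) ((F.erase x).finite_toSet.isClosed.isOpen_compl.mem_nhds (by simp))
  obtain ⟨ε, hε, hb⟩ := Metric.nhds_basis_closedBall.mem_iff.1 h1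
  rw [Real.closedBall_eq_Icc] at hb
  refine ⟨ε, hε, fun t ht => (hb ht).1, fun t htF ht => ?_⟩
  by_contra hne
  exact (hb ht).2 (by simp [hne, htF])

theorem tendsto_future (H : IsPiecewisePrimitive f g D F) {x : ℝ} (hx : x ∈ D) :
    Tendsto f (𝓝[>] x ⊓ ae volume) (𝓝 (meanLim 1 f x)) := by
  obtain ⟨ε, hε, hD, hF⟩ := H.exists_Icc hx
  refine ((H.exists_eq (a := x) (b := x + ε) (by linarith)
    (fun t ht => hD ⟨by linarith [ht.1], ht.2⟩) fun t ht hm => ?_).2.1 x ⟨le_rfl, by linarith⟩).1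
  exact hm.1.ne' (hF t ht ⟨by linarith [hm.1], hm.2.le⟩)

theorem tendsto_past (H : IsPiecewisePrimitive f g D F) {x : ℝ} (hx : x ∈ D) :
    Tendsto f (𝓝[<] x ⊓ ae volume) (𝓝 (meanLim (-1) f x)) := by
  obtain ⟨ε, hε, hD, hF⟩ := H.exists_Icc hx
  refine ((H.exists_eq (a := x - ε) (b := x) (by linarith)
    (fun t ht => hD ⟨ht.1, by linarith [ht.2]⟩) fun t ht hm => ?_).2.2 x ⟨by linarith, le_rfl⟩).1
  exact hm.2.ne (hF t ht ⟨hm.1.le, by linarith [hm.2]⟩)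

theorem past_eq_future (H : IsPiecewisePrimitive f g D F) {x : ℝ} (hx : x ∈ D) (hxF : x ∉ F) :
    meanLim (-1) f x = meanLim 1 f x := by
  obtain ⟨ε, hε, hD, hF⟩ := H.exists_Icc hx
  have := H.exists_eq (a := x - ε) (b := x + ε) (by linarith) hD fun t ht hm =>
    hxF (hF t ht ⟨hm.1.le, hm.2.le⟩ ▸ ht)
  rw [(this.2.1 x ⟨by linarith, by linarith⟩).2, (this.2.2 x ⟨by linarith, by linarith⟩).2]

/-- The identity holds almost everywhere near each non-exceptional point; a locally null set is
null, and `F` is finite. -/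
theorem ae_eq (H : IsPiecewisePrimitive f g D F) :
    ∀ᵐ t, t ∈ D → f t = meanLim 1 f t := by
  have hloc : ∀ x ∈ D \ (F : Set ℝ), ∃ u ∈ 𝓝[D \ (F : Set ℝ)] x,
      volume (u ∩ {t | ¬ f t = meanLim 1 f t}) = 0 := by
    rintro x ⟨hx, hxF⟩
    obtain ⟨ε, hε, hD, hF⟩ := H.exists_Icc hx
    have := H.exists_eq (a := x - ε) (b := x + ε) (by linarith) hD fun t ht hm =>
      hxF (hF t ht ⟨hm.1.le, hm.2.le⟩ ▸ ht)
    refine ⟨Set.Ioo (x - ε) (x + ε), mem_nhdsWithin_of_mem_nhds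
      (Ioo_mem_nhds (by linarith) (by linarith)), ?_⟩
    refine measure_mono_null ?_ (ae_iff.1 this.1)
    rintro t ⟨ht, hne⟩ himp
    exact hne ((himp ht).trans (this.2.1 t ⟨ht.1.le, ht.2⟩).2.symm)
  have h0 : volume ({t | ¬ f t = meanLim 1 f t} ∩ (D \ (F : Set ℝ))) = 0 := by
    have := measure_null_of_locally_null ({t | ¬ f t = meanLim 1 f t} ∩ (D \ (F : Set ℝ)))
      (μ := volume) fun x hx => ?_
    · exact this
    · obtain ⟨u, hu, h0⟩ := hloc x hx.2
      refine ⟨u ∩ {t | ¬ f t = meanLim 1 f t}, inter_mem (nhdsWithin_mono _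
        Set.inter_subset_right hu) ?_, h0⟩
      exact mem_of_superset self_mem_nhdsWithin Set.inter_subset_left
  have hF0 : volume (F : Set ℝ) = 0 := F.finite_toSet.measure_zero _
  filter_upwards [measure_eq_zero_iff_ae_notMem.1 h0, measure_eq_zero_iff_ae_notMem.1 hF0]
    with t h₁ h₂ ht
  by_contra hne
  exact h₁ ⟨hne, ht, h₂⟩

/-- Increments are the integral of the derivative plus the jumps in between. -/
theorem past_sub_future (H : IsPiecewisePrimitive f g D F) {x : ℝ} :
    ∀ y, x < y → Set.Icc x y ⊆ D →
      meanLim (-1) f y - meanLim 1 f x = (∫ t in x..y, g t) +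
        ∑ t ∈ F with x < t ∧ t < y, (meanLim 1 f t - meanLim (-1) f t) := by
  suffices ∀ n : ℕ, ∀ y, x < y → Set.Icc x y ⊆ D → (F.filter fun t => x < t ∧ t < y).card ≤ n →
      meanLim (-1) f y - meanLim 1 f x = (∫ t in x..y, g t) +
        ∑ t ∈ F with x < t ∧ t < y, (meanLim 1 f t - meanLim (-1) f t) from
    fun y h₁ h₂ => this _ y h₁ h₂ le_rfl
  intro n
  induction n with
  | zero =>
    intro y hxy hD hn
    have he : (F.filter fun t => x < t ∧ t < y) = ∅ := Finset.card_eq_zero.1 (Nat.le_zero.1 hn)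
    have := (H.exists_eq hxy hD fun t ht hm => by
      have : t ∈ F.filter fun t => x < t ∧ t < y := Finset.mem_filter.2 ⟨ht, hm⟩
      rw [he] at this
      simp at this).2.2 y ⟨hxy, le_rfl⟩
    rw [this.2, he]
    simp
  | succ n ih =>
    intro y hxy hD hn
    by_cases hne : (F.filter fun t => x < t ∧ t < y).Nonempty
    -- Split at the last exceptional point `s`: no jump lies between `s` and `y`, and the interval
    -- from `x` to `s` has one exceptional point fewer.
    · obtain ⟨s, hs, hmax⟩ := Finset.exists_max_image _ id hne
      simp only [Finset.mem_filter, id_eq] at hs hmax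
      obtain ⟨hsF, hxs, hsy⟩ := hs
      have hfil : (F.filter fun t => x < t ∧ t < y) =
          insert s (F.filter fun t => x < t ∧ t < s) := by
        ext t
        simp only [Finset.mem_filter, Finset.mem_insert]
        constructor
        · rintro ⟨a, b, c⟩
          rcases (hmax t ⟨a, b, c⟩).lt_or_eq with h | h
          · exact Or.inr ⟨a, b, h⟩
          · exact Or.inl h
        · rintro (rfl | ⟨a, b, c⟩)
          · exact ⟨hsF, hxs, hsy⟩
          · exact ⟨a, b, c.trans hsy⟩
      have hns : s ∉ F.filter fun t => x < t ∧ t < s := by simp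
      rw [hfil, Finset.card_insert_of_notMem hns] at hn
      have h1 := ih s hxs (fun t ht => hD ⟨ht.1, ht.2.trans hsy.le⟩) (Nat.le_of_succ_le_succ hn)
      have h2 := ((H.exists_eq hsy (fun t ht => hD ⟨hxs.le.trans ht.1, ht.2⟩) fun t ht hm =>
        absurd (hmax t ⟨ht, hxs.trans hm.1, hm.2⟩) (not_le.2 hm.1)).2.2 y ⟨hsy, le_rfl⟩).2
      rw [hfil, Finset.sum_insert hns, h2]
      have h3 := intervalIntegral.integral_add_adjacent_intervals
        (H.intervalIntegrable x s (by
          rw [Set.uIcc_of_le hxs.le]; exact fun t ht => hD ⟨ht.1, ht.2.trans hsy.le⟩))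
        (H.intervalIntegrable s y (by
          rw [Set.uIcc_of_le hsy.le]; exact fun t ht => hD ⟨hxs.le.trans ht.1, ht.2⟩))
      linarith
    · rw [Finset.not_nonempty_iff_eq_empty] at hne
      exact ih y hxy hD (by simp [hne])

/-- Away from the exceptional points the right limits form a primitive. -/
theorem isPrimitiveOn (H : IsPiecewisePrimitive f g D F) :
    IsPrimitiveOn (meanLim 1 f) g (D \ F) := by
  have key : ∀ x y, x < y → Set.Icc x y ⊆ D \ F →
      ∫ t in x..y, g t = meanLim 1 f y - meanLim 1 f x := by
    intro x y hxy hsub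
    have := H.past_sub_future y hxy (fun t ht => (hsub ht).1)
    have hy := hsub (Set.right_mem_Icc.2 hxy.le)
    rw [← H.past_eq_future hy.1 hy.2, this]
    have he : (F.filter fun t => x < t ∧ t < y) = ∅ := by
      refine Finset.filter_eq_empty_iff.2 fun {t} ht hm => ?_
      exact (hsub ⟨hm.1.le, hm.2.le⟩).2 ht
    rw [he]
    simp
  intro x y hxy
  refine ⟨H.intervalIntegrable x y fun t ht => (hxy ht).1, ?_⟩
  rcases lt_trichotomy x y with h | h | h
  · exact key x y h (by rwa [Set.uIcc_of_le h.le] at hxy)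
  · simp [h]
  · rw [intervalIntegral.integral_symm, key y x h (by rwa [Set.uIcc_of_ge h.le] at hxy)]
    ring

end IsPiecewisePrimitive

/-! ### Removal of the jumps on a single line by a barrier. -/

namespace IsPiecewisePrimitive

variable {f g b b' : ℝ → ℝ} {D : Set ℝ} {F : Finset ℝ}

/-- Unlike `f`, its right-limit representative has ordinary one-sided limits, as needed for genuine
continuity of the truncated function. -/
theorem tendsto_meanLim_right (H : IsPiecewisePrimitive f g D F) {x : ℝ} (hx : x ∈ D) :
    Tendsto (meanLim 1 f) (𝓝[>] x) (𝓝 (meanLim 1 f x)) := by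
  obtain ⟨ε, hε, hD, hF⟩ := H.exists_Icc hx
  have hD' : Set.Icc x (x + ε) ⊆ D := fun t ht => hD ⟨by linarith [ht.1], ht.2⟩
  have h := (H.exists_eq (a := x) (b := x + ε) (by linarith) hD' fun t ht hm =>
    hm.1.ne' (hF t ht ⟨by linarith [hm.1], hm.2.le⟩)).2.1
  have hcont : ContinuousOn (fun τ => meanLim 1 f x + ∫ t in x..τ, g t) (Set.Icc x (x + ε)) := by
    have := intervalIntegral.continuousOn_primitive_interval'
      (H.intervalIntegrable x (x + ε) (by rwa [Set.uIcc_of_le (by linarith)])) Set.left_mem_uIcc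
    rw [Set.uIcc_of_le (by linarith)] at this
    exact continuousOn_const.add this
  have h1 : Tendsto (fun τ => meanLim 1 f x + ∫ t in x..τ, g t) (𝓝[>] x) (𝓝 (meanLim 1 f x)) := by
    have := hcont x ⟨le_rfl, by linarith⟩
    rw [ContinuousWithinAt] at this
    simp only [intervalIntegral.integral_same, add_zero] at this
    refine this.mono_left ?_
    rw [← nhdsWithin_Ioo_eq_nhdsGT (show x < x + ε by linarith)]
    exact nhdsWithin_mono _ Set.Ioo_subset_Icc_self
  refine h1.congr' ?_
  filter_upwards [Ioo_mem_nhdsGT (show x < x + ε by linarith)] with s hs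
  exact (h s ⟨hs.1.le, hs.2⟩).2.symm

theorem tendsto_meanLim_left (H : IsPiecewisePrimitive f g D F) {x : ℝ} (hx : x ∈ D) :
    Tendsto (meanLim 1 f) (𝓝[<] x) (𝓝 (meanLim (-1) f x)) := by
  obtain ⟨ε, hε, hD, hF⟩ := H.exists_Icc hx
  have hlt : x - ε < x := by linarith
  have hD' : Set.Icc (x - ε) x ⊆ D := fun t ht => hD ⟨ht.1, by linarith [ht.2]⟩
  have h := (H.exists_eq hlt hD' fun t ht hm =>
    hm.2.ne (hF t ht ⟨hm.1.le, by linarith [hm.2]⟩)).2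
  have hcont : ContinuousOn (fun τ => meanLim 1 f (x - ε) + ∫ t in (x - ε)..τ, g t)
      (Set.Icc (x - ε) x) := by
    have := intervalIntegral.continuousOn_primitive_interval'
      (H.intervalIntegrable (x - ε) x (by rwa [Set.uIcc_of_le hlt.le])) Set.left_mem_uIcc
    rw [Set.uIcc_of_le hlt.le] at this
    exact continuousOn_const.add this
  have h1 : Tendsto (fun τ => meanLim 1 f (x - ε) + ∫ t in (x - ε)..τ, g t) (𝓝[<] x)
      (𝓝 (meanLim (-1) f x)) := by
    rw [(h.2 x ⟨hlt, le_rfl⟩).2]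
    refine (hcont x ⟨hlt.le, le_rfl⟩).mono_left ?_
    rw [← nhdsWithin_Ioo_eq_nhdsLT hlt]
    exact nhdsWithin_mono _ Set.Ioo_subset_Icc_self
  refine h1.congr' ?_
  filter_upwards [Ioo_mem_nhdsLT hlt] with s hs
  exact (h.1 s ⟨hs.1.le, hs.2⟩).2.symm

/-- Cutting `f` off by a barrier lying below both one-sided limits at all exceptional points
removes the jumps. -/
theorem min_barrier (H : IsPiecewisePrimitive f g D F) (hg : Measurable g) (hb : Measurable b)
    (hb' : Measurable b') (hp : IsPrimitiveOn b b' D)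
    (hle : ∀ t ∈ F, t ∈ D → b t ≤ meanLim 1 f t ∧ b t ≤ meanLim (-1) f t) :
    IsPrimitiveOn (fun t => min (meanLim 1 f t) (b t)) (fun t => if f t ≤ b t then g t else b' t)
      D := by
  have hP := H.isPrimitiveOn.min (hp.mono (Set.sdiff_subset (t := (F : Set ℝ))))
  have hmeas : Measurable fun t => if f t ≤ b t then g t else b' t :=
    Measurable.ite (measurableSet_le H.measurable hb) hg hb'
  have hint : ∀ x y, Set.uIcc x y ⊆ D →
      IntervalIntegrable (fun t => if f t ≤ b t then g t else b' t) volume x y := by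
    intro x y hxy
    refine ((H.intervalIntegrable x y hxy).norm.add (hp x y hxy).1.norm).mono_fun
      hmeas.aestronglyMeasurable (ae_of_all _ fun t => ?_)
    simp only [Real.norm_eq_abs]
    rw [abs_of_nonneg (add_nonneg (abs_nonneg (g t)) (abs_nonneg (b' t)))]
    split_ifs
    · linarith [abs_nonneg (b' t)]
    · linarith [abs_nonneg (g t)]
  have hDF : IsOpen (D \ (F : Set ℝ)) := H.isOpen.sdiff F.finite_toSet.isClosed
  -- At an exceptional point both one-sided limits of the minimum equal `b t`, because `b t` lies
  -- below both limits of `f`.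
  have hcont : ContinuousOn (fun t => min (meanLim 1 f t) (b t)) D := by
    intro t ht
    refine ContinuousAt.continuousWithinAt ?_
    by_cases htF : t ∈ F
    · obtain ⟨h₁, h₂⟩ := hle t htF ht
      have hbt : ContinuousAt b t := (hp.continuousOn H.isOpen).continuousAt (H.isOpen.mem_nhds ht)
      rw [continuousAt_iff_continuous_left'_right']
      constructor
      · have := (H.tendsto_meanLim_left ht).min (hbt.mono_left nhdsWithin_le_nhds)
        rw [min_eq_right h₂] at this
        rw [ContinuousWithinAt, min_eq_right h₁]
        exact this
      · exact (H.tendsto_meanLim_right ht).min (hbt.mono_left nhdsWithin_le_nhds)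
    · exact (hP.continuousOn hDF).continuousAt (hDF.mem_nhds ⟨ht, htF⟩)
  intro x y hxy
  refine ⟨hint x y hxy, ?_⟩
  set G := fun t => min (meanLim 1 f t) (b t) with hG
  set G' := fun t => if f t ≤ b t then g t else b' t with hG'
  -- The difference of `G` and the integral of `G'` is continuous and locally constant off the
  -- finite set `F`, hence constant.
  have hK := integral_eq_of_hasDerivAt_off_countable
    (fun s => G s - ∫ t in x..s, G' t) (fun _ => (0 : ℝ)) (a := x) (b := y)
    F.countable_toSet
    ((hcont.mono hxy).sub (intervalIntegral.continuousOn_primitive_interval' (hint x y hxy)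
      Set.left_mem_uIcc)) ?_ intervalIntegrable_const
  · simp only [intervalIntegral.integral_zero, intervalIntegral.integral_same] at hK
    linarith
  · rintro s ⟨hs, hsF⟩
    have hsu : s ∈ Set.uIcc x y := Set.Ioo_subset_Icc_self hs
    obtain ⟨ε, hε, hD, hF⟩ := H.exists_Icc (hxy hsu)
    refine (hasDerivAt_const s (G s - ∫ t in x..s, G' t)).congr_of_eventuallyEq ?_
    filter_upwards [Icc_mem_nhds (show s - ε < s by linarith) (show s < s + ε by linarith),
      Ioo_mem_nhds hs.1 hs.2] with r hr hr'
    have hru : r ∈ Set.uIcc x y := Set.Ioo_subset_Icc_self hr'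
    have hsr : Set.uIcc s r ⊆ Set.Icc (s - ε) (s + ε) :=
      Set.uIcc_subset_Icc ⟨by linarith, by linarith⟩ hr
    have hsub : Set.uIcc s r ⊆ D \ (F : Set ℝ) := fun t ht =>
      ⟨hD (hsr ht), fun htF => hsF (hF t htF (hsr ht) ▸ htF)⟩
    have h1 := (hP s r hsub).2
    -- The branch is chosen by `f` in one integrand and by its right limits in the other; these
    -- agree almost everywhere.
    have h2 : ∫ t in s..r, G' t = ∫ t in s..r,
        (if meanLim 1 f t ≤ b t then g t else b' t) := by
      refine intervalIntegral.integral_congr_ae ?_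
      filter_upwards [H.ae_eq] with t ht hm
      rw [hG']
      simp only
      rw [ht (hsub (Set.uIoc_subset_uIcc hm)).1]
    have h3 := intervalIntegral.integral_add_adjacent_intervals
      (hint x s ((Set.uIcc_subset_uIcc_left hsu).trans hxy))
      (hint s r ((Set.uIcc_subset_uIcc hsu hru).trans hxy))
    change G r - ∫ t in x..r, G' t = G s - ∫ t in x..s, G' t
    rw [h2, h1] at h3
    change _ + (G r - G s) = _ at h3
    linarith

/-- Off a null set, `f` exceeds the lower one-sided limit at an exceptional point by at most the
jumps and the variation in between. -/
theorem ae_sub_le (H : IsPiecewisePrimitive f g D F) :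
    ∀ᵐ τ, ∀ s ∈ F, Set.uIcc s τ ⊆ D →
      f τ - min (meanLim 1 f s) (meanLim (-1) f s) ≤
        (∫ t in Set.uIoc s τ, |g t|) + ∑ t ∈ F, |meanLim 1 f t - meanLim (-1) f t| := by
  have hF0 : volume (F : Set ℝ) = 0 := F.finite_toSet.measure_zero _
  filter_upwards [H.ae_eq, measure_eq_zero_iff_ae_notMem.1 hF0] with τ hτ hτF s hs hsub
  have hτD : τ ∈ D := hsub Set.right_mem_uIcc
  rw [hτ hτD]
  -- The jump at `s` is not among those strictly between `s` and `τ`. It pays for passing from the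
  -- limit facing `τ` to the lower one, and the total still contains every jump only once.
  have hsum : ∀ p : ℝ → Prop, ∀ [DecidablePred p], ¬ p s →
      |∑ t ∈ F with p t, (meanLim 1 f t - meanLim (-1) f t)| +
        |meanLim 1 f s - meanLim (-1) f s| ≤
        ∑ t ∈ F, |meanLim 1 f t - meanLim (-1) f t| := by
    intro p _ hp
    have hns : s ∉ F.filter p := fun h => hp (Finset.mem_filter.1 h).2
    calc _ ≤ (∑ t ∈ F with p t, |meanLim 1 f t - meanLim (-1) f t|) +
          |meanLim 1 f s - meanLim (-1) f s| := by
          gcongr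
          exact Finset.abs_sum_le_sum_abs _ _
      _ = ∑ t ∈ insert s (F.filter p), |meanLim 1 f t - meanLim (-1) f t| := by
          rw [Finset.sum_insert hns, add_comm]
      _ ≤ _ := Finset.sum_le_sum_of_subset_of_nonneg
          (Finset.insert_subset hs (Finset.filter_subset _ _)) fun _ _ _ => abs_nonneg _
  rcases lt_trichotomy s τ with h | h | h
  · rw [Set.uIcc_of_le h.le] at hsub
    have h1 := H.past_sub_future τ h hsub
    rw [H.past_eq_future hτD (by simpa using hτF)] at h1
    have h2 := hsum (fun t => s < t ∧ t < τ) (by simp)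
    have h3 := intervalIntegral.norm_integral_le_integral_norm (f := g) (μ := volume) h.le
    rw [intervalIntegral.integral_of_le (f := fun t => ‖g t‖) h.le, ← Set.uIoc_of_le h.le] at h3
    simp only [Real.norm_eq_abs] at h3
    have h4 : meanLim 1 f s - |meanLim 1 f s - meanLim (-1) f s| ≤
        min (meanLim 1 f s) (meanLim (-1) f s) :=
      le_min (by linarith [abs_nonneg (meanLim 1 f s - meanLim (-1) f s)])
        (by linarith [le_abs_self (meanLim 1 f s - meanLim (-1) f s)])
    linarith [le_abs_self (∫ t in s..τ, g t),
      le_abs_self (∑ t ∈ F with s < t ∧ t < τ, (meanLim 1 f t - meanLim (-1) f t))]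
  · exact absurd (h ▸ hs) (by simpa using hτF)
  · rw [Set.uIcc_of_ge h.le] at hsub
    have h1 := H.past_sub_future s h hsub
    have h2 := hsum (fun t => τ < t ∧ t < s) (by simp)
    have h3 := intervalIntegral.norm_integral_le_integral_norm (f := g) (μ := volume) h.le
    rw [intervalIntegral.integral_of_le (f := fun t => ‖g t‖) h.le, ← Set.uIoc_of_ge h.le] at h3
    simp only [Real.norm_eq_abs] at h3
    have h4 : meanLim (-1) f s - |meanLim 1 f s - meanLim (-1) f s| ≤
        min (meanLim 1 f s) (meanLim (-1) f s) :=
      le_min (by linarith [neg_abs_le (meanLim 1 f s - meanLim (-1) f s)])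
        (by linarith [abs_nonneg (meanLim 1 f s - meanLim (-1) f s)])
    linarith [neg_abs_le (∫ t in τ..s, g t),
      neg_abs_le (∑ t ∈ F with τ < t ∧ t < s, (meanLim 1 f t - meanLim (-1) f t))]

end IsPiecewisePrimitive

/-! ### Cones -/

theorem isPrimitiveOn_const (c : ℝ) (U : Set ℝ) : IsPrimitiveOn (fun _ => c) (fun _ => 0) U :=
  fun x y _ => ⟨intervalIntegrable_const, by simp⟩

theorem isPrimitiveOn_cone (m κ s : ℝ) (U : Set ℝ) :
    IsPrimitiveOn (fun τ => m + κ * |τ - s|) (fun τ => if s < τ then κ else -κ) U := by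
  intro x y _
  have hm : Measurable fun τ : ℝ => if s < τ then κ else -κ :=
    Measurable.ite measurableSet_Ioi measurable_const measurable_const
  have hint : IntervalIntegrable (fun τ : ℝ => if s < τ then κ else -κ) volume x y :=
    (intervalIntegrable_const (c := |κ|)).mono_fun hm.aestronglyMeasurable
      (ae_of_all _ fun τ => by simp only; split_ifs <;> simp)
  refine ⟨hint, ?_⟩
  refine integral_eq_of_hasDerivAt_off_countable (fun τ => m + κ * |τ - s|) _
    (Set.countable_singleton s) (by fun_prop) ?_ hint
  rintro τ ⟨-, hτ⟩
  rcases lt_or_gt_of_ne (show τ ≠ s from hτ) with h | h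
  · rw [if_neg (not_lt.2 h.le)]
    have : HasDerivAt (fun τ => m + κ * (s - τ)) (-κ) τ := by
      simpa using (((hasDerivAt_id τ).const_sub s).const_mul κ).const_add m
    refine this.congr_of_eventuallyEq ?_
    filter_upwards [Iio_mem_nhds h] with r hr
    rw [abs_of_neg (sub_neg.2 hr)]
    ring
  · rw [if_pos h]
    have : HasDerivAt (fun τ => m + κ * (τ - s)) κ τ := by
      simpa using (((hasDerivAt_id τ).sub_const s).const_mul κ).const_add m
    refine this.congr_of_eventuallyEq ?_
    filter_upwards [Ioi_mem_nhds h] with r hr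
    rw [abs_of_pos (sub_pos.2 hr)]

open Classical in
/-- A cone over the part of `D` that can be joined to its vertex, completed by a constant. -/
theorem isPrimitiveOn_ite_cone (m κ s M : ℝ) (D : Set ℝ) :
    IsPrimitiveOn (fun τ => if Set.uIcc s τ ⊆ D then m + κ * |τ - s| else M)
      (fun τ => if Set.uIcc s τ ⊆ D then (if s < τ then κ else -κ) else 0) D := by
  intro x y hxy
  -- Being joined to `s` inside `D` is constant along a segment contained in `D`, so only one branch
  -- occurs there.
  have hiff : ∀ t ∈ Set.uIcc x y, (Set.uIcc s t ⊆ D ↔ Set.uIcc s x ⊆ D) := by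
    intro t ht
    have h1 : Set.uIcc x t ⊆ D := (Set.uIcc_subset_uIcc_left ht).trans hxy
    constructor
    · intro h
      exact Set.uIcc_subset_uIcc_union_uIcc.trans (Set.union_subset h (by rwa [Set.uIcc_comm]))
    · intro h
      exact Set.uIcc_subset_uIcc_union_uIcc.trans (Set.union_subset h h1)
  have hy := hiff y Set.right_mem_uIcc
  by_cases hx : Set.uIcc s x ⊆ D
  · obtain ⟨h1, h2⟩ := isPrimitiveOn_cone m κ s D x y hxy
    have he : Set.EqOn (fun τ => if Set.uIcc s τ ⊆ D then (if s < τ then κ else -κ) else 0)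
        (fun τ => if s < τ then κ else -κ) (Set.uIcc x y) := fun t ht => by
      simp only [if_pos ((hiff t ht).2 hx)]
    refine ⟨h1.congr_ae ?_, ?_⟩
    · refine (ae_restrict_iff' measurableSet_uIoc).2 (ae_of_all _ fun t ht => ?_)
      exact (he (Set.uIoc_subset_uIcc ht)).symm
    · rw [intervalIntegral.integral_congr he, h2]
      simp only [if_pos (hy.2 hx), if_pos hx]
  · obtain ⟨h1, h2⟩ := isPrimitiveOn_const M D x y hxy
    have he : Set.EqOn (fun τ => if Set.uIcc s τ ⊆ D then (if s < τ then κ else -κ) else 0)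
        (fun _ => 0) (Set.uIcc x y) := fun t ht => by
      simp only [if_neg (fun h => hx ((hiff t ht).1 h))]
    refine ⟨h1.congr_ae ?_, ?_⟩
    · refine (ae_restrict_iff' measurableSet_uIoc).2 (ae_of_all _ fun t ht => ?_)
      exact (he (Set.uIoc_subset_uIcc ht)).symm
    · rw [intervalIntegral.integral_congr he, h2]
      simp only [if_neg (fun h => hx (hy.1 h)), if_neg hx]

/-! ### Weak time derivatives and increments along time lines -/

instance : (volume : Measure (SpaceTime d)).IsAddLeftInvariant :=
  inferInstanceAs ((volume : Measure ℝ).prod (volume : Measure (Space d))).IsAddLeftInvariant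

/-- The average of `φ` over the time segment of signed length `h` ending at `p`. -/
def timeAverage (h : ℝ) (φ : SpaceTime d → ℝ) (p : SpaceTime d) : ℝ :=
  ∫ θ in Set.Icc (0 : ℝ) 1, φ (p - (θ * h, 0))

/-- The uniform measure on a time segment of length `h`. -/
def segmentMeasure (d : ℕ) (h : ℝ) : Measure (SpaceTime d) :=
  (volume.restrict (Set.Icc (0 : ℝ) 1)).map fun θ => ((θ * h, 0) : SpaceTime d)

instance (h : ℝ) : IsFiniteMeasure (segmentMeasure d h) := by
  unfold segmentMeasure; infer_instance

/-- Seen as a convolution with a finite measure, the average inherits the smoothness of `φ`, so it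
can serve as a test function. -/
theorem timeAverage_eq_convolution (h : ℝ) {φ : SpaceTime d → ℝ} (hφ : Continuous φ) :
    timeAverage h φ =
      convolution (fun _ => (1 : ℝ)) φ (ContinuousLinearMap.mul ℝ ℝ) (segmentMeasure d h) := by
  ext p
  rw [convolution_def, segmentMeasure, integral_map (by fun_prop)
    (Continuous.aestronglyMeasurable (by fun_prop))]
  simp [timeAverage]

theorem locallyIntegrable_one_segmentMeasure (h : ℝ) :
    LocallyIntegrable (fun _ : SpaceTime d => (1 : ℝ)) (segmentMeasure d h) :=
  (integrable_const 1).locallyIntegrable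

theorem contDiff_timeAverage (h : ℝ) {φ : SpaceTime d → ℝ} (hφ : ContDiff ℝ ∞ φ)
    (hc : HasCompactSupport φ) : ContDiff ℝ ∞ (timeAverage h φ) := by
  rw [timeAverage_eq_convolution h hφ.continuous]
  exact hc.contDiff_convolution_right _ (locallyIntegrable_one_segmentMeasure h) hφ

theorem fderiv_timeAverage (h : ℝ) {φ : SpaceTime d → ℝ} (hφ : ContDiff ℝ ∞ φ)
    (hc : HasCompactSupport φ) (p : SpaceTime d) :
    fderiv ℝ (timeAverage h φ) p (1, 0) = timeAverage h (fun q => fderiv ℝ φ q (1, 0)) p := by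
  have h1 : ContDiff ℝ 1 φ := hφ.of_le (by norm_cast)
  have hf := h1.continuous_fderiv one_ne_zero
  obtain ⟨C, hC⟩ := (hc.fderiv ℝ).exists_bound_of_continuous hf
  have hd : HasFDerivAt (timeAverage h φ)
      (∫ θ in Set.Icc (0 : ℝ) 1, fderiv ℝ φ (p - (θ * h, 0))) p := by
    refine hasFDerivAt_integral_of_dominated_of_fderiv_le (bound := fun _ => C)
      (F' := fun q θ => fderiv ℝ φ (q - (θ * h, 0))) univ_mem
      (Eventually.of_forall fun q => Continuous.aestronglyMeasurable (by fun_prop)) ?_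
      (Continuous.aestronglyMeasurable (by fun_prop)) (ae_of_all _ fun θ q _ => hC _)
      (integrable_const C) (ae_of_all _ fun θ q _ => ?_)
    · exact (Continuous.continuousOn (by fun_prop)).integrableOn_compact isCompact_Icc
    · simpa [Function.comp_def] using ((h1.differentiable one_ne_zero (q - (θ * h, 0))).hasFDerivAt).comp q
        ((hasFDerivAt_id q).sub_const ((θ * h, 0) : SpaceTime d))
  have hi : Integrable (fun θ : ℝ => fderiv ℝ φ (p - (θ * h, 0)))
      (volume.restrict (Set.Icc (0 : ℝ) 1)) :=
    (Continuous.continuousOn (by fun_prop)).integrableOn_compact isCompact_Icc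
  rw [hd.fderiv, ContinuousLinearMap.integral_apply hi, timeAverage]

/-- The fundamental theorem of calculus along the segment. With `fderiv_timeAverage` it makes the
finite difference of `φ` the time derivative of an admissible test function, multiplied by `h`. -/
theorem mul_timeAverage_fderiv (h : ℝ) {φ : SpaceTime d → ℝ} (hφ : ContDiff ℝ ∞ φ)
    (p : SpaceTime d) :
    h * timeAverage h (fun q => fderiv ℝ φ q (1, 0)) p = φ p - φ (p - (h, 0)) := by
  have h1 : ContDiff ℝ 1 φ := hφ.of_le (by norm_cast)
  have hf := h1.continuous_fderiv one_ne_zero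
  have hd : ∀ θ : ℝ, HasDerivAt (fun θ : ℝ => φ (p - (θ * h, 0)))
      (-h * fderiv ℝ φ (p - (θ * h, 0)) (1, 0)) θ := by
    intro θ
    have a1 : HasDerivAt (fun θ : ℝ => (p - (θ * h, 0) : SpaceTime d)) (-(h, 0)) θ := by
      have : HasDerivAt (fun θ : ℝ => ((θ * h, 0) : SpaceTime d)) (h, 0) θ := by
        simpa using ((hasDerivAt_id θ).mul_const h).prodMk (hasDerivAt_const θ (0 : Space d))
      exact this.const_sub p
    have a2 := ((h1.differentiable one_ne_zero (p - (θ * h, 0))).hasFDerivAt).comp_hasDerivAt θ a1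
    have e : (-(h, 0) : SpaceTime d) = (-h) • ((1, 0) : SpaceTime d) := by simp
    rw [e, map_smul, smul_eq_mul] at a2
    exact a2
  have hcont : Continuous fun θ : ℝ => -h * fderiv ℝ φ (p - (θ * h, 0)) (1, 0) := by fun_prop
  have := intervalIntegral.integral_eq_sub_of_hasDerivAt (fun θ _ => hd θ)
    (hcont.intervalIntegrable 0 1)
  rw [intervalIntegral.integral_const_mul, intervalIntegral.integral_of_le zero_le_one,
    ← integral_Icc_eq_integral_Ioc] at this
  simp only [zero_mul, one_mul] at this
  rw [timeAverage]
  have e : φ (p - (0, 0)) = φ p := by congr 1; exact sub_zero p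
  rw [e] at this
  linarith

theorem timeAverage_eq_zero {h : ℝ} {φ : SpaceTime d → ℝ} {K : Set (SpaceTime d)}
    (hK : ∀ q ∈ tsupport φ, ∀ θ ∈ Set.Icc (0 : ℝ) 1, q + (θ * h, 0) ∈ K) {p : SpaceTime d}
    (hp : p ∉ K) {θ : ℝ} (hθ : θ ∈ Set.Icc (0 : ℝ) 1) : φ (p - (θ * h, 0)) = 0 := by
  by_contra hne
  have := hK _ (subset_tsupport _ (Function.mem_support.2 hne)) θ hθ
  exact hp (by simpa using this)

/-- The set swept by translating `K` along time segments of length `h`. -/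
def sweep (h : ℝ) (K : Set (SpaceTime d)) : Set (SpaceTime d) :=
  (fun x : SpaceTime d × ℝ => x.1 + (x.2 * h, 0)) '' (K ×ˢ Set.Icc (0 : ℝ) 1)

theorem isCompact_sweep {h : ℝ} {K : Set (SpaceTime d)} (hK : IsCompact K) :
    IsCompact (sweep h K) :=
  (hK.prod isCompact_Icc).image (by fun_prop)

theorem mem_sweep {h : ℝ} {K : Set (SpaceTime d)} {q : SpaceTime d} (hq : q ∈ K) {θ : ℝ}
    (hθ : θ ∈ Set.Icc (0 : ℝ) 1) : q + (θ * h, 0) ∈ sweep h K :=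
  ⟨(q, θ), ⟨hq, hθ⟩, rfl⟩

theorem tsupport_timeAverage_subset {h : ℝ} {φ : SpaceTime d → ℝ} {K : Set (SpaceTime d)}
    (hKc : IsClosed K) (hK : ∀ q ∈ tsupport φ, ∀ θ ∈ Set.Icc (0 : ℝ) 1, q + (θ * h, 0) ∈ K) :
    tsupport (timeAverage h φ) ⊆ K := by
  refine closure_minimal (fun p hp => ?_) hKc
  by_contra hpK
  refine hp ?_
  rw [timeAverage, setIntegral_congr_fun measurableSet_Icc fun θ hθ => timeAverage_eq_zero hK hpK hθ]
  simp

/-- The increment of `U` over a time segment of length `h`, minus the integral of `V`. -/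
def incrementDefect (h : ℝ) (U V : SpaceTime d → ℝ) (p : SpaceTime d) : ℝ :=
  U (p + (h, 0)) - U p - h * ∫ θ in Set.Icc (0 : ℝ) 1, V (p + (θ * h, 0))

/-- Each fibre is translated, so the product measure is preserved; this gives the integrability
needed to exchange the average with the space-time integral. -/
theorem measurePreserving_shear (h : ℝ) :
    MeasurePreserving (fun x : ℝ × SpaceTime d => (x.1, x.2 + (x.1 * h, 0)))
      ((volume.restrict (Set.Icc (0 : ℝ) 1)).prod volume)
      ((volume.restrict (Set.Icc (0 : ℝ) 1)).prod volume) :=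
  (MeasurePreserving.id _).skew_product (g := fun θ p => p + (θ * h, (0 : Space d)))
    (by unfold Function.uncurry; fun_prop)
    (ae_of_all _ fun θ => map_add_right_eq_self _ _)

theorem integrable_mul_shift {V φ : SpaceTime d → ℝ} (hV : Integrable V) (hφ : Continuous φ)
    (hc : HasCompactSupport φ) (h : ℝ) :
    Integrable (fun x : ℝ × SpaceTime d => V x.2 * φ (x.2 - (x.1 * h, 0)))
      ((volume.restrict (Set.Icc (0 : ℝ) 1)).prod volume) := by
  obtain ⟨C, hC⟩ := hc.exists_bound_of_continuous hφ
  exact (hV.comp_snd _).mul_bdd (c := C)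
    (Continuous.aestronglyMeasurable (by fun_prop)) (ae_of_all _ fun x => hC _)

theorem integrable_shift_mul {V φ : SpaceTime d → ℝ} (hV : Integrable V) (hφ : Continuous φ)
    (hc : HasCompactSupport φ) (h : ℝ) :
    Integrable (fun x : ℝ × SpaceTime d => V (x.2 + (x.1 * h, 0)) * φ x.2)
      ((volume.restrict (Set.Icc (0 : ℝ) 1)).prod volume) := by
  have h1 := integrable_mul_shift hV hφ hc h
  have := ((measurePreserving_shear (d := d) h).integrable_comp h1.aestronglyMeasurable).2 h1
  simpa [Function.comp_def] using this

theorem integrable_average {V : SpaceTime d → ℝ} (hV : Integrable V) (h : ℝ) :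
    Integrable (fun p => ∫ θ in Set.Icc (0 : ℝ) 1, V (p + (θ * h, 0))) := by
  have h1 : Integrable (fun x : ℝ × SpaceTime d => V x.2)
      ((volume.restrict (Set.Icc (0 : ℝ) 1)).prod volume) := hV.comp_snd _
  have := ((measurePreserving_shear (d := d) h).integrable_comp h1.aestronglyMeasurable).2 h1
  exact this.integral_prod_right

theorem integrable_incrementDefect {U V : SpaceTime d → ℝ} (hU : Integrable U)
    (hV : Integrable V) (h : ℝ) : Integrable (incrementDefect h U V) :=
  ((hU.comp_add_right _).sub hU).sub ((integrable_average hV h).const_mul h)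

/-- Discrete integration by parts: translation invariance moves the shifts from `φ` to `U` and `V`.
Both directions of the characterization of weak derivatives rest on it. -/
theorem integral_shift_identity {U V φ : SpaceTime d → ℝ} (hU : Integrable U) (hV : Integrable V)
    (hφ : Continuous φ) (hc : HasCompactSupport φ) (h : ℝ) :
    (∫ p, U p * (φ p - φ (p - (h, 0)))) + h * ∫ p, V p * timeAverage h φ p =
      -∫ p, φ p * incrementDefect h U V p := by
  obtain ⟨C, hC⟩ := hc.exists_bound_of_continuous hφ
  have i1 : Integrable fun p => U p * φ p :=
    hU.mul_bdd (c := C) hφ.aestronglyMeasurable (ae_of_all _ hC)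
  have i2 : Integrable fun p => U p * φ (p - (h, 0)) :=
    hU.mul_bdd (c := C) (Continuous.aestronglyMeasurable (by fun_prop)) (ae_of_all _ fun p => hC _)
  have i3 : Integrable fun p => U (p + (h, 0)) * φ p :=
    (hU.comp_add_right _).mul_bdd (c := C) hφ.aestronglyMeasurable (ae_of_all _ hC)
  have i4 : Integrable fun p => (h * ∫ θ in Set.Icc (0 : ℝ) 1, V (p + (θ * h, 0))) * φ p :=
    ((integrable_average hV h).const_mul h).mul_bdd (c := C) hφ.aestronglyMeasurable
      (ae_of_all _ hC)
  have e1 : ∫ p, U p * φ (p - (h, 0)) = ∫ p, U (p + (h, 0)) * φ p := by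
    rw [← integral_add_right_eq_self _ ((h, 0) : SpaceTime d)]
    simp
  have e2 : ∫ p, V p * timeAverage h φ p =
      ∫ p, (∫ θ in Set.Icc (0 : ℝ) 1, V (p + (θ * h, 0))) * φ p := by
    simp only [timeAverage, ← integral_const_mul, ← integral_mul_const]
    have s1 := integral_integral_swap (f := fun (θ : ℝ) p => V p * φ (p - (θ * h, 0)))
      (integrable_mul_shift hV hφ hc h)
    have s2 := integral_integral_swap (f := fun (θ : ℝ) p => V (p + (θ * h, 0)) * φ p)
      (integrable_shift_mul hV hφ hc h)
    rw [← s1, ← s2]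
    congr 1
    ext θ
    rw [← integral_add_right_eq_self _ ((θ * h, 0) : SpaceTime d)]
    simp
  simp only [mul_sub]
  rw [integral_sub i1 i2, e1, e2]
  have e3 : ∫ p, φ p * incrementDefect h U V p =
      (∫ p, U (p + (h, 0)) * φ p) - (∫ p, U p * φ p) -
        ∫ p, (h * ∫ θ in Set.Icc (0 : ℝ) 1, V (p + (θ * h, 0))) * φ p := by
    rw [← integral_sub i3 i1]
    refine Eq.trans ?_ (integral_sub (i3.sub i1) i4)
    congr 1
    ext p
    simp only [incrementDefect]
    ring
  rw [e3]
  simp only [mul_assoc, integral_const_mul]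
  ring

/-- Tube lemma over the compact parameter interval. -/
theorem isOpen_forall_Icc {X : Type*} [TopologicalSpace X] {D : Set (SpaceTime d)} (hD : IsOpen D)
    {Φ : X → ℝ → SpaceTime d} (hΦ : Continuous (Function.uncurry Φ)) :
    IsOpen {x | ∀ θ ∈ Set.Icc (0 : ℝ) 1, Φ x θ ∈ D} := by
  rw [isOpen_iff_mem_nhds]
  intro x hx
  exact isCompact_Icc.eventually_forall_of_forall_eventually fun θ hθ =>
    hΦ.continuousAt.eventually (hD.mem_nhds (hx θ hθ))

theorem integrable_indicator_of_locallyIntegrableOn {A K : Set (SpaceTime d)}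
    {u : SpaceTime d → ℝ} (hu : LocallyIntegrableOn u A) (hK : IsCompact K) (hKA : K ⊆ A) :
    Integrable (K.indicator u) :=
  (hu.integrableOn_compact_subset hKA hK).integrable_indicator hK.measurableSet

theorem setIntegral_mul_eq {A K : Set (SpaceTime d)} (hKA : K ⊆ A) {u ψ : SpaceTime d → ℝ}
    (hψ : ∀ p ∉ K, ψ p = 0) : ∫ p in A, u p * ψ p = ∫ p, K.indicator u p * ψ p := by
  rw [setIntegral_eq_integral_of_forall_compl_eq_zero fun p hp => by
    rw [hψ p (fun h => hp (hKA h)), mul_zero]]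
  congr 1
  ext p
  by_cases hp : p ∈ K
  · rw [Set.indicator_of_mem hp]
  · rw [hψ p hp, mul_zero, mul_zero]

theorem incrementDefect_indicator {h : ℝ} {K : Set (SpaceTime d)} {u v : SpaceTime d → ℝ}
    {p : SpaceTime d} (hp : ∀ θ ∈ Set.Icc (0 : ℝ) 1, p + (θ * h, 0) ∈ K) :
    incrementDefect h (K.indicator u) (K.indicator v) p = incrementDefect h u v p := by
  have h0 : p ∈ K := by
    have := hp 0 ⟨le_rfl, zero_le_one⟩
    rwa [zero_mul, show p + ((0, 0) : SpaceTime d) = p from add_zero p] at this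
  have h1 : p + (h, 0) ∈ K := by simpa using hp 1 ⟨zero_le_one, le_rfl⟩
  simp only [incrementDefect]
  rw [Set.indicator_of_mem h0, Set.indicator_of_mem h1, setIntegral_congr_fun measurableSet_Icc
    fun θ hθ => Set.indicator_of_mem (hp θ hθ) v]

/-- A function with a weak time derivative satisfies the fundamental theorem of calculus along
almost all time segments of a given length. -/
theorem HasWeakTimeDeriv.ae_incrementDefect_eq_zero {u v : SpaceTime d → ℝ}
    {A : Set (SpaceTime d)} (hA : IsOpen A) (H : HasWeakTimeDeriv u v A) (h : ℝ) :
    ∀ᵐ p, (∀ θ ∈ Set.Icc (0 : ℝ) 1, p + (θ * h, 0) ∈ A) → incrementDefect h u v p = 0 := by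
  set W : Set (SpaceTime d) := {p | ∀ θ ∈ Set.Icc (0 : ℝ) 1, p + (θ * h, 0) ∈ A} with hW
  have hWo : IsOpen W :=
    isOpen_forall_Icc hA (Φ := fun p θ => p + (θ * h, 0)) (by unfold Function.uncurry; fun_prop)
  have hsw : ∀ K ⊆ W, sweep h K ⊆ A := by
    rintro K hK _ ⟨⟨q, θ⟩, ⟨hq, hθ⟩, rfl⟩
    exact hK hq θ hθ
  refine hWo.ae_eq_zero_of_integral_contDiff_smul_eq_zero (f := incrementDefect h u v) ?_ ?_
  · rw [locallyIntegrableOn_iff hWo.isLocallyClosed]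
    intro K hKW hK
    have hi := integrable_incrementDefect
      (integrable_indicator_of_locallyIntegrableOn H.locInt (isCompact_sweep hK) (hsw K hKW))
      (integrable_indicator_of_locallyIntegrableOn H.locInt_deriv (isCompact_sweep hK) (hsw K hKW)) h
    refine hi.integrableOn.congr_fun (fun p hp => ?_) hK.measurableSet
    exact incrementDefect_indicator fun θ hθ => mem_sweep hp hθ
  · intro φ hφ hc hsupp
    have hKc : IsCompact (sweep h (tsupport φ)) := isCompact_sweep hc
    have hKA := hsw _ hsupp
    have hK : ∀ q ∈ tsupport φ, ∀ θ ∈ Set.Icc (0 : ℝ) 1, q + (θ * h, 0) ∈ sweep h (tsupport φ) :=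
      fun q hq θ hθ => mem_sweep hq hθ
    have hts := tsupport_timeAverage_subset hKc.isClosed hK
    -- The averaged function is supported in the swept set, which stays inside `A` by the definition
    -- of `W`.
    have hw := H.integral_eq (timeAverage h φ) (contDiff_timeAverage h hφ hc)
      (hKc.of_isClosed_subset (isClosed_tsupport _) hts) (hts.trans hKA)
    have hz : ∀ p ∉ sweep h (tsupport φ), timeAverage h φ p = 0 := fun p hp =>
      image_eq_zero_of_notMem_tsupport fun h' => hp (hts h')
    have hz' : ∀ p ∉ sweep h (tsupport φ), φ p - φ (p - (h, 0)) = 0 := fun p hp => by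
      have a := timeAverage_eq_zero hK hp (θ := 0) ⟨le_rfl, zero_le_one⟩
      have b := timeAverage_eq_zero hK hp (θ := 1) ⟨zero_le_one, le_rfl⟩
      have e : p - ((0, 0) : SpaceTime d) = p := sub_zero p
      rw [one_mul] at b
      rw [zero_mul, e] at a
      rw [a, b, sub_zero]
    have hid := integral_shift_identity
      (integrable_indicator_of_locallyIntegrableOn H.locInt hKc hKA)
      (integrable_indicator_of_locallyIntegrableOn H.locInt_deriv hKc hKA) hφ.continuous hc h
    rw [← setIntegral_mul_eq hKA hz, ← setIntegral_mul_eq hKA hz'] at hid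
    have e1 : ∫ p in A, u p * (φ p - φ (p - (h, 0))) =
        h * ∫ p in A, u p * fderiv ℝ (timeAverage h φ) p (1, 0) := by
      rw [← integral_const_mul]
      congr 1
      ext p
      rw [fderiv_timeAverage h hφ hc, ← mul_timeAverage_fderiv h hφ]
      ring
    rw [e1, hw] at hid
    have e2 : ∫ p, φ p • incrementDefect h u v p = ∫ p, φ p * incrementDefect h
        ((sweep h (tsupport φ)).indicator u) ((sweep h (tsupport φ)).indicator v) p := by
      congr 1
      ext p
      by_cases hp : p ∈ tsupport φ
      · rw [incrementDefect_indicator fun θ hθ => mem_sweep hp hθ, smul_eq_mul]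
      · rw [image_eq_zero_of_notMem_tsupport hp, zero_smul, zero_mul]
    rw [e2]
    linarith

theorem tendsto_timeAverage {ψ : SpaceTime d → ℝ} (hψ : Continuous ψ)
    (hc : HasCompactSupport ψ) {U : SpaceTime d → ℝ} (hU : Integrable U) {h : ℕ → ℝ}
    (hh : Tendsto h atTop (𝓝 0)) :
    Tendsto (fun n => ∫ p, U p * timeAverage (h n) ψ p) atTop (𝓝 (∫ p, U p * ψ p)) := by
  obtain ⟨C, hC⟩ := hc.exists_bound_of_continuous hψ
  have hm : ∀ n, Continuous fun p => timeAverage (h n) ψ p := fun n => by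
    unfold timeAverage
    exact continuous_parametric_integral_of_continuous (by fun_prop) isCompact_Icc
  have hb : ∀ n p, ‖timeAverage (h n) ψ p‖ ≤ C := fun n p => by
    have := norm_setIntegral_le_of_norm_le_const (μ := volume) (s := Set.Icc (0 : ℝ) 1) (by simp)
      fun θ _ => hC (p - (θ * h n, 0))
    simpa [timeAverage] using this
  refine tendsto_integral_of_dominated_convergence (fun p => ‖U p‖ * C)
    (fun n => hU.aestronglyMeasurable.mul (hm n).aestronglyMeasurable) (hU.norm.mul_const C)
    (fun n => ae_of_all _ fun p => ?_) (ae_of_all _ fun p => Tendsto.const_mul _ ?_)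
  · rw [norm_mul]
    exact mul_le_mul_of_nonneg_left (hb n p) (norm_nonneg _)
  · have e : ψ p = ∫ θ in Set.Icc (0 : ℝ) 1, ψ p := by simp
    rw [e]
    refine tendsto_integral_of_dominated_convergence (fun _ => C)
      (fun n => Continuous.aestronglyMeasurable (by fun_prop)) (integrable_const C)
      (fun n => ae_of_all _ fun θ => hC _) (ae_of_all _ fun θ => ?_)
    have : Tendsto (fun n => p - ((θ * h n, 0) : SpaceTime d)) atTop (𝓝 (p - (θ * 0, 0))) :=
      tendsto_const_nhds.sub ((hh.const_mul θ).prodMk_nhds tendsto_const_nhds)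
    rw [mul_zero, show p - ((0, 0) : SpaceTime d) = p from sub_zero p] at this
    exact (hψ.tendsto p).comp this

/-- The fundamental theorem of calculus along almost all time segments characterizes the weak
time derivative. -/
theorem hasWeakTimeDeriv_of_ae {u v : SpaceTime d → ℝ} {A : Set (SpaceTime d)} (hA : IsOpen A)
    (hu : LocallyIntegrableOn u A) (hv : LocallyIntegrableOn v A)
    (H : ∀ h : ℝ, ∀ᵐ p, (∀ θ ∈ Set.Icc (0 : ℝ) 1, p + (θ * h, 0) ∈ A) →
      incrementDefect h u v p = 0) :
    HasWeakTimeDeriv u v A := by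
  refine ⟨hu, hv, fun φ hφ hc hsupp => ?_⟩
  -- The thickening leaves room for all shifts of length at most `δ`. The identity at scale `h n`,
  -- divided by `h n`, then yields the weak derivative as `h n → 0`.
  obtain ⟨δ, hδ, hK⟩ := hc.isCompact.exists_cthickening_subset_open hA hsupp
  set K := Metric.cthickening δ (tsupport φ) with hKdef
  have hKc : IsCompact K := hc.isCompact.cthickening
  have hsub : tsupport φ ⊆ K := Metric.self_subset_cthickening _
  have h1 : ContDiff ℝ 1 φ := hφ.of_le (by norm_cast)
  have hf := h1.continuous_fderiv one_ne_zero
  have hz : ∀ p ∉ K, φ p = 0 := fun p hp =>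
    image_eq_zero_of_notMem_tsupport fun h' => hp (hsub h')
  have hz' : ∀ p ∉ K, fderiv ℝ φ p (1, 0) = 0 := fun p hp => by
    rw [image_eq_zero_of_notMem_tsupport (f := fderiv ℝ φ) fun h' =>
      hp (hsub (tsupport_fderiv_subset ℝ h'))]
    rfl
  rw [setIntegral_mul_eq hK hz, setIntegral_mul_eq hK hz']
  have hU := integrable_indicator_of_locallyIntegrableOn hu hKc hK
  have hV := integrable_indicator_of_locallyIntegrableOn hv hKc hK
  set h : ℕ → ℝ := fun n => δ * (1 / ((n : ℝ) + 1)) with hh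
  have hlim : Tendsto h atTop (𝓝 0) := by
    simpa [hh] using tendsto_one_div_add_atTop_nhds_zero_nat.const_mul δ
  have hpos : ∀ n, 0 < h n := fun n => by positivity
  have hle : ∀ n, h n ≤ δ := fun n => by
    have : 1 / ((n : ℝ) + 1) ≤ 1 := by
      rw [div_le_one (by positivity)]
      linarith [(Nat.cast_nonneg n : (0 : ℝ) ≤ n)]
    exact mul_le_of_le_one_right hδ.le this
  have hmem : ∀ n, ∀ q ∈ tsupport φ, ∀ θ ∈ Set.Icc (0 : ℝ) 1, q + (θ * h n, 0) ∈ K := by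
    intro n q hq θ hθ
    refine Metric.mem_cthickening_of_dist_le _ q _ _ hq ?_
    rw [dist_eq_norm, add_sub_cancel_left, Prod.norm_mk, norm_zero, max_eq_left (norm_nonneg _),
      Real.norm_eq_abs, abs_of_nonneg (mul_nonneg hθ.1 (hpos n).le)]
    exact (mul_le_of_le_one_left (hpos n).le hθ.2).trans (hle n)
  have key : ∀ n, ∫ p, K.indicator u p * timeAverage (h n) (fun q => fderiv ℝ φ q (1, 0)) p =
      -∫ p, K.indicator v p * timeAverage (h n) φ p := by
    intro n
    have hid := integral_shift_identity hU hV hφ.continuous hc (h n)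
    have hz0 : ∫ p, φ p * incrementDefect (h n) (K.indicator u) (K.indicator v) p = 0 := by
      refine integral_eq_zero_of_ae ?_
      filter_upwards [H (h n)] with p hp
      by_cases hpm : p ∈ tsupport φ
      · rw [incrementDefect_indicator (hmem n p hpm), hp fun θ hθ => hK (hmem n p hpm θ hθ)]
        simp
      · rw [image_eq_zero_of_notMem_tsupport hpm]
        simp
    have e : ∫ p, K.indicator u p * (φ p - φ (p - (h n, 0))) =
        h n * ∫ p, K.indicator u p * timeAverage (h n) (fun q => fderiv ℝ φ q (1, 0)) p := by
      rw [← integral_const_mul]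
      congr 1
      ext p
      rw [← mul_timeAverage_fderiv (h n) hφ]
      ring
    rw [hz0, e, neg_zero, ← mul_add] at hid
    have := (mul_eq_zero.1 hid).resolve_left (hpos n).ne'
    linarith
  have t1 := tendsto_timeAverage (hf.clm_apply continuous_const)
    ((hc.fderiv ℝ).comp_left (g := fun L : SpaceTime d →L[ℝ] ℝ => L (1, 0)) rfl) hU hlim
  have t2 := (tendsto_timeAverage hφ.continuous hc hV hlim).neg
  simp only [key] at t1
  exact tendsto_nhds_unique t1 t2

/-! ### Bounds for the potentials -/

/-- The substitution `Z = V s` puts the integral on `[0, 1]` with a nonnegative integrand, so the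
sign of `V` needs no case distinction. -/
theorem Psi_eq (S V : ℝ) : Psi S V =
    1 / 2 * ∫ s in (0 : ℝ)..1, V ^ 2 * (1 - s) / √((V * s) ^ 2 + (1 - S) * (1 + S)) := by
  have h := intervalIntegral.mul_integral_comp_mul_left (a := 0) (b := 1)
    (f := fun Z => (V - Z) / √(Z ^ 2 + (1 - S) * (1 + S))) V
  rw [mul_zero, mul_one] at h
  rw [Psi, ← h, ← intervalIntegral.integral_const_mul]
  congr 2
  ext s
  ring

theorem one_sub_mul_one_add_pos {S : ℝ} (hS : |S| < 1) : 0 < (1 - S) * (1 + S) :=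
  mul_pos (by linarith [le_abs_self S]) (by linarith [neg_abs_le S])

theorem continuous_Psi_integrand {S : ℝ} (hS : |S| < 1) (V : ℝ) :
    Continuous fun s : ℝ => V ^ 2 * (1 - s) / √((V * s) ^ 2 + (1 - S) * (1 + S)) := by
  refine Continuous.div (by fun_prop) (by fun_prop) fun s => ?_
  have := one_sub_mul_one_add_pos hS
  positivity

/-- The root in the denominator is largest at `S = 0`. -/
theorem Psi0_le_Psi {S : ℝ} (hS : |S| < 1) (V : ℝ) : Psi0 V ≤ Psi S V := by
  have hpos := one_sub_mul_one_add_pos hS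
  rw [Psi0, Psi_eq, Psi_eq]
  gcongr
  refine intervalIntegral.integral_mono_on zero_le_one
    ((continuous_Psi_integrand (by simp) V).intervalIntegrable _ _)
    ((continuous_Psi_integrand hS V).intervalIntegrable _ _) fun s hs => ?_
  have h1 : (0 : ℝ) ≤ 1 - s := by linarith [hs.2]
  refine div_le_div_of_nonneg_left (by positivity) (by positivity) (Real.sqrt_le_sqrt ?_)
  nlinarith [sq_nonneg S]

theorem Psi_le {S a : ℝ} (hS : |S| < 1) (ha : 0 < a) (haS : a ^ 2 ≤ (1 - S) * (1 + S)) (V : ℝ) :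
    Psi S V ≤ V ^ 2 / (4 * a) := by
  rw [Psi_eq]
  have h : ∫ s in (0 : ℝ)..1, V ^ 2 * (1 - s) / √((V * s) ^ 2 + (1 - S) * (1 + S)) ≤
      ∫ s in (0 : ℝ)..1, V ^ 2 / a * (1 - s) := by
    refine intervalIntegral.integral_mono_on zero_le_one
      ((continuous_Psi_integrand hS V).intervalIntegrable _ _)
      (Continuous.intervalIntegrable (by fun_prop) _ _) fun s hs => ?_
    have h1 : (0 : ℝ) ≤ 1 - s := by linarith [hs.2]
    rw [div_mul_eq_mul_div]
    refine div_le_div_of_nonneg_left (by positivity) ha (Real.le_sqrt_of_sq_le ?_)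
    nlinarith [sq_nonneg (V * s)]
  have h2 : ∫ s in (0 : ℝ)..1, V ^ 2 / a * (1 - s) = V ^ 2 / a * (1 / 2) := by
    rw [intervalIntegral.integral_const_mul, intervalIntegral.integral_sub (by simp) (by simp)]
    norm_num
  rw [h2] at h
  calc _ ≤ 1 / 2 * (V ^ 2 / a * (1 / 2)) := by gcongr
    _ = _ := by field_simp; ring

theorem le_Psi0 (V : ℝ) : V ^ 2 / (4 * (1 + |V|)) ≤ Psi0 V := by
  rw [Psi0, Psi_eq]
  have h : ∫ s in (0 : ℝ)..1, V ^ 2 / (1 + |V|) * (1 - s) ≤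
      ∫ s in (0 : ℝ)..1, V ^ 2 * (1 - s) / √((V * s) ^ 2 + (1 - 0) * (1 + 0)) := by
    refine intervalIntegral.integral_mono_on zero_le_one
      (Continuous.intervalIntegrable (by fun_prop) _ _)
      ((continuous_Psi_integrand (by simp) V).intervalIntegrable _ _) fun s hs => ?_
    have h1 : (0 : ℝ) ≤ 1 - s := by linarith [hs.2]
    rw [div_mul_eq_mul_div]
    refine div_le_div_of_nonneg_left (by positivity) (by positivity) ?_
    rw [Real.sqrt_le_left (by positivity)]
    have h2 : (V * s) ^ 2 ≤ |V| ^ 2 := by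
      rw [sq_abs, mul_pow]
      exact mul_le_of_le_one_right (sq_nonneg V) (pow_le_one₀ hs.1 hs.2)
    nlinarith [abs_nonneg V]
  have h2 : ∫ s in (0 : ℝ)..1, V ^ 2 / (1 + |V|) * (1 - s) = V ^ 2 / (1 + |V|) * (1 / 2) := by
    rw [intervalIntegral.integral_const_mul, intervalIntegral.integral_sub (by simp) (by simp)]
    norm_num
  rw [h2] at h
  calc _ = 1 / 2 * (V ^ 2 / (1 + |V|) * (1 / 2)) := by field_simp; norm_num
    _ ≤ _ := by gcongr

theorem Psi0_nonneg (V : ℝ) : 0 ≤ Psi0 V := le_trans (by positivity) (le_Psi0 V)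

/-- For `|V| > δ` the lower bound `le_Psi0` reduces this to `δ (1 + |V|) ≤ 2 |V|`, true because `δ ≤
|V|` and `δ |V| ≤ |V|`. The second inequality is where `δ ≤ 1` enters. -/
theorem abs_le_add_Psi0 {δ : ℝ} (hδ : 0 < δ) (hδ1 : δ ≤ 1) (V : ℝ) :
    |V| ≤ δ + 8 * (δ⁻¹ * Psi0 V) := by
  have h := le_Psi0 V
  rw [← sq_abs] at h
  have hw : 0 ≤ |V| := abs_nonneg V
  have hΨ := Psi0_nonneg V
  generalize |V| = w at *
  rcases le_or_gt w δ with hle | hlt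
  · have : 0 ≤ 8 * (δ⁻¹ * Psi0 V) := by positivity
    linarith
  · have h1 : w ≤ 8 * (δ⁻¹ * (w ^ 2 / (4 * (1 + w)))) := by
      rw [show 8 * (δ⁻¹ * (w ^ 2 / (4 * (1 + w)))) = 2 * w ^ 2 / (δ * (1 + w)) by field_simp; ring,
        le_div_iff₀ (by positivity)]
      nlinarith [mul_nonneg hw (mul_nonneg hw (sub_nonneg.2 hδ1)), mul_nonneg hw (sub_nonneg.2 hlt.le)]
    have h2 : 8 * (δ⁻¹ * (w ^ 2 / (4 * (1 + w)))) ≤ 8 * (δ⁻¹ * Psi0 V) := by gcongr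
    linarith

/-- Completing the square in `√(1 - S²)`; both sign and upper bound can be read off. -/
theorem wellPotential_eq {β Jhat S : ℝ} (hβ : 0 < β) (hJ : 0 < Jhat) (hS : |S| ≤ 1) :
    wellPotential β Jhat S = Jhat / 2 * (√(1 - S ^ 2) - 1 / (β * Jhat)) ^ 2 := by
  have h1 : 0 ≤ 1 - S ^ 2 := by nlinarith [abs_nonneg S, sq_abs S]
  have h2 : S ^ 2 = 1 - √(1 - S ^ 2) ^ 2 := by rw [Real.sq_sqrt h1]; ring
  rw [wellPotential, statCost]
  generalize √(1 - S ^ 2) = y at *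
  rw [h2]
  field_simp
  ring

theorem wellPotential_nonneg {β Jhat S : ℝ} (hβ : 0 < β) (hJ : 0 < Jhat) (hS : |S| ≤ 1) :
    0 ≤ wellPotential β Jhat S := by
  rw [wellPotential_eq hβ hJ hS]
  positivity

theorem wellPotential_le {β Jhat S : ℝ} (hβ : 0 < β) (hJ : 1 < β * Jhat) (hS : |S| ≤ 1) :
    wellPotential β Jhat S ≤ Jhat / 2 := by
  have hJ0 : 0 < Jhat := pos_of_mul_pos_right (zero_lt_one.trans hJ) hβ.le
  rw [wellPotential_eq hβ hJ0 hS]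
  have h1 : √(1 - S ^ 2) ≤ 1 := by
    rw [Real.sqrt_le_one]; nlinarith [sq_nonneg S]
  have h2 : 1 / (β * Jhat) ≤ 1 := by
    rw [div_le_one (zero_lt_one.trans hJ)]; exact hJ.le
  have h3 : 0 ≤ 1 / (β * Jhat) := by positivity
  have h4 := Real.sqrt_nonneg (1 - S ^ 2)
  have : (√(1 - S ^ 2) - 1 / (β * Jhat)) ^ 2 ≤ 1 := by
    rw [sq_le_one_iff_abs_le_one, abs_le]
    constructor <;> linarith
  calc _ ≤ Jhat / 2 * 1 := by gcongr
    _ = _ := mul_one _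

theorem spinEq_sq {β Jhat : ℝ} (hJ : 1 < β * Jhat) :
    spinEq β Jhat ^ 2 = 1 - (1 / (β * Jhat)) ^ 2 := by
  rw [spinEq, Real.sq_sqrt]
  · rw [div_pow, one_pow, mul_pow]
  · rw [← mul_pow, sub_nonneg, div_le_one (by positivity)]
    nlinarith

theorem spinEq_lt_one {β Jhat : ℝ} (hJ : 1 < β * Jhat) : spinEq β Jhat < 1 := by
  have h := spinEq_sq hJ
  have h0 : 0 < 1 / (β * Jhat) := by have := zero_lt_one.trans hJ; positivity
  have h1 : 0 ≤ spinEq β Jhat := Real.sqrt_nonneg _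
  nlinarith [sq_nonneg (1 / (β * Jhat))]

theorem spinEq_nonneg (β Jhat : ℝ) : 0 ≤ spinEq β Jhat := Real.sqrt_nonneg _

theorem abs_lt_one_of_mem {β Jhat S : ℝ} (hJ : 1 < β * Jhat)
    (hS : S ∈ Set.Icc (-spinEq β Jhat) (spinEq β Jhat)) : |S| < 1 :=
  (abs_le.2 hS).trans_lt (spinEq_lt_one hJ)

/-- The density of the local energy is bounded for bounded velocities. -/
theorem localDensity_le {β Jhat S V : ℝ} (hβ : 0 < β) (hJ : 1 < β * Jhat)
    (hS : S ∈ Set.Icc (-spinEq β Jhat) (spinEq β Jhat)) (hV : |V| ≤ 2) :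
    wellPotential β Jhat S + 1 / (2 * β) * Psi S V ≤ Jhat := by
  have hS1 := abs_lt_one_of_mem hJ hS
  have h1 := wellPotential_le hβ hJ hS1.le
  have h0 : 0 < β * Jhat := zero_lt_one.trans hJ
  -- On `[-𝔰, 𝔰]` one has `√(1 - S²) ≥ √(1 - 𝔰²) = 1 / (β Ĵ)`. With `V² ≤ 4` the temporal part is
  -- then at most `Ĵ / 2`, like the potential.
  have h2 := Psi_le hS1 (a := 1 / (β * Jhat)) (by positivity) (by
    have := spinEq_sq hJ
    have : S ^ 2 ≤ spinEq β Jhat ^ 2 := sq_le_sq.2 (by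
      rw [abs_of_nonneg (spinEq_nonneg β Jhat)]; exact abs_le.2 hS)
    nlinarith) V
  have h3 : V ^ 2 ≤ 4 := by nlinarith [sq_abs V, abs_nonneg V]
  have h4 : Psi S V ≤ β * Jhat := by
    refine h2.trans ?_
    calc V ^ 2 / (4 * (1 / (β * Jhat))) ≤ 4 / (4 * (1 / (β * Jhat))) := by gcongr
      _ = _ := by field_simp
  calc _ ≤ Jhat / 2 + 1 / (2 * β) * (β * Jhat) := by gcongr
    _ = _ := by field_simp; norm_num

/-- The density of the local energy controls the velocity. -/
theorem abs_le_localDensity {β Jhat S V : ℝ} (hβ : 0 < β) (hJ : 1 < β * Jhat)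
    (hS : S ∈ Set.Icc (-spinEq β Jhat) (spinEq β Jhat)) :
    |V| ≤ 1 + 16 * β * (wellPotential β Jhat S + 1 / (2 * β) * Psi S V) := by
  have hJ0 : 0 < Jhat := pos_of_mul_pos_right (zero_lt_one.trans hJ) hβ.le
  have hS1 := abs_lt_one_of_mem hJ hS
  have h1 := wellPotential_nonneg hβ hJ0 hS1.le
  have h2 := Psi0_le_Psi hS1 V
  have h3 := abs_le_add_Psi0 zero_lt_one le_rfl V
  have h4 : 16 * β * (1 / (2 * β) * Psi S V) = 8 * Psi S V := by field_simp; ring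
  have h5 : 0 ≤ 16 * β * wellPotential β Jhat S := by positivity
  rw [mul_add, h4]
  rw [inv_one, one_mul] at h3
  linarith

/-! ### Hausdorff measure on graphs -/

theorem hausdorff_apply (E : Set (SpaceTime d)) :
    hausdorff d E = (Measure.euclideanHausdorffMeasure d : Measure (Normal d))
      ((WithLp.ofLp : Normal d → SpaceTime d) ⁻¹' E) :=
  (MeasurableEquiv.toLp 2 (SpaceTime d)).symm.map_apply E

theorem lipschitzWith_snd_ofLp :
    LipschitzWith 1 fun p : Normal d => (WithLp.ofLp p).2 := by
  refine LipschitzWith.of_dist_le_mul fun p q => ?_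
  rw [NNReal.coe_one, one_mul, dist_eq_norm, dist_eq_norm]
  have h := WithLp.prod_norm_sq_eq_of_L2 (p - q)
  have h2 : ‖(p - q).snd‖ ≤ ‖p - q‖ := by
    refine le_of_sq_le_sq ?_ (norm_nonneg _)
    nlinarith [sq_nonneg ‖(p - q).fst‖]
  exact h2

/-- Projection along time is 1-Lipschitz for the Euclidean distance, and the normalization of the
Hausdorff measure depends on `d` alone. -/
theorem volume_image_snd_le (E : Set (SpaceTime d)) :
    volume (Prod.snd '' E) ≤ hausdorff d E := by
  rw [hausdorff_apply, ← EuclideanSpace.euclideanHausdorffMeasure_eq_volume]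
  have h := lipschitzWith_snd_ofLp.hausdorffMeasure_image_le (d := (d : ℝ)) (by positivity)
    ((WithLp.ofLp : Normal d → SpaceTime d) ⁻¹' E)
  rw [ENNReal.coe_one, ENNReal.one_rpow, one_mul] at h
  have e : (fun p : Normal d => (WithLp.ofLp p).2) ''
      ((WithLp.ofLp : Normal d → SpaceTime d) ⁻¹' E) = Prod.snd '' E := by
    ext z
    constructor
    · rintro ⟨p, hp, rfl⟩
      exact ⟨_, hp, rfl⟩
    · rintro ⟨p, hp, rfl⟩
      exact ⟨WithLp.toLp 2 p, hp, rfl⟩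
  rw [e] at h
  rw [Measure.euclideanHausdorffMeasure_def, Measure.euclideanHausdorffMeasure_def,
    Measure.smul_apply, Measure.smul_apply]
  exact smul_le_smul_of_nonneg_left h zero_le

/-- The time at which the time line through `(0, z)` meets the plane `n · p = c`. -/
def planeTime (n : Normal d) (c : ℝ) (z : Space d) : ℝ :=
  (c - inner ℝ n.snd z) / n.fst

theorem continuous_planeTime (n : Normal d) (c : ℝ) : Continuous (planeTime n c) := by
  unfold planeTime
  fun_prop

theorem eq_planeTime {n : Normal d} {c : ℝ} (hn : n.fst ≠ 0) {p : SpaceTime d}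
    (hp : inner ℝ n (WithLp.toLp 2 p) = c) : p.1 = planeTime n c p.2 := by
  rw [WithLp.prod_inner_apply] at hp
  rw [planeTime, eq_div_iff hn, ← hp]
  simp

/-- The graph map is affine, hence Lipschitz. Statements for almost every time line thereby become
statements for almost every surface point. -/
theorem hausdorff_graph_eq_zero (n : Normal d) (c : ℝ) {N : Set (Space d)} (hN : volume N = 0) :
    hausdorff d ((fun z => (planeTime n c z, z)) '' N) = 0 := by
  set T : Space d →L[ℝ] Normal d :=
    ((WithLp.prodContinuousLinearEquiv 2 ℝ ℝ (Space d)).symm : (ℝ × Space d) →L[ℝ] Normal d) ∘L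
      ((-(n.fst)⁻¹ • innerSL ℝ n.snd).prod (ContinuousLinearMap.id ℝ (Space d))) with hT
  set q : Normal d := WithLp.toLp 2 (c / n.fst, 0) with hq
  have hL : LipschitzWith ‖T‖₊ fun z => q + T z :=
    LipschitzWith.of_dist_le_mul fun x y => by
      rw [dist_add_left]; exact T.lipschitz.dist_le_mul x y
  have e : (WithLp.ofLp : Normal d → SpaceTime d) ⁻¹' ((fun z => (planeTime n c z, z)) '' N) =
      (fun z => q + T z) '' N := by
    have hz : ∀ z, WithLp.ofLp (q + T z) = (planeTime n c z, z) := fun z => by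
      refine Prod.ext ?_ ?_
      · simp [hq, hT, planeTime]
        ring
      · simp [hq, hT]
    ext p
    constructor
    · rintro ⟨z, hz', hp⟩
      refine ⟨z, hz', ?_⟩
      have := (hz z).trans hp
      exact WithLp.ofLp_injective 2 this
    · rintro ⟨z, hz', rfl⟩
      exact ⟨z, hz', (hz z).symm⟩
  have h := hL.hausdorffMeasure_image_le (d := (d : ℝ)) (by positivity) N
  have h0 : (Measure.hausdorffMeasure (d : ℝ) : Measure (Space d)) N = 0 := by
    rw [← EuclideanSpace.euclideanHausdorffMeasure_eq_volume,
      Measure.euclideanHausdorffMeasure_def, Measure.smul_apply] at hN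
    exact (smul_eq_zero.1 hN).resolve_left
      (Measure.addHaarScalarFactor_volume_hausdorffMeasure_ne_zero d)
  rw [h0, mul_zero] at h
  rw [hausdorff_apply, e, Measure.euclideanHausdorffMeasure_def, Measure.smul_apply,
    nonpos_iff_eq_zero.1 h, smul_zero]

/-- Comparing the measures replaces the area formula and requires measurability neither of `P` nor
of `G`. The lost Jacobian `|ν_t|` is restored later at the price of a constant. -/
theorem lintegral_le_hausdorff (P : Set (SpaceTime d)) (t : Space d → ℝ)
    (G : Space d → ℝ≥0∞) :
    ∫⁻ z in {z | (t z, z) ∈ P}, G z ≤ ∫⁻ p in P, G p.2 ∂(hausdorff d) := by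
  have hle : (volume.restrict {z | (t z, z) ∈ P} : Measure (Space d)) ≤
      ((hausdorff d).restrict P).map Prod.snd := by
    refine Measure.le_iff.2 fun E hE => ?_
    rw [Measure.map_apply measurable_snd hE, Measure.restrict_apply hE,
      Measure.restrict_apply (measurable_snd hE)]
    refine (measure_mono ?_).trans (volume_image_snd_le _)
    rintro z ⟨hz, hzP⟩
    exact ⟨(t z, z), ⟨hz, hzP⟩, rfl⟩
  exact (lintegral_mono' hle le_rfl).trans (lintegral_map_le _ _)

theorem ae_hausdorff_notMem {P : Set (SpaceTime d)} {n : Normal d} {c : ℝ}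
    (hPt : ∀ p ∈ P, p.1 = planeTime n c p.2) (hPm : MeasurableSet P) {N : Set (Space d)}
    (hN : volume N = 0) : ∀ᵐ p ∂(hausdorff d).restrict P, p.2 ∉ N := by
  rw [ae_restrict_iff' hPm]
  filter_upwards [measure_eq_zero_iff_ae_notMem.1 (hausdorff_graph_eq_zero n c hN)] with p hp hpP hpN
  exact hp ⟨p.2, hpN, Prod.ext (hPt p hpP).symm rfl⟩

/-- A time-like plane has a null projection. -/
theorem volume_vertical_eq_zero {n : Normal d} (hn : ‖n‖ = 1) (h0 : n.fst = 0) (c : ℝ) :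
    volume {z : Space d | inner ℝ n.snd z = c} = 0 := by
  have hns : n.snd ≠ 0 := by
    intro hs
    have := WithLp.prod_norm_sq_eq_of_L2 n
    rw [hn, h0, hs] at this
    simp at this
  rcases Set.eq_empty_or_nonempty {z : Space d | inner ℝ n.snd z = c} with he | ⟨z₀, hz₀⟩
  · rw [he, measure_empty]
  · have hL : (innerSL ℝ n.snd : Space d →L[ℝ] ℝ).ker ≠ ⊤ := fun ht => by
      have : n.snd ∈ (innerSL ℝ n.snd : Space d →L[ℝ] ℝ).ker := ht ▸ Submodule.mem_top
      exact hns (by simpa using this)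
    have h := Measure.addHaar_submodule volume _ hL
    rw [← measure_preimage_add_right volume (-z₀)] at h
    refine measure_mono_null (fun z hz => ?_) h
    have h1 : inner ℝ n.snd z = c := hz
    have h2 : inner ℝ n.snd z₀ = c := hz₀
    simp [inner_add_right, h1, h2]

/-! ### Almost every time line -/

theorem ae_ae_of_ae {p : SpaceTime d → Prop} (h : ∀ᵐ x, p x) :
    ∀ᵐ z : Space d, ∀ᵐ τ : ℝ, p (τ, z) := by
  have h1 : ∀ᵐ y ∂((volume : Measure (Space d)).prod (volume : Measure ℝ)), p y.swap :=
    (Measure.measurePreserving_swap (μ := (volume : Measure (Space d)))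
      (ν := (volume : Measure ℝ))).quasiMeasurePreserving.ae h
  exact Measure.ae_ae_of_ae_prod h1

theorem ae_of_ae_ae {p : SpaceTime d → Prop} (hp : MeasurableSet {x | p x})
    (h : ∀ᵐ z : Space d, ∀ᵐ τ : ℝ, p (τ, z)) : ∀ᵐ x, p x := by
  have h1 : ∀ᵐ y ∂((volume : Measure (Space d)).prod (volume : Measure ℝ)), p y.swap :=
    (Measure.ae_prod_iff_ae_ae (measurable_swap hp)).2 h
  exact (Measure.measurePreserving_swap (μ := (volume : Measure ℝ))
      (ν := (volume : Measure (Space d)))).quasiMeasurePreserving.ae h1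

/-- The intersection of a space-time set with the time line through `(0, z)`. -/
def timeLine (D : Set (SpaceTime d)) (z : Space d) : Set ℝ := {τ | (τ, z) ∈ D}

theorem isOpen_timeLine {D : Set (SpaceTime d)} (hD : IsOpen D) (z : Space d) :
    IsOpen (timeLine D z) :=
  hD.preimage (by fun_prop)

/-- `u` is bounded by `M`, and has the weak time derivative `v` on the open subset `A` of `D`,
which on almost all time lines is obtained from `D` by removing the graph points `t i z`, `z ∈ Q i`,
and `v` is integrable on bounded subsets of `D`. -/
structure IsSlitField {k : ℕ} (M : ℝ) (u v : SpaceTime d → ℝ) (A D : Set (SpaceTime d))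
    (t : Fin k → Space d → ℝ) (Q : Fin k → Set (Space d)) : Prop where
  isOpen_left : IsOpen A
  isOpen : IsOpen D
  continuous : ∀ i, Continuous (t i)
  measurableSet : ∀ i, MeasurableSet (Q i)
  mem : ∀ i, ∀ z ∈ Q i, (t i z, z) ∈ D
  ae_mem : ∀ᵐ z, ∀ τ, (τ, z) ∈ D → (∀ i, z ∈ Q i → τ ≠ t i z) → (τ, z) ∈ A
  measurable : Measurable u
  measurable_deriv : Measurable v
  bounded : ∀ p, |u p| ≤ M
  le_one : M ≤ 1
  deriv : HasWeakTimeDeriv u v A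
  lintegral_lt_top : ∀ N : ℕ, ∫⁻ p in D ∩ Metric.closedBall 0 N, ‖v p‖ₑ < ⊤

open Classical in
/-- The exceptional times on the time line of `z`. -/
def slitTimes {k : ℕ} (t : Fin k → Space d → ℝ) (Q : Fin k → Set (Space d)) (z : Space d) :
    Finset ℝ :=
  (Finset.univ.filter fun i => z ∈ Q i).image fun i => t i z

theorem mem_slitTimes {k : ℕ} {t : Fin k → Space d → ℝ} {Q : Fin k → Set (Space d)} {z : Space d}
    {τ : ℝ} : τ ∈ slitTimes t Q z ↔ ∃ i, z ∈ Q i ∧ t i z = τ := by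
  simp [slitTimes]

theorem measurable_incrementDefect {u v : SpaceTime d → ℝ} (hu : Measurable u)
    (hv : Measurable v) :
    Measurable fun x : ℝ × SpaceTime d => incrementDefect x.1 u v x.2 := by
  unfold incrementDefect
  have h1 : StronglyMeasurable fun y : (ℝ × SpaceTime d) × ℝ =>
      v (y.1.2 + (y.2 * y.1.1, 0)) := (hv.comp (by fun_prop)).stronglyMeasurable
  have h2 := h1.integral_prod_right' (ν := volume.restrict (Set.Icc (0 : ℝ) 1))
  have h3 : Measurable fun x : ℝ × SpaceTime d => u (x.2 + (x.1, 0)) := hu.comp (by fun_prop)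
  exact (h3.sub (hu.comp measurable_snd)).sub (measurable_fst.mul h2.measurable)

/-- Joint measurability in `(h, p)` permits the exchange of the quantifiers "almost every `h`" and
"almost every `p`". -/
theorem measurableSet_incrementDefect {u v : SpaceTime d → ℝ} (hu : Measurable u)
    (hv : Measurable v) {A : Set (SpaceTime d)} (hA : IsOpen A) :
    MeasurableSet {x : ℝ × SpaceTime d | (∀ θ ∈ Set.Icc (0 : ℝ) 1, x.2 + (θ * x.1, 0) ∈ A) →
      incrementDefect x.1 u v x.2 = 0} := by
  have hW : IsOpen {x : ℝ × SpaceTime d | ∀ θ ∈ Set.Icc (0 : ℝ) 1, x.2 + (θ * x.1, 0) ∈ A} :=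
    isOpen_forall_Icc hA (Φ := fun (x : ℝ × SpaceTime d) θ => x.2 + (θ * x.1, 0))
      (by unfold Function.uncurry; fun_prop)
  have : {x : ℝ × SpaceTime d | (∀ θ ∈ Set.Icc (0 : ℝ) 1, x.2 + (θ * x.1, 0) ∈ A) →
      incrementDefect x.1 u v x.2 = 0} =
      {x : ℝ × SpaceTime d | ∀ θ ∈ Set.Icc (0 : ℝ) 1, x.2 + (θ * x.1, 0) ∈ A}ᶜ ∪
        {x | incrementDefect x.1 u v x.2 = 0} := by
    ext x
    simp only [Set.mem_ofPred_eq, Set.mem_union, Set.mem_compl_iff, imp_iff_not_or]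
  rw [this]
  exact hW.measurableSet.compl.union
    (measurable_incrementDefect hu hv (measurableSet_singleton 0))

theorem incrementDefect_eq (u v : SpaceTime d → ℝ) (h s : ℝ) (z : Space d) :
    incrementDefect h u v (s, z) = u (s + h, z) - u (s, z) - ∫ τ in s..(s + h), v (τ, z) := by
  have h1 := intervalIntegral.mul_integral_comp_add_mul (a := 0) (b := 1)
    (f := fun τ => v (τ, z)) h s
  rw [mul_zero, mul_one, add_zero] at h1
  rw [← h1, incrementDefect, intervalIntegral.integral_of_le zero_le_one,
    ← integral_Icc_eq_integral_Ioc]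
  simp [mul_comm]

namespace IsSlitField

variable {k : ℕ} {M : ℝ} {u v : SpaceTime d → ℝ} {A D : Set (SpaceTime d)}
  {t : Fin k → Space d → ℝ} {Q : Fin k → Set (Space d)}

/-- Fubini on each ball. The bound across the slits comes from `lintegral_lt_top`, since the weak
derivative alone gives integrability only inside `A`. -/
theorem ae_intervalIntegrable (H : IsSlitField M u v A D t Q) :
    ∀ᵐ z, ∀ x y, Set.uIcc x y ⊆ timeLine D z →
      IntervalIntegrable (fun τ => v (τ, z)) volume x y := by
  have h1 : ∀ N : ℕ, ∀ᵐ z : Space d,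
      ∫⁻ τ, (D ∩ Metric.closedBall 0 (N : ℝ)).indicator (fun p => ‖v p‖ₑ) (τ, z) < ⊤ := by
    intro N
    have hms : MeasurableSet (D ∩ Metric.closedBall 0 (N : ℝ)) :=
      H.isOpen.measurableSet.inter measurableSet_closedBall
    have hm : Measurable ((D ∩ Metric.closedBall 0 (N : ℝ)).indicator (fun p => ‖v p‖ₑ)) :=
      H.measurable_deriv.enorm.indicator hms
    have h := H.lintegral_lt_top N
    rw [← lintegral_indicator hms, Measure.volume_eq_prod,
      lintegral_prod_symm _ hm.aemeasurable] at h
    exact ae_lt_top (Measurable.lintegral_prod_left' hm) h.ne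
  filter_upwards [ae_all_iff.2 h1] with z hz x y hxy
  obtain ⟨N, hN⟩ := exists_nat_ge (max (max |x| |y|) ‖z‖)
  have hx := (le_max_left _ _).trans ((le_max_left _ _).trans hN)
  have hy := (le_max_right _ _).trans ((le_max_left _ _).trans hN)
  have hzN := (le_max_right _ _).trans hN
  rw [intervalIntegrable_iff]
  refine ⟨(H.measurable_deriv.comp (by fun_prop)).aestronglyMeasurable, ?_⟩
  refine lt_of_le_of_lt ?_ (hz N)
  rw [← lintegral_indicator measurableSet_uIoc]
  refine lintegral_mono fun τ => ?_
  by_cases hτ : τ ∈ Set.uIoc x y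
  · have hτ' := Set.uIoc_subset_uIcc hτ
    have hmem : (τ, z) ∈ D ∩ Metric.closedBall 0 (N : ℝ) := by
      refine ⟨hxy hτ', ?_⟩
      rw [mem_closedBall_zero_iff, Prod.norm_mk, max_le_iff]
      refine ⟨?_, hzN⟩
      have := Set.uIcc_subset_Icc (abs_le.1 hx) (abs_le.1 hy) hτ'
      exact abs_le.2 this
    rw [Set.indicator_of_mem hτ, Set.indicator_of_mem hmem]
  · rw [Set.indicator_of_notMem hτ]
    exact zero_le

/-- On almost all time lines `u` is a primitive of `v` off the slits. -/
theorem ae_isPiecewisePrimitive (H : IsSlitField M u v A D t Q) :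
    ∀ᵐ z, IsPiecewisePrimitive (fun τ => u (τ, z)) (fun τ => v (τ, z)) (timeLine D z)
      (slitTimes t Q z) := by
  have hms := measurableSet_incrementDefect H.measurable H.measurable_deriv H.isOpen_left
  have h1 : ∀ᵐ h : ℝ, ∀ᵐ p : SpaceTime d, (∀ θ ∈ Set.Icc (0 : ℝ) 1, p + (θ * h, 0) ∈ A) →
      incrementDefect h u v p = 0 :=
    ae_of_all _ fun h => H.deriv.ae_incrementDefect_eq_zero H.isOpen_left h
  -- For each `h` the exceptional set of points may differ; after the exchange one null set of base
  -- points serves almost all `h`.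
  have h2 := (Measure.ae_ae_comm (p := fun (h : ℝ) (p : SpaceTime d) =>
    (∀ θ ∈ Set.Icc (0 : ℝ) 1, p + (θ * h, 0) ∈ A) → incrementDefect h u v p = 0) hms).1 h1
  filter_upwards [ae_ae_of_ae h2, H.ae_intervalIntegrable, H.ae_mem] with z hz hi hmem
  refine ⟨isOpen_timeLine H.isOpen z, H.measurable.comp (by fun_prop), ⟨M, fun τ => H.bounded _⟩,
    hi, ?_⟩
  filter_upwards [hz] with s hs
  filter_upwards [hs] with h hh hsub
  have := hh fun θ hθ => by
    have h3 := hsub θ hθ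
    have h4 := hmem (s + θ * h) h3.1 fun i hi he => h3.2 (mem_slitTimes.2 ⟨i, hi, he.symm⟩)
    simpa using h4
  rw [incrementDefect_eq] at this
  linarith

end IsSlitField

theorem abs_meanLim_le {f : ℝ → ℝ} {M : ℝ} (hM : ∀ τ, |f τ| ≤ M) (σ x : ℝ) :
    |meanLim σ f x| ≤ M := by
  have hb : ∀ n : ℕ, |∫ θ in (0 : ℝ)..1, f (x + σ * (θ / (n + 1)))| ≤ M := fun n => by
    have := intervalIntegral.norm_integral_le_of_norm_le_const (a := 0) (b := 1) (C := M)
      (f := fun θ => f (x + σ * (θ / (n + 1)))) fun θ _ => hM _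
    simpa using this
  rw [abs_le]
  constructor
  · refine le_limsup_of_frequently_le (Frequently.of_forall fun n => (abs_le.1 (hb n)).1) ?_
    exact isBoundedUnder_of ⟨M, fun n => (abs_le.1 (hb n)).2⟩
  · refine limsup_le_of_le ?_ (Eventually.of_forall fun n => (abs_le.1 (hb n)).2)
    exact isCoboundedUnder_le_of_le (x := -M) atTop fun n => (abs_le.1 (hb n)).1

theorem measurable_meanLim {u : SpaceTime d → ℝ} (hu : Measurable u) {t : Space d → ℝ}
    (ht : Measurable t) (σ : ℝ) : Measurable fun z => meanLim σ (fun τ => u (τ, z)) (t z) := by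
  unfold meanLim
  refine Measurable.limsup fun n => ?_
  simp only [intervalIntegral.integral_of_le zero_le_one]
  have h1 : StronglyMeasurable fun y : Space d × ℝ => u (t y.1 + σ * (y.2 / (n + 1)), y.1) :=
    (hu.comp (by fun_prop)).stronglyMeasurable
  exact (h1.integral_prod_right' (ν := volume.restrict (Set.Ioc (0 : ℝ) 1))).measurable

/-! ### The barrier -/

section Barrier

variable {k : ℕ} (κ : ℝ) (u : SpaceTime d → ℝ) (D : Set (SpaceTime d))
  (t : Fin k → Space d → ℝ) (Q : Fin k → Set (Space d))

/-- The lower one of the two one-sided limits of `u` on the graph of `t i`. -/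
def lowerTrace (i : Fin k) (z : Space d) : ℝ :=
  min (meanLim 1 (fun τ => u (τ, z)) (t i z)) (meanLim (-1) (fun τ => u (τ, z)) (t i z))

/-- The points that can be joined to the graph of `t i` over `Q i` inside `D` in time direction. -/
def reach (i : Fin k) : Set (SpaceTime d) :=
  {p | p.2 ∈ Q i ∧ Set.uIcc (t i p.2) p.1 ⊆ timeLine D p.2}

open Classical in
/-- The cone with slope `κ` over the graph of `t i` together with its time derivative. -/
def coneAt (i : Fin k) (p : SpaceTime d) : ℝ × ℝ :=
  if p ∈ reach D t Q i then
    (lowerTrace u t i p.2 + κ * |p.1 - t i p.2|, if t i p.2 < p.1 then κ else -κ)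
  -- The default 2 exceeds every value of `u`, as `|u| ≤ M ≤ 1` for slit fields, so it is never
  -- active.
  else (2, 0)

/-- The lower envelope of the cones together with its time derivative. -/
def barrier : List (Fin k) → SpaceTime d → ℝ × ℝ
  | [], _ => (2, 0)
  | i :: l, p => if (coneAt κ u D t Q i p).1 ≤ (barrier l p).1 then coneAt κ u D t Q i p
      else barrier l p

variable {κ u D t Q}

theorem uIcc_subset_timeLine_iff {s τ : ℝ} {z : Space d} : Set.uIcc s τ ⊆ timeLine D z ↔
    ∀ θ ∈ Set.Icc (0 : ℝ) 1, (s + θ * (τ - s), z) ∈ D := by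
  rw [← segment_eq_uIcc, segment_eq_image', Set.image_subset_iff]
  rfl

theorem measurableSet_reach (hD : IsOpen D) (ht : ∀ i, Continuous (t i))
    (hQ : ∀ i, MeasurableSet (Q i)) (i : Fin k) : MeasurableSet (reach D t Q i) := by
  have h : IsOpen {p : SpaceTime d | ∀ θ ∈ Set.Icc (0 : ℝ) 1,
      (t i p.2 + θ * (p.1 - t i p.2), p.2) ∈ D} := by
    have := ht i
    exact isOpen_forall_Icc hD (Φ := fun (p : SpaceTime d) θ =>
      (t i p.2 + θ * (p.1 - t i p.2), p.2)) (by unfold Function.uncurry; fun_prop)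
  have e : reach D t Q i = Prod.snd ⁻¹' Q i ∩ {p : SpaceTime d | ∀ θ ∈ Set.Icc (0 : ℝ) 1,
      (t i p.2 + θ * (p.1 - t i p.2), p.2) ∈ D} := by
    ext p
    simp only [reach, uIcc_subset_timeLine_iff]
    rfl
  rw [e]
  exact (measurable_snd (hQ i)).inter h.measurableSet

theorem measurable_lowerTrace (hu : Measurable u) (ht : ∀ i, Continuous (t i)) (i : Fin k) :
    Measurable (lowerTrace u t i) :=
  (measurable_meanLim hu (ht i).measurable 1).min (measurable_meanLim hu (ht i).measurable (-1))

theorem measurable_coneAt (hu : Measurable u) (hD : IsOpen D) (ht : ∀ i, Continuous (t i))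
    (hQ : ∀ i, MeasurableSet (Q i)) (i : Fin k) : Measurable (coneAt κ u D t Q i) := by
  have h1 := measurable_lowerTrace hu ht i
  have h2 := (ht i).measurable
  refine Measurable.ite (measurableSet_reach hD ht hQ i) (Measurable.prodMk (by fun_prop) ?_)
    measurable_const
  exact Measurable.ite (measurableSet_lt (by fun_prop) (by fun_prop)) measurable_const
    measurable_const

theorem measurable_barrier (hu : Measurable u) (hD : IsOpen D) (ht : ∀ i, Continuous (t i))
    (hQ : ∀ i, MeasurableSet (Q i)) (l : List (Fin k)) : Measurable (barrier κ u D t Q l) := by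
  induction l with
  | nil => exact measurable_const
  | cons i l ih =>
    have h1 := measurable_coneAt (κ := κ) hu hD ht hQ i
    exact Measurable.ite (measurableSet_le h1.fst ih.fst) h1 ih

theorem isPrimitiveOn_coneAt (i : Fin k) (z : Space d) :
    IsPrimitiveOn (fun τ => (coneAt κ u D t Q i (τ, z)).1)
      (fun τ => (coneAt κ u D t Q i (τ, z)).2) (timeLine D z) := by
  by_cases hz : z ∈ Q i
  · have hm : ∀ τ, (τ, z) ∈ reach D t Q i ↔ Set.uIcc (t i z) τ ⊆ timeLine D z :=
      fun τ => ⟨fun h => h.2, fun h => ⟨hz, h⟩⟩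
    convert isPrimitiveOn_ite_cone (lowerTrace u t i z) κ (t i z) 2 (timeLine D z) using 2 with τ τ
    · by_cases h : Set.uIcc (t i z) τ ⊆ timeLine D z <;> simp [coneAt, hm, h]
    · by_cases h : Set.uIcc (t i z) τ ⊆ timeLine D z <;> simp [coneAt, hm, h]
  · convert isPrimitiveOn_const 2 (timeLine D z) using 2 with τ τ
    · simp [coneAt, reach, hz]
    · simp [coneAt, reach, hz]

theorem isPrimitiveOn_barrier (l : List (Fin k)) (z : Space d) :
    IsPrimitiveOn (fun τ => (barrier κ u D t Q l (τ, z)).1)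
      (fun τ => (barrier κ u D t Q l (τ, z)).2) (timeLine D z) := by
  induction l with
  | nil => exact isPrimitiveOn_const 2 _
  | cons i l ih =>
    convert (isPrimitiveOn_coneAt i z).min ih using 2 with τ τ
    · simp only [barrier]
      split_ifs with h
      · exact (min_eq_left h).symm
      · exact (min_eq_right (not_le.1 h).le).symm
    · simp only [barrier]
      split_ifs <;> rfl

theorem abs_barrier_snd_le (hκ : 0 ≤ κ) (l : List (Fin k)) (p : SpaceTime d) :
    |(barrier κ u D t Q l p).2| ≤ κ := by
  induction l with
  | nil => simpa [barrier]
  | cons i l ih =>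
    simp only [barrier]
    split_ifs
    · simp only [coneAt]
      split_ifs <;> simp [abs_of_nonneg hκ, hκ]
    · exact ih

theorem barrier_fst_le {l : List (Fin k)} {i : Fin k} (hi : i ∈ l) (p : SpaceTime d) :
    (barrier κ u D t Q l p).1 ≤ (coneAt κ u D t Q i p).1 := by
  induction l with
  | nil => simp at hi
  | cons j l ih =>
    simp only [barrier]
    rcases List.mem_cons.1 hi with rfl | h
    · split_ifs with hle
      · exact le_rfl
      · exact (not_le.1 hle).le
    · split_ifs with hle
      · exact hle.trans (ih h)
      · exact ih h

theorem barrier_fst_eq (l : List (Fin k)) (p : SpaceTime d) :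
    (barrier κ u D t Q l p).1 = 2 ∨ ∃ i, p ∈ reach D t Q i ∧
      (barrier κ u D t Q l p).1 = lowerTrace u t i p.2 + κ * |p.1 - t i p.2| := by
  induction l with
  | nil => exact Or.inl rfl
  | cons j l ih =>
    simp only [barrier]
    split_ifs with hle
    · by_cases hr : p ∈ reach D t Q j
      · exact Or.inr ⟨j, hr, by simp [coneAt, hr]⟩
      · exact Or.inl (by simp [coneAt, hr])
    · exact ih

theorem abs_lowerTrace_le {M : ℝ} (hM : ∀ p, |u p| ≤ M) (i : Fin k) (z : Space d) :
    |lowerTrace u t i z| ≤ M := by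
  have h1 := abs_meanLim_le (f := fun τ => u (τ, z)) (fun τ => hM _) 1 (t i z)
  have h2 := abs_meanLim_le (f := fun τ => u (τ, z)) (fun τ => hM _) (-1) (t i z)
  rw [abs_le] at *
  exact ⟨le_min h1.1 h2.1, (min_le_left _ _).trans h1.2⟩

end Barrier

/-! ### The field cut off at the barrier -/

section Cut

variable {k : ℕ} (κ : ℝ) (u v : SpaceTime d → ℝ) (D : Set (SpaceTime d))
  (t : Fin k → Space d → ℝ) (Q : Fin k → Set (Space d))

/-- The field `u` cut off at the barrier. -/
def cut (p : SpaceTime d) : ℝ := min (u p) (barrier κ u D t Q (List.finRange k) p).1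

/-- The time derivative of the field cut off at the barrier. -/
def cutDeriv (p : SpaceTime d) : ℝ :=
  if u p ≤ (barrier κ u D t Q (List.finRange k) p).1 then v p
  else (barrier κ u D t Q (List.finRange k) p).2

/-- The points where the barrier is active. -/
def cutSet : Set (SpaceTime d) := {p ∈ D | (barrier κ u D t Q (List.finRange k) p).1 < u p}

/-- The points of `D` at distance less than `r` in time direction from the slits. -/
def slitNhd (r : ℝ) : Set (SpaceTime d) := {p ∈ D | ∃ i, p.2 ∈ Q i ∧ |p.1 - t i p.2| < r}

end Cut

namespace IsSlitField

variable {k : ℕ} {κ M : ℝ} {u v : SpaceTime d → ℝ} {A D : Set (SpaceTime d)}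
  {t : Fin k → Space d → ℝ} {Q : Fin k → Set (Space d)}

theorem measurable_barrier (H : IsSlitField M u v A D t Q) (l : List (Fin k)) :
    Measurable (barrier κ u D t Q l) :=
  SpinPatch.measurable_barrier H.measurable H.isOpen H.continuous H.measurableSet l

theorem measurable_cut (H : IsSlitField M u v A D t Q) : Measurable (cut κ u D t Q) :=
  H.measurable.min (H.measurable_barrier _).fst

theorem measurable_cutDeriv (H : IsSlitField M u v A D t Q) :
    Measurable (cutDeriv κ u v D t Q) :=
  Measurable.ite (measurableSet_le H.measurable (H.measurable_barrier _).fst)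
    H.measurable_deriv (H.measurable_barrier _).snd

theorem measurableSet_cutSet (H : IsSlitField M u v A D t Q) :
    MeasurableSet (cutSet κ u D t Q) :=
  H.isOpen.measurableSet.inter (measurableSet_lt (H.measurable_barrier _).fst H.measurable)

theorem measurableSet_slitNhd (H : IsSlitField M u v A D t Q) (r : ℝ) :
    MeasurableSet (slitNhd D t Q r) := by
  have : slitNhd D t Q r = D ∩ ⋃ i, (Prod.snd ⁻¹' Q i ∩ {p | |p.1 - t i p.2| < r}) := by
    ext p
    simp [slitNhd]
  rw [this]
  refine H.isOpen.measurableSet.inter (MeasurableSet.iUnion fun i =>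
    (measurable_snd (H.measurableSet i)).inter ?_)
  have := (H.continuous i).measurable
  exact measurableSet_lt (by fun_prop) measurable_const

theorem abs_cut_le (H : IsSlitField M u v A D t Q) (hκ : 0 ≤ κ) (p : SpaceTime d) :
    |cut κ u D t Q p| ≤ M := by
  have hu := abs_le.1 (H.bounded p)
  refine abs_le.2 ⟨le_min hu.1 ?_, (min_le_left _ _).trans hu.2⟩
  rcases barrier_fst_eq (κ := κ) (u := u) (D := D) (t := t) (Q := Q) (List.finRange k) p
    with h | ⟨i, -, h⟩
  · rw [h]
    have : 0 ≤ M := (abs_nonneg _).trans (H.bounded p)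
    linarith
  · rw [h]
    have h1 := (abs_le.1 (abs_lowerTrace_le (t := t) H.bounded i p.2)).1
    have h2 : 0 ≤ κ * |p.1 - t i p.2| := by positivity
    linarith

theorem cut_eq_of_notMem {p : SpaceTime d} (hp : p ∈ D) (hn : p ∉ cutSet κ u D t Q) :
    cut κ u D t Q p = u p :=
  min_eq_left (not_lt.1 fun h => hn ⟨hp, h⟩)

theorem cutDeriv_eq_of_notMem {p : SpaceTime d} (hp : p ∈ D) (hn : p ∉ cutSet κ u D t Q) :
    cutDeriv κ u v D t Q p = v p :=
  if_pos (not_lt.1 fun h => hn ⟨hp, h⟩)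

theorem abs_cutDeriv_le_of_mem (hκ : 0 ≤ κ) {p : SpaceTime d} (hp : p ∈ cutSet κ u D t Q) :
    |cutDeriv κ u v D t Q p| ≤ κ := by
  rw [cutDeriv, if_neg (not_le.2 hp.2)]
  exact abs_barrier_snd_le hκ _ p

theorem abs_cutDeriv_le (hκ : 0 ≤ κ) (p : SpaceTime d) :
    |cutDeriv κ u v D t Q p| ≤ |v p| + κ := by
  rw [cutDeriv]
  split_ifs
  · linarith
  · linarith [abs_barrier_snd_le (u := u) (D := D) (t := t) (Q := Q) hκ (List.finRange k) p,
      abs_nonneg (v p)]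

theorem exists_of_mem_cutSet (H : IsSlitField M u v A D t Q)
    {p : SpaceTime d} (hp : p ∈ cutSet κ u D t Q) :
    ∃ i, p ∈ reach D t Q i ∧ lowerTrace u t i p.2 + κ * |p.1 - t i p.2| < u p := by
  have hu := abs_le.1 (H.bounded p)
  rcases barrier_fst_eq (κ := κ) (u := u) (D := D) (t := t) (Q := Q) (List.finRange k) p
    with h | ⟨i, hi, h⟩
  · have := hp.2
    rw [h] at this
    linarith [H.le_one]
  · exact ⟨i, hi, h ▸ hp.2⟩

/-- This fixes the slope `2 / λ`: `u` exceeds the vertex by at most `2 M ≤ 2`, so the cone overtakes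
it within time `λ`. -/
theorem abs_sub_lt (H : IsSlitField M u v A D t Q) {lam : ℝ} (hl : 0 < lam) {i : Fin k}
    {p : SpaceTime d} (h : lowerTrace u t i p.2 + 2 / lam * |p.1 - t i p.2| < u p) :
    |p.1 - t i p.2| < lam := by
  have hu := abs_le.1 (H.bounded p)
  have h1 := (abs_le.1 (abs_lowerTrace_le (t := t) H.bounded i p.2)).1
  have h2 : 2 / lam * |p.1 - t i p.2| < 2 := by linarith [H.le_one]
  rw [div_mul_eq_mul_div, div_lt_iff₀ hl] at h2
  linarith

theorem cutSet_subset (H : IsSlitField M u v A D t Q) {lam : ℝ} (hl : 0 < lam) :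
    cutSet (2 / lam) u D t Q ⊆ slitNhd D t Q lam := by
  intro p hp
  obtain ⟨i, hi, h⟩ := H.exists_of_mem_cutSet hp
  exact ⟨hp.1, i, hi.1, H.abs_sub_lt hl h⟩

theorem ae_isPrimitiveOn_cut (H : IsSlitField M u v A D t Q) :
    ∀ᵐ z, IsPrimitiveOn (fun τ => min (meanLim 1 (fun s => u (s, z)) τ)
        (barrier κ u D t Q (List.finRange k) (τ, z)).1)
      (fun τ => cutDeriv κ u v D t Q (τ, z)) (timeLine D z) := by
  filter_upwards [H.ae_isPiecewisePrimitive] with z hz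
  have hb := H.measurable_barrier (κ := κ) (List.finRange k)
  refine hz.min_barrier (H.measurable_deriv.comp (by fun_prop)) (hb.fst.comp (by fun_prop))
    (hb.snd.comp (by fun_prop)) (isPrimitiveOn_barrier _ z) ?_
  intro s hs hsD
  obtain ⟨i, hi, rfl⟩ := mem_slitTimes.1 hs
  have h1 := barrier_fst_le (κ := κ) (u := u) (D := D) (t := t) (Q := Q)
    (List.mem_finRange i) (t i z, z)
  have hr : (t i z, z) ∈ reach D t Q i := ⟨hi, by simpa using hsD⟩
  have h2 : (coneAt κ u D t Q i (t i z, z)).1 = lowerTrace u t i z := by simp [coneAt, hr]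
  rw [h2] at h1
  exact ⟨h1.trans (min_le_left _ _), h1.trans (min_le_right _ _)⟩

theorem locallyIntegrableOn_deriv (H : IsSlitField M u v A D t Q) : LocallyIntegrableOn v D := by
  rw [locallyIntegrableOn_iff H.isOpen.isLocallyClosed]
  intro K hKD hK
  obtain ⟨R, hR⟩ := hK.isBounded.subset_closedBall 0
  obtain ⟨N, hN⟩ := exists_nat_ge R
  refine ⟨H.measurable_deriv.aestronglyMeasurable, lt_of_le_of_lt ?_ (H.lintegral_lt_top N)⟩
  exact lintegral_mono_set fun p hp => ⟨hKD hp, Metric.closedBall_subset_closedBall hN (hR hp)⟩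

/-- Cutting off removes the slits: the result has a weak time derivative on all of `D`. -/
theorem hasWeakTimeDeriv_cut (H : IsSlitField M u v A D t Q) (hκ : 0 ≤ κ) :
    HasWeakTimeDeriv (cut κ u D t Q) (cutDeriv κ u v D t Q) D := by
  refine hasWeakTimeDeriv_of_ae H.isOpen ?_ ?_ fun h => ?_
  · refine LocallyIntegrable.locallyIntegrableOn ?_ D
    refine (locallyIntegrable_const M).mono H.measurable_cut.aestronglyMeasurable
      (ae_of_all _ fun p => ?_)
    exact (H.abs_cut_le hκ p).trans (le_abs_self M)
  · have h1 : LocallyIntegrableOn (fun p => |v p| + κ) D :=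
      H.locallyIntegrableOn_deriv.norm.add ((locallyIntegrable_const κ).locallyIntegrableOn D)
    rw [locallyIntegrableOn_iff H.isOpen.isLocallyClosed] at h1 ⊢
    intro K hKD hK
    refine (h1 K hKD hK).mono' H.measurable_cutDeriv.aestronglyMeasurable
      (ae_of_all _ fun p => abs_cutDeriv_le hκ p)
  · have hms : MeasurableSet {p : SpaceTime d | (∀ θ ∈ Set.Icc (0 : ℝ) 1, p + (θ * h, 0) ∈ D) →
        incrementDefect h (cut κ u D t Q) (cutDeriv κ u v D t Q) p = 0} :=
      (measurable_prodMk_left (x := h)) (measurableSet_incrementDefect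
        (H.measurable_cut (κ := κ)) H.measurable_cutDeriv H.isOpen)
    -- By Fubini it suffices to work on one time line. There `u` is replaced by its right limits at
    -- both endpoints, which is harmless for almost every `s`.
    refine ae_of_ae_ae hms ?_
    filter_upwards [H.ae_isPrimitiveOn_cut (κ := κ), H.ae_isPiecewisePrimitive] with z hz hz'
    have hae := hz'.ae_eq
    filter_upwards [hae, ae_comp_affine hae h one_ne_zero] with s h1 h2 hsub
    have e : h + 1 * s = s + h := by ring
    rw [e] at h2
    have hsub' : Set.uIcc s (s + h) ⊆ timeLine D z := by
      rw [uIcc_subset_timeLine_iff]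
      intro θ hθ
      have := hsub θ hθ
      simpa using this
    have hs : s ∈ timeLine D z := hsub' Set.left_mem_uIcc
    have hs' : s + h ∈ timeLine D z := hsub' Set.right_mem_uIcc
    rw [incrementDefect_eq, (hz s (s + h) hsub').2]
    simp only [cut, ← h1 hs, ← h2 hs']
    ring

/-! ### The measure of the set where the barrier is active. -/

/-- The total variation of `u` on the part of the time line of `z` near the slits, including the
jumps. -/
def _root_.SpinPatch.slitVariation (u v : SpaceTime d → ℝ) (D : Set (SpaceTime d))
    (t : Fin k → Space d → ℝ) (Q : Fin k → Set (Space d)) (r : ℝ) (z : Space d) : ℝ≥0∞ :=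
  (∑ i, (Q i).indicator (fun z => ENNReal.ofReal |meanLim 1 (fun τ => u (τ, z)) (t i z) -
      meanLim (-1) (fun τ => u (τ, z)) (t i z)|) z) +
    ∫⁻ τ in timeLine (slitNhd D t Q r) z, ‖v (τ, z)‖ₑ

/-- At an active time the height `(2 / λ) |τ - t i z|` of a cone is below the rise of `u` over the
vertex, hence below the variation plus jumps. Each cone is therefore active within an interval of
length `λ` times that quantity. -/
theorem ae_volume_timeLine_cutSet_le (H : IsSlitField M u v A D t Q) {lam : ℝ} (hl : 0 < lam) :
    ∀ᵐ z, volume (timeLine (cutSet (2 / lam) u D t Q) z) ≤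
      ∑ i, (Q i).indicator (fun z => ENNReal.ofReal lam * min 2 (slitVariation u v D t Q lam z)) z := by
  filter_upwards [H.ae_isPiecewisePrimitive] with z hz
  set O := slitVariation u v D t Q lam z with hO
  have hfin : min 2 O ≠ ⊤ := ne_top_of_le_ne_top (by simp) (min_le_left _ _)
  -- The variation may be infinite. The cap 2 keeps the radius finite and reflects `|τ - t i z| <
  -- λ`; it is also what settles the case `δ > 1` later.
  set w := (min 2 O).toReal with hw
  have key : ∀ᵐ τ, τ ∈ timeLine (cutSet (2 / lam) u D t Q) z →
      ∃ i, z ∈ Q i ∧ |τ - t i z| ≤ lam * w / 2 := by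
    filter_upwards [hz.ae_sub_le] with τ hτ hmem
    obtain ⟨i, hi, hlt⟩ := H.exists_of_mem_cutSet hmem
    refine ⟨i, hi.1, ?_⟩
    have hlam := H.abs_sub_lt hl hlt
    have hle := hτ (t i z) (mem_slitTimes.2 ⟨i, hi.1, rfl⟩) hi.2
    have h1 : 2 / lam * |τ - t i z| ≤ (∫ s in Set.uIoc (t i z) τ, |v (s, z)|) +
        ∑ s ∈ slitTimes t Q z, |meanLim 1 (fun τ => u (τ, z)) s -
          meanLim (-1) (fun τ => u (τ, z)) s| := by
      have := hlt
      simp only [lowerTrace] at this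
      linarith
    have h2 : ENNReal.ofReal (2 / lam * |τ - t i z|) ≤ O := by
      refine (ENNReal.ofReal_le_ofReal h1).trans (ENNReal.ofReal_add_le.trans ?_)
      rw [add_comm, hO, slitVariation]
      refine add_le_add ?_ ?_
      · rw [ENNReal.ofReal_sum_of_nonneg fun _ _ => abs_nonneg _]
        classical
        have e : slitTimes t Q z = (Finset.univ.filter fun i => z ∈ Q i).image fun i => t i z := by
          unfold slitTimes
          congr
        rw [e]
        -- Several pieces may meet the line at the same time; the sum over times counts such a jump
        -- once, the sum over pieces repeatedly.
        refine (Finset.sum_image_le_of_nonneg (fun _ _ => zero_le)).trans ?_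
        rw [Finset.sum_filter]
        refine Finset.sum_le_sum fun j _ => ?_
        rw [Set.indicator_apply]
      · have hint := intervalIntegrable_iff.1 (hz.intervalIntegrable _ _ hi.2)
        have h5 := ofReal_integral_norm_eq_lintegral_enorm hint
        simp only [Real.norm_eq_abs] at h5
        rw [h5]
        refine lintegral_mono_set fun s hs => ?_
        have hs' := Set.uIoc_subset_uIcc hs
        refine ⟨hi.2 hs', i, hi.1, lt_of_le_of_lt ?_ hlam⟩
        exact Set.abs_sub_left_of_mem_uIcc hs'
    have h3 : ENNReal.ofReal (2 / lam * |τ - t i z|) ≤ min 2 O := by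
      refine le_min ?_ h2
      rw [← ENNReal.ofReal_ofNat]
      refine ENNReal.ofReal_le_ofReal ?_
      rw [div_mul_eq_mul_div, div_le_iff₀ hl]
      linarith
    have h4 := (ENNReal.ofReal_le_iff_le_toReal hfin).1 h3
    rw [div_mul_eq_mul_div, div_le_iff₀ hl] at h4
    linarith
  have hsub : volume (timeLine (cutSet (2 / lam) u D t Q) z) ≤
      volume (⋃ i, {τ : ℝ | z ∈ Q i ∧ |τ - t i z| ≤ lam * w / 2}) := by
    refine measure_mono_ae ?_
    filter_upwards [key] with τ hτ hmem
    exact Set.mem_iUnion.2 (hτ hmem)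
  refine hsub.trans ((measure_iUnion_fintype_le _ _).trans (Finset.sum_le_sum fun i _ => ?_))
  by_cases hz' : z ∈ Q i
  · rw [Set.indicator_of_mem hz']
    have e : {τ : ℝ | z ∈ Q i ∧ |τ - t i z| ≤ lam * w / 2} =
        Metric.closedBall (t i z) (lam * w / 2) := by
      ext τ
      simp [hz', Real.dist_eq]
    rw [e, Real.volume_closedBall, show 2 * (lam * w / 2) = lam * w by ring,
      ENNReal.ofReal_mul hl.le, ENNReal.ofReal_toReal hfin]
  · simp [hz']

end IsSlitField

theorem volume_eq_lintegral_timeLine {E : Set (SpaceTime d)} (hE : MeasurableSet E) :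
    volume E = ∫⁻ z : Space d, volume (timeLine E z) := by
  rw [Measure.volume_eq_prod, Measure.prod_apply_symm hE]
  rfl

theorem lintegral_timeLine {E : Set (SpaceTime d)} (hE : MeasurableSet E) {f : SpaceTime d → ℝ≥0∞}
    (hf : Measurable f) :
    Measurable (fun z : Space d => ∫⁻ τ in timeLine E z, f (τ, z)) ∧
      ∫⁻ z : Space d, ∫⁻ τ in timeLine E z, f (τ, z) = ∫⁻ p in E, f p := by
  have e : ∀ z : Space d, ∫⁻ τ in timeLine E z, f (τ, z) = ∫⁻ τ, E.indicator f (τ, z) := by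
    intro z
    rw [← lintegral_indicator (show MeasurableSet (timeLine E z) from measurable_prodMk_right hE)]
    rfl
  simp only [e]
  have hm := hf.indicator hE
  refine ⟨hm.lintegral_prod_left', ?_⟩
  rw [← lintegral_indicator hE, Measure.volume_eq_prod, lintegral_prod_symm _ hm.aemeasurable]

namespace IsSlitField

variable {k : ℕ} {M : ℝ} {u v : SpaceTime d → ℝ} {A D : Set (SpaceTime d)}
  {t : Fin k → Space d → ℝ} {Q : Fin k → Set (Space d)}

/-- The absolute value of the jump of `u` on the graph of `t i`. -/
def _root_.SpinPatch.slitJump (u : SpaceTime d → ℝ) (t : Fin k → Space d → ℝ) (i : Fin k)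
    (z : Space d) : ℝ :=
  |meanLim 1 (fun τ => u (τ, z)) (t i z) - meanLim (-1) (fun τ => u (τ, z)) (t i z)|

theorem measurable_slitJump (H : IsSlitField M u v A D t Q) (i : Fin k) :
    Measurable (slitJump u t i) :=
  ((measurable_meanLim H.measurable (H.continuous i).measurable 1).sub
    (measurable_meanLim H.measurable (H.continuous i).measurable (-1))).norm

theorem volume_slitNhd_le (H : IsSlitField M u v A D t Q) (r : ℝ) :
    volume (slitNhd D t Q r) ≤ ∑ i, ENNReal.ofReal (2 * r) * volume (Q i) := by
  rw [volume_eq_lintegral_timeLine (H.measurableSet_slitNhd r)]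
  calc ∫⁻ z, volume (timeLine (slitNhd D t Q r) z)
      ≤ ∫⁻ z, ∑ i, (Q i).indicator (fun _ => ENNReal.ofReal (2 * r)) z := by
        refine lintegral_mono fun z => ?_
        have hsub : timeLine (slitNhd D t Q r) z ⊆ ⋃ i, {τ : ℝ | z ∈ Q i ∧ |τ - t i z| < r} := by
          rintro τ ⟨-, i, h⟩
          exact Set.mem_iUnion.2 ⟨i, h⟩
        refine (measure_mono hsub).trans ((measure_iUnion_fintype_le _ _).trans
          (Finset.sum_le_sum fun i _ => ?_))
        by_cases hz : z ∈ Q i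
        · rw [Set.indicator_of_mem hz]
          have e : {τ : ℝ | z ∈ Q i ∧ |τ - t i z| < r} = Metric.ball (t i z) r := by
            ext τ
            simp [hz, Real.dist_eq]
          rw [e, Real.volume_ball]
        · simp [hz]
    _ = _ := by
        rw [lintegral_finsetSum _ fun i _ => measurable_const.indicator (H.measurableSet i)]
        refine Finset.sum_congr rfl fun i _ => ?_
        rw [lintegral_indicator_const (H.measurableSet i)]

theorem lintegral_slitVariation (H : IsSlitField M u v A D t Q) (r : ℝ) :
    ∫⁻ z, slitVariation u v D t Q r z =
      (∑ i, ∫⁻ z in Q i, ENNReal.ofReal (slitJump u t i z)) + ∫⁻ p in slitNhd D t Q r, ‖v p‖ₑ := by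
  obtain ⟨h1, h2⟩ := lintegral_timeLine (H.measurableSet_slitNhd r) H.measurable_deriv.enorm
  have hm : ∀ i, Measurable ((Q i).indicator fun z => ENNReal.ofReal (slitJump u t i z)) :=
    fun i => (H.measurable_slitJump i).ennreal_ofReal.indicator (H.measurableSet i)
  unfold slitVariation
  rw [lintegral_add_right _ h1, h2]
  congr 1
  refine (lintegral_finsetSum _ fun i _ => hm i).trans (Finset.sum_congr rfl fun i _ => ?_)
  exact lintegral_indicator (H.measurableSet i) _

/-- `abs_le_add_Psi0` with `V = λ v`, divided by `λ`. The constant part `δ / λ` meets durations at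
most `2 λ` per slit and leaves `2 δ`. -/
theorem lintegral_slitNhd_le {lam δ : ℝ} (H : IsSlitField M u v A D t Q) (hl : 0 < lam)
    (hδ : 0 < δ) (hδ1 : δ ≤ 1) :
    ∫⁻ p in slitNhd D t Q lam, ‖v p‖ₑ ≤ (∑ i, 2 * ∫⁻ _ in Q i, ENNReal.ofReal δ) +
      8 * ENNReal.ofReal δ⁻¹ * (ENNReal.ofReal lam⁻¹ *
        ∫⁻ p in slitNhd D t Q lam, ENNReal.ofReal (Psi0 (lam * v p))) := by
  have hl' : 0 < lam⁻¹ := inv_pos.2 hl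
  have hδ' : 0 < δ⁻¹ := inv_pos.2 hδ
  have hpt : ∀ p, ‖v p‖ₑ ≤ ENNReal.ofReal (lam⁻¹ * δ) +
      ENNReal.ofReal (8 * (δ⁻¹ * lam⁻¹)) * ENNReal.ofReal (Psi0 (lam * v p)) := by
    intro p
    rw [← ENNReal.ofReal_mul (by positivity), ← ENNReal.ofReal_add (by positivity)
      (mul_nonneg (by positivity) (Psi0_nonneg _)), Real.enorm_eq_ofReal_abs]
    refine ENNReal.ofReal_le_ofReal ?_
    have h := abs_le_add_Psi0 hδ hδ1 (lam * v p)
    rw [abs_mul, abs_of_pos hl] at h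
    calc |v p| = lam⁻¹ * (lam * |v p|) := by field_simp
      _ ≤ lam⁻¹ * (δ + 8 * (δ⁻¹ * Psi0 (lam * v p))) := by gcongr
      _ = _ := by ring
  refine (lintegral_mono hpt).trans ?_
  rw [lintegral_add_left measurable_const, lintegral_const_mul' _ _ ENNReal.ofReal_ne_top,
    lintegral_const, Measure.restrict_apply MeasurableSet.univ, Set.univ_inter]
  refine add_le_add ?_ (le_of_eq ?_)
  · refine (mul_le_mul_right (H.volume_slitNhd_le lam) _).trans ?_
    rw [Finset.mul_sum]
    refine Finset.sum_le_sum fun i _ => le_of_eq ?_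
    have e : ENNReal.ofReal (lam⁻¹ * δ * (2 * lam)) = 2 * ENNReal.ofReal δ := by
      rw [show lam⁻¹ * δ * (2 * lam) = 2 * δ by field_simp, ENNReal.ofReal_mul (by norm_num),
        ENNReal.ofReal_ofNat]
    rw [lintegral_const, Measure.restrict_apply MeasurableSet.univ, Set.univ_inter, ← mul_assoc,
      ← mul_assoc, ← ENNReal.ofReal_mul (by positivity), e]
  · rw [ENNReal.ofReal_mul (by positivity), ENNReal.ofReal_mul hδ'.le, ENNReal.ofReal_ofNat]
    ring

/-- The volume of the set where the barrier is active is controlled by the jumps, the width of the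
slits, and the energy near the slits. -/
theorem volume_cutSet_le (H : IsSlitField M u v A D t Q) {lam δ : ℝ} (hl : 0 < lam)
    (hδ : 0 < δ) :
    volume (cutSet (2 / lam) u D t Q) ≤ ENNReal.ofReal lam *
      ((3 * k + 2) * (∑ i, ∫⁻ z in Q i, ENNReal.ofReal (slitJump u t i z + lam + δ)) +
        8 * k * (ENNReal.ofReal δ⁻¹ * (ENNReal.ofReal lam⁻¹ *
          ∫⁻ p in slitNhd D t Q lam, ENNReal.ofReal (Psi0 (lam * v p))))) := by
  set Y := ∑ i, ∫⁻ z in Q i, ENNReal.ofReal (slitJump u t i z + lam + δ) with hY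
  set I := ENNReal.ofReal lam⁻¹ *
    ∫⁻ p in slitNhd D t Q lam, ENNReal.ofReal (Psi0 (lam * v p)) with hI
  have hJ0 : ∀ i z, 0 ≤ slitJump u t i z := fun i z => abs_nonneg _
  have hJ : ∀ i z, ENNReal.ofReal (slitJump u t i z) ≤
      ENNReal.ofReal (slitJump u t i z + lam + δ) := fun i z =>
    ENNReal.ofReal_le_ofReal (by linarith)
  have hD : ∀ i z, ENNReal.ofReal δ ≤ ENNReal.ofReal (slitJump u t i z + lam + δ) := fun i z =>
    ENNReal.ofReal_le_ofReal (by linarith [hJ0 i z])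
  have h1 : volume (cutSet (2 / lam) u D t Q) ≤
      ∑ i, ∫⁻ z, (Q i).indicator
        (fun z => ENNReal.ofReal lam * min 2 (slitVariation u v D t Q lam z)) z := by
    rw [volume_eq_lintegral_timeLine H.measurableSet_cutSet]
    refine (lintegral_mono_ae (H.ae_volume_timeLine_cutSet_le hl)).trans (le_of_eq ?_)
    refine lintegral_finsetSum _ fun i _ => Measurable.indicator ?_ (H.measurableSet i)
    refine measurable_const.mul (measurable_const.min ?_)
    refine Measurable.add ?_ (lintegral_timeLine (H.measurableSet_slitNhd lam)
      H.measurable_deriv.enorm).1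
    exact Finset.measurable_fun_sum _ fun j _ =>
      (H.measurable_slitJump j).ennreal_ofReal.indicator (H.measurableSet j)
  refine h1.trans ?_
  simp only [lintegral_indicator (H.measurableSet _), lintegral_const_mul' _ _ ENNReal.ofReal_ne_top]
  rw [← Finset.mul_sum]
  refine mul_le_mul_right ?_ _
  -- For `δ ≤ 1` the variation is used: one `Y` from the jumps and two from `δ`, for each of the `k`
  -- cones. For `δ > 1` the cap gives `2 ≤ 2 δ`. The final constant is the sum of both cases.
  rcases le_or_gt δ 1 with hδ1 | hδ1
  · have h2 : ∀ i, ∫⁻ z in Q i, min 2 (slitVariation u v D t Q lam z) ≤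
        3 * Y + 8 * (ENNReal.ofReal δ⁻¹ * I) := by
      intro i
      calc ∫⁻ z in Q i, min 2 (slitVariation u v D t Q lam z)
          ≤ ∫⁻ z, slitVariation u v D t Q lam z :=
            (lintegral_mono fun z => min_le_right _ _).trans (setLIntegral_le_lintegral _ _)
        _ ≤ Y + (2 * Y + 8 * (ENNReal.ofReal δ⁻¹ * I)) := by
            rw [H.lintegral_slitVariation]
            refine add_le_add ?_ ((H.lintegral_slitNhd_le hl hδ hδ1).trans (add_le_add ?_ ?_))
            · exact Finset.sum_le_sum fun i _ => lintegral_mono fun z => hJ i z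
            · rw [hY, Finset.mul_sum]
              exact Finset.sum_le_sum fun i _ => mul_le_mul_right (lintegral_mono fun z => hD i z) _
            · rw [mul_assoc]
        _ = _ := by ring
    calc _ ≤ ∑ _i : Fin k, (3 * Y + 8 * (ENNReal.ofReal δ⁻¹ * I)) :=
          Finset.sum_le_sum fun i _ => h2 i
      _ = k * (3 * Y + 8 * (ENNReal.ofReal δ⁻¹ * I)) := by
          rw [Finset.sum_const, Finset.card_univ, Fintype.card_fin, nsmul_eq_mul]
      _ ≤ k * (3 * Y + 8 * (ENNReal.ofReal δ⁻¹ * I)) + 2 * Y := le_self_add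
      _ = _ := by ring
  · calc _ ≤ ∑ i, 2 * ∫⁻ z in Q i, ENNReal.ofReal (slitJump u t i z + lam + δ) := by
          refine Finset.sum_le_sum fun i _ => ?_
          rw [← lintegral_const_mul' _ _ (by simp)]
          refine lintegral_mono fun z => (min_le_left _ _).trans ?_
          refine le_mul_of_one_le_right' (le_trans ?_ (hD i z))
          rw [ENNReal.one_le_ofReal]
          exact hδ1.le
      _ = 2 * Y := by rw [← Finset.mul_sum]
      _ ≤ 2 * Y + (3 * k * Y + 8 * k * (ENNReal.ofReal δ⁻¹ * I)) := le_self_add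
      _ = _ := by ring

end IsSlitField

/-! ### Comparison of energies -/

theorem ae_ae_slice {p : SpaceTime d → Prop} (h : ∀ᵐ x, p x) :
    ∀ᵐ τ : ℝ, ∀ᵐ z : Space d, p (τ, z) :=
  Measure.ae_ae_of_ae_prod h

theorem measurableSet_slice {A : Set (SpaceTime d)} (hA : MeasurableSet A) (τ : ℝ) :
    MeasurableSet (slice A τ) :=
  measurable_prodMk_left hA

theorem volume_eq_lintegral_slice {E : Set (SpaceTime d)} (hE : MeasurableSet E) :
    volume E = ∫⁻ τ : ℝ, volume (slice E τ) := by
  rw [Measure.volume_eq_prod, Measure.prod_apply hE]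
  rfl

theorem measurable_volume_slice {E : Set (SpaceTime d)} (hE : MeasurableSet E) :
    Measurable fun τ : ℝ => volume (slice E τ) :=
  measurable_measure_prodMk_left hE

/-- Stated for iterated integrals because the energy densities of `u` and `v` need not be
measurable; only the indicator of `E` is split off and integrated by Fubini. -/
theorem lintegral_slice_le {A D E : Set (SpaceTime d)} (hA : MeasurableSet A)
    (hD : MeasurableSet D) (hE : MeasurableSet E) {F G : SpaceTime d → ℝ≥0∞} {a b : ℝ≥0∞}
    (ha : a ≠ ⊤) (h : ∀ᵐ p, p ∈ D → F p ≤ a * A.indicator G p + E.indicator (fun _ => b) p) :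
    ∫⁻ τ : ℝ, ∫⁻ z in slice D τ, F (τ, z) ≤
      a * (∫⁻ τ : ℝ, ∫⁻ z in slice A τ, G (τ, z)) + b * volume E := by
  have key : ∀ᵐ τ : ℝ, ∫⁻ z in slice D τ, F (τ, z) ≤
      a * (∫⁻ z in slice A τ, G (τ, z)) + b * volume (slice E τ) := by
    filter_upwards [ae_ae_slice h] with τ hτ
    calc ∫⁻ z in slice D τ, F (τ, z)
        ≤ ∫⁻ z in slice D τ,
            (a * A.indicator G (τ, z) + E.indicator (fun _ => b) (τ, z)) := by
          exact lintegral_mono_ae ((ae_restrict_iff' (measurableSet_slice hD τ)).2 hτ)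
      _ ≤ ∫⁻ z, (a * (slice A τ).indicator (fun z => G (τ, z)) z +
            (slice E τ).indicator (fun _ => b) z) := setLIntegral_le_lintegral _ _
      _ = _ := by
          rw [lintegral_add_right _ (measurable_const.indicator (measurableSet_slice hE τ)),
            lintegral_const_mul' _ _ ha, lintegral_indicator (measurableSet_slice hA τ),
            lintegral_indicator_const (measurableSet_slice hE τ)]
  refine (lintegral_mono_ae key).trans (le_of_eq ?_)
  rw [lintegral_add_right _ ((measurable_volume_slice hE).const_mul b),
    lintegral_const_mul' _ _ ha, lintegral_const_mul _ (measurable_volume_slice hE),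
    volume_eq_lintegral_slice hE]

/-- Changing a field on a set where the new density is bounded. -/
theorem localEnergy_le {β lam K : ℝ} {J : Space d → ℝ} {u v u' v' : SpaceTime d → ℝ}
    {A D E : Set (SpaceTime d)} (hA : MeasurableSet A) (hD : MeasurableSet D)
    (hE : MeasurableSet E) (hl : 0 ≤ lam)
    (h : ∀ᵐ p, p ∈ D → p ∉ E → p ∈ A ∧ u' p = u p ∧ v' p = v p)
    (hK : ∀ᵐ p, p ∈ D → p ∈ E →
      wellPotential β (mass J) (u' p) + 1 / (2 * β) * Psi (u' p) (lam * v' p) ≤ K) :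
    localEnergy β J lam u' v' D ≤
      localEnergy β J lam u v A + ENNReal.ofReal (lam⁻¹ * K) * volume E := by
  have := lintegral_slice_le hA hD hE (a := 1) (b := ENNReal.ofReal (lam⁻¹ * K))
    (F := fun p => ENNReal.ofReal (lam⁻¹ * (wellPotential β (mass J) (u' p) +
      1 / (2 * β) * Psi (u' p) (lam * v' p))))
    (G := fun p => ENNReal.ofReal (lam⁻¹ * (wellPotential β (mass J) (u p) +
      1 / (2 * β) * Psi (u p) (lam * v p)))) ENNReal.one_ne_top (by
    filter_upwards [h, hK] with p hp hpK hpD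
    by_cases hpE : p ∈ E
    · rw [Set.indicator_of_mem hpE]
      refine le_trans (ENNReal.ofReal_le_ofReal ?_) le_add_self
      exact mul_le_mul_of_nonneg_left (hpK hpD hpE) (inv_nonneg.2 hl)
    · obtain ⟨h1, h2, h3⟩ := hp hpD hpE
      rw [Set.indicator_of_mem h1, h2, h3, one_mul]
      exact le_self_add)
  rw [one_mul] at this
  exact this

theorem lintegral_scaledKernel {J : Space d → ℝ} (hJ0 : ∀ x, 0 ≤ J x) (hJ : Integrable J)
    {lam : ℝ} (hl : 0 < lam) :
    ∫⁻ x, ENNReal.ofReal (scaledKernel J lam x) = ENNReal.ofReal (mass J) := by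
  have hi : Integrable (scaledKernel J lam) :=
    (hJ.comp_smul (inv_ne_zero hl.ne')).const_mul _
  rw [← ofReal_integral_eq_lintegral_ofReal hi (ae_of_all _ fun x =>
    mul_nonneg (by positivity) (hJ0 _))]
  congr 1
  unfold scaledKernel mass
  rw [integral_const_mul, Measure.integral_comp_inv_smul_of_nonneg _ _ hl.le,
    finrank_euclideanSpace_fin, smul_eq_mul, ← mul_assoc, inv_mul_cancel₀ (by positivity), one_mul]

theorem aemeasurable_scaledKernel {J : Space d → ℝ} (hJ : Integrable J) {lam : ℝ} (hl : 0 < lam) :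
    AEMeasurable fun x => ENNReal.ofReal (scaledKernel J lam x) :=
  ((hJ.comp_smul (inv_ne_zero hl.ne')).const_mul _).aemeasurable.ennreal_ofReal

/-- Changing a spin field on a set `E` changes the locality defect at most by a multiple of the
volume of `E`. -/
theorem defectSlice_le {J : Space d → ℝ} (hJ0 : ∀ x, 0 ≤ J x) (hJ : Integrable J)
    {lam : ℝ} (hl : 0 < lam) {s s' : Space d → ℝ} {B E : Set (Space d)} (hB : MeasurableSet B)
    (hE : MeasurableSet E) (hs' : ∀ z ∈ B, |s' z| ≤ 1)
    (h : ∀ᵐ z, z ∈ B → z ∉ E → s' z = s z) :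
    defectSlice J lam s' B B ≤
      defectSlice J lam s B B + 2 * ENNReal.ofReal (lam⁻¹ * mass J) * volume E := by
  -- The kernel is only almost everywhere measurable; a measurable version is needed to exchange the
  -- integrals over `z` and `w`.
  set g := (aemeasurable_scaledKernel hJ hl).mk _ with hg
  have hgm : Measurable g := (aemeasurable_scaledKernel hJ hl).measurable_mk
  have hge : ∀ᵐ x, ENNReal.ofReal (scaledKernel J lam x) = g x :=
    (aemeasurable_scaledKernel hJ hl).ae_eq_mk
  have hgi : ∫⁻ x, g x = ENNReal.ofReal (mass J) := by
    rw [← lintegral_scaledKernel hJ0 hJ hl]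
    exact (lintegral_congr_ae hge).symm
  set χ : Space d → ℝ≥0∞ := E.indicator fun _ => 1 with hχ
  have hχm : Measurable χ := measurable_const.indicator hE
  set b : ℝ≥0∞ := ENNReal.ofReal lam⁻¹ with hb
  -- Only pairs with a point in `E` change. For them the squared difference is at most 4, which
  -- cancels the 4 in the prefactor; each of the two indicators then integrates to `Ĵ |E|`.
  set R : Space d → Space d → ℝ≥0∞ := fun z w => b * (g (z - w) * (χ z + χ w)) with hR
  have hRm : Measurable (Function.uncurry R) := by
    unfold Function.uncurry
    fun_prop
  have hRmz : ∀ z, Measurable (R z) := fun z => hRm.comp measurable_prodMk_left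
  have hpt : ∀ᵐ z, z ∈ B → ∀ᵐ w, w ∈ B →
      ENNReal.ofReal (1 / (4 * lam) * scaledKernel J lam (z - w) * (s' z - s' w) ^ 2) ≤
        ENNReal.ofReal (1 / (4 * lam) * scaledKernel J lam (z - w) * (s z - s w) ^ 2) + R z w := by
    filter_upwards [h] with z hz hzB
    have hq : ∀ᵐ w, ENNReal.ofReal (scaledKernel J lam (z - w)) = g (z - w) :=
      (quasiMeasurePreserving_sub_left volume z).ae hge
    filter_upwards [h, hq] with w hw hgw hwB
    have hk : 0 ≤ scaledKernel J lam (z - w) := mul_nonneg (by positivity) (hJ0 _)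
    by_cases hE' : z ∈ E ∨ w ∈ E
    · have h1 : 1 ≤ χ z + χ w := by
        rcases hE' with h | h
        · exact le_add_of_le_left (by rw [hχ, Set.indicator_of_mem h])
        · exact le_add_of_le_right (by rw [hχ, Set.indicator_of_mem h])
      refine le_trans ?_ le_add_self
      calc _ ≤ ENNReal.ofReal (lam⁻¹ * scaledKernel J lam (z - w)) := by
            refine ENNReal.ofReal_le_ofReal ?_
            have h2 : (s' z - s' w) ^ 2 ≤ 4 := by
              have a1 := abs_le.1 (hs' z hzB)
              have a2 := abs_le.1 (hs' w hwB)
              nlinarith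
            calc 1 / (4 * lam) * scaledKernel J lam (z - w) * (s' z - s' w) ^ 2
                ≤ 1 / (4 * lam) * scaledKernel J lam (z - w) * 4 := by gcongr
              _ = _ := by field_simp
        _ = b * (g (z - w) * 1) := by rw [ENNReal.ofReal_mul (by positivity), hgw, mul_one]
        _ ≤ b * (g (z - w) * (χ z + χ w)) := by gcongr
    · rw [not_or] at hE'
      rw [hz hzB hE'.1, hw hwB hE'.2]
      exact le_self_add
  have h1 : defectSlice J lam s' B B ≤ ∫⁻ z in B, ((∫⁻ w in B,
      ENNReal.ofReal (1 / (4 * lam) * scaledKernel J lam (z - w) * (s z - s w) ^ 2)) +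
        ∫⁻ w, R z w) := by
    refine lintegral_mono_ae ((ae_restrict_iff' hB).2 ?_)
    filter_upwards [hpt] with z hz hzB
    calc _ ≤ ∫⁻ w in B, (ENNReal.ofReal
          (1 / (4 * lam) * scaledKernel J lam (z - w) * (s z - s w) ^ 2) + R z w) := by
          exact lintegral_mono_ae ((ae_restrict_iff' hB).2 (hz hzB))
      _ = _ := lintegral_add_right _ (hRmz z)
      _ ≤ _ := add_le_add le_rfl (setLIntegral_le_lintegral _ _)
  refine h1.trans ?_
  rw [lintegral_add_right _ (show Measurable fun z => ∫⁻ w, R z w from hRm.lintegral_prod_right')]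
  refine add_le_add le_rfl ((setLIntegral_le_lintegral _ _).trans (le_of_eq ?_))
  have e1 : ∀ z, ∫⁻ w, g (z - w) = ENNReal.ofReal (mass J) := fun z => by
    rw [lintegral_sub_left_eq_self g z, hgi]
  have e2 : ∀ w, ∫⁻ z, g (z - w) = ENNReal.ofReal (mass J) := fun w => by
    rw [lintegral_sub_right_eq_self g w, hgi]
  have e3 : ∫⁻ z, χ z = volume E := by rw [hχ, lintegral_indicator_const hE, one_mul]
  have m1 : Measurable fun y : Space d × Space d => g (y.1 - y.2) * χ y.1 := by fun_prop
  have m2 : Measurable fun y : Space d × Space d => g (y.1 - y.2) * χ y.2 := by fun_prop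
  have i1 : ∫⁻ z, ∫⁻ w, g (z - w) * χ z = ENNReal.ofReal (mass J) * volume E := by
    have : ∀ z, ∫⁻ w, g (z - w) * χ z = ENNReal.ofReal (mass J) * χ z := fun z => by
      rw [lintegral_mul_const _ (by fun_prop), e1]
    simp only [this]
    rw [lintegral_const_mul _ hχm, e3]
  have i2 : ∫⁻ z, ∫⁻ w, g (z - w) * χ w = ENNReal.ofReal (mass J) * volume E := by
    rw [lintegral_lintegral_swap m2.aemeasurable]
    have : ∀ w, ∫⁻ z, g (z - w) * χ w = ENNReal.ofReal (mass J) * χ w := fun w => by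
      rw [lintegral_mul_const _ (by fun_prop), e2]
    simp only [this]
    rw [lintegral_const_mul _ hχm, e3]
  have hin : ∀ z, ∫⁻ w, R z w = b * ((∫⁻ w, g (z - w) * χ z) + ∫⁻ w, g (z - w) * χ w) := by
    intro z
    have a1 : Measurable fun w => g (z - w) * χ z := by fun_prop
    rw [← lintegral_add_left a1, ← lintegral_const_mul' _ _ ENNReal.ofReal_ne_top]
    simp only [hR, hb, mul_add]
  simp only [hin]
  rw [lintegral_const_mul' _ _ ENNReal.ofReal_ne_top,
    lintegral_add_left (Measurable.lintegral_prod_right' m1), i1, i2,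
    ENNReal.ofReal_mul (by positivity)]
  ring

theorem defect_le {J : Space d → ℝ} (hJ0 : ∀ x, 0 ≤ J x) (hJ : Integrable J)
    {lam : ℝ} (hl : 0 < lam) {u u' : SpaceTime d → ℝ} {B E : Set (SpaceTime d)}
    (hB : MeasurableSet B) (hE : MeasurableSet E) (hu' : ∀ p ∈ B, |u' p| ≤ 1)
    (h : ∀ᵐ p, p ∈ B → p ∉ E → u' p = u p) :
    defect J lam u' B B ≤
      defect J lam u B B + 2 * ENNReal.ofReal (lam⁻¹ * mass J) * volume E := by
  have key : ∀ᵐ τ : ℝ, defectSlice J lam (fun z => u' (τ, z)) (slice B τ) (slice B τ) ≤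
      defectSlice J lam (fun z => u (τ, z)) (slice B τ) (slice B τ) +
        2 * ENNReal.ofReal (lam⁻¹ * mass J) * volume (slice E τ) := by
    filter_upwards [ae_ae_slice h] with τ hτ
    exact defectSlice_le hJ0 hJ hl (measurableSet_slice hB τ) (measurableSet_slice hE τ)
      (fun z hz => hu' _ hz) hτ
  refine (lintegral_mono_ae key).trans (le_of_eq ?_)
  rw [lintegral_add_right _ ((measurable_volume_slice hE).const_mul _),
    lintegral_const_mul _ (measurable_volume_slice hE), volume_eq_lintegral_slice hE]
  rfl

/-- Both fields are bounded by 1 on `B`, so `defect_le` applies with their roles exchanged. -/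
theorem absDiff_defect_le {J : Space d → ℝ} (hJ0 : ∀ x, 0 ≤ J x) (hJ : Integrable J)
    {lam : ℝ} (hl : 0 < lam) {u u' : SpaceTime d → ℝ} {B E : Set (SpaceTime d)}
    (hB : MeasurableSet B) (hE : MeasurableSet E) (hu : ∀ p ∈ B, |u p| ≤ 1)
    (hu' : ∀ p ∈ B, |u' p| ≤ 1) (h : ∀ᵐ p, p ∈ B → p ∉ E → u' p = u p) :
    absDiff (defect J lam u' B B) (defect J lam u B B) ≤
      2 * ENNReal.ofReal (lam⁻¹ * mass J) * volume E := by
  refine max_le (tsub_le_iff_left.2 (defect_le hJ0 hJ hl hB hE hu' h))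
    (tsub_le_iff_left.2 (defect_le hJ0 hJ hl hB hE hu ?_))
  filter_upwards [h] with p hp hpB hpE
  exact (hp hpB hpE).symm

/-! ### Representatives -/

theorem HasWeakTimeDeriv.congr {u v u' v' : SpaceTime d → ℝ} {A : Set (SpaceTime d)}
    (H : HasWeakTimeDeriv u v A) (hA : IsOpen A) (hu : ∀ᵐ p, p ∈ A → u' p = u p)
    (hv : ∀ᵐ p, p ∈ A → v' p = v p) : HasWeakTimeDeriv u' v' A := by
  have key : ∀ f f' : SpaceTime d → ℝ, (∀ᵐ p, p ∈ A → f' p = f p) → LocallyIntegrableOn f A →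
      LocallyIntegrableOn f' A := by
    intro f f' h hf
    rw [locallyIntegrableOn_iff hA.isLocallyClosed] at hf ⊢
    intro K hKA hK
    refine (hf K hKA hK).congr ?_
    rw [Filter.EventuallyEq, ae_restrict_iff' hK.measurableSet]
    filter_upwards [h] with p hp hpK
    exact (hp (hKA hpK)).symm
  refine ⟨key _ _ hu H.locInt, key _ _ hv H.locInt_deriv, fun φ h1 h2 h3 => ?_⟩
  rw [setIntegral_congr_ae (g := fun p => u p * fderiv ℝ φ p (1, 0)) hA.measurableSet,
    setIntegral_congr_ae (f := fun p => v' p * φ p) (g := fun p => v p * φ p) hA.measurableSet]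
  · exact H.integral_eq φ h1 h2 h3
  · filter_upwards [hv] with p hp hpA
    rw [hp hpA]
  · filter_upwards [hu] with p hp hpA
    rw [hp hpA]

theorem exists_measurable_eq {f : SpaceTime d → ℝ} {A : Set (SpaceTime d)} (hA : IsOpen A)
    (hf : LocallyIntegrableOn f A) :
    ∃ g : SpaceTime d → ℝ, Measurable g ∧ ∀ᵐ p, p ∈ A → g p = f p := by
  have h := hf.aestronglyMeasurable.aemeasurable
  refine ⟨h.mk f, h.measurable_mk, ?_⟩
  rw [← ae_restrict_iff' hA.measurableSet]
  exact h.ae_eq_mk.symm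

/-! ### Planar slits -/

/-- The projection of the part in `D` of the `i`-th piece, unless that piece lies in a time-like
plane. -/
def planeSlit {k : ℕ} (P : Fin k → Set (SpaceTime d)) (n : Fin k → Normal d) (c : Fin k → ℝ)
    (D : Set (SpaceTime d)) (i : Fin k) : Set (Space d) :=
  {z | (n i).fst ≠ 0 ∧ (planeTime (n i) (c i) z, z) ∈ P i ∩ D}

section Slits

variable {k : ℕ} {P : Fin k → Set (SpaceTime d)} {n : Fin k → Normal d} {c : Fin k → ℝ}

theorem measurableSet_planeSlit (hP : ∀ i, MeasurableSet (P i)) {D : Set (SpaceTime d)}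
    (hD : IsOpen D) (i : Fin k) : MeasurableSet (planeSlit P n c D i) := by
  have h := (continuous_planeTime (n i) (c i)).measurable
  refine MeasurableSet.inter (MeasurableSet.const _) ?_
  exact (show Measurable fun z => (planeTime (n i) (c i) z, z) by fun_prop)
    ((hP i).inter hD.measurableSet)

/-- On almost all time lines the planar surface consists of the times at which one of its
non-vertical pieces is met. -/
theorem ae_planeSlit (hn : ∀ i, ‖n i‖ = 1)
    (hPc : ∀ i, ∀ p ∈ P i, inner ℝ (n i) (WithLp.toLp 2 p) = c i) (D : Set (SpaceTime d)) :
    ∀ᵐ z, ∀ τ, (τ, z) ∈ D → (τ, z) ∈ ⋃ i, P i →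
      ∃ i, z ∈ planeSlit P n c D i ∧ τ = planeTime (n i) (c i) z := by
  have h : ∀ᵐ z : Space d, ∀ i, (n i).fst = 0 → inner ℝ (n i).snd z ≠ c i := by
    rw [ae_all_iff]
    intro i
    by_cases h0 : (n i).fst = 0
    · filter_upwards [measure_eq_zero_iff_ae_notMem.1 (volume_vertical_eq_zero (hn i) h0 (c i))]
        with z hz _ using hz
    · exact ae_of_all _ fun z h => absurd h h0
  filter_upwards [h] with z hz τ hτ hS
  obtain ⟨i, hi⟩ := Set.mem_iUnion.1 hS
  have h0 : (n i).fst ≠ 0 := by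
    intro h0
    refine hz i h0 ?_
    have := hPc i _ hi
    rw [WithLp.prod_inner_apply, show (n i).ofLp.1 = 0 from h0] at this
    simpa using this
  have h1 := eq_planeTime h0 (hPc i _ hi)
  have h1' : τ = planeTime (n i) (c i) z := h1
  exact ⟨i, ⟨h0, h1' ▸ ⟨hi, hτ⟩⟩, h1'⟩

variable {A D : Set (SpaceTime d)} {u v : SpaceTime d → ℝ}

/-- Almost no point of `D` lies on the planar surface. -/
theorem ae_notMem_iUnion (hP : ∀ i, MeasurableSet (P i)) (hn : ∀ i, ‖n i‖ = 1)
    (hPc : ∀ i, ∀ p ∈ P i, inner ℝ (n i) (WithLp.toLp 2 p) = c i) :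
    ∀ᵐ p, p ∉ ⋃ i, P i := by
  have hms : MeasurableSet {p : SpaceTime d | p ∉ ⋃ i, P i} :=
    (MeasurableSet.iUnion hP).compl
  refine ae_of_ae_ae hms ?_
  filter_upwards [ae_planeSlit hn hPc Set.univ] with z hz
  have hfin : (Set.range fun i => planeTime (n i) (c i) z).Finite := Set.finite_range _
  filter_upwards [measure_eq_zero_iff_ae_notMem.1 (hfin.measure_zero volume)] with τ hτ hS
  obtain ⟨i, -, h⟩ := hz τ trivial hS
  exact hτ ⟨i, h.symm⟩

/-- A field of finite local energy has a representative which is a slit field. -/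
theorem exists_isSlitField {β lam : ℝ} {J : Space d → ℝ} (hβ : 0 < β) (hJ : 1 < β * mass J)
    (hl : 0 < lam) (hP : ∀ i, MeasurableSet (P i)) (hn : ∀ i, ‖n i‖ = 1)
    (hPc : ∀ i, ∀ p ∈ P i, inner ℝ (n i) (WithLp.toLp 2 p) = c i)
    (hA : IsOpen A) (hD : IsOpen D) (hDA : D ⊆ A ∪ ⋃ i, P i)
    (hu : ∀ p ∈ A, u p ∈ Set.Icc (-spinEq β (mass J)) (spinEq β (mass J)))
    (H : HasWeakTimeDeriv u v A) (hE : localEnergy β J lam u v A < ⊤) :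
    ∃ u₁ v₁ : SpaceTime d → ℝ, (∀ᵐ p, p ∈ A → u₁ p = u p) ∧ (∀ᵐ p, p ∈ A → v₁ p = v p) ∧
      IsSlitField (spinEq β (mass J)) u₁ v₁ A D (fun i => planeTime (n i) (c i))
        (planeSlit P n c D) := by
  set s := spinEq β (mass J) with hs
  have hs0 : 0 ≤ s := spinEq_nonneg _ _
  obtain ⟨u₀, hu₀, hu₀u⟩ := exists_measurable_eq hA H.locInt
  obtain ⟨v₁, hv₁, hv₁v⟩ := exists_measurable_eq hA H.locInt_deriv
  have hu₁ : ∀ᵐ p, p ∈ A → max (-s) (min s (u₀ p)) = u p := by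
    filter_upwards [hu₀u] with p hp hpA
    rw [hp hpA, min_eq_right (hu p hpA).2, max_eq_right (hu p hpA).1]
  have hnot := ae_notMem_iUnion hP hn hPc
  -- Clamping makes the bound hold at every point of space-time without changing the values on `A`
  -- beyond a null set.
  refine ⟨fun p => max (-s) (min s (u₀ p)), v₁, hu₁, hv₁v, ?_⟩
  refine ⟨hA, hD, fun i => continuous_planeTime _ _, fun i => measurableSet_planeSlit hP hD i,
    fun i z hz => hz.2.2, ?_, by fun_prop, hv₁, fun p => ?_, (spinEq_lt_one hJ).le,
    H.congr hA hu₁ hv₁v, fun N => ?_⟩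
  · filter_upwards [ae_planeSlit hn hPc D] with z hz τ hτ hne
    refine (hDA hτ).resolve_right fun hS => ?_
    obtain ⟨i, hi, h⟩ := hz τ hτ hS
    exact hne i hi h
  · exact abs_le.2 ⟨le_max_left _ _, max_le (by linarith) (min_le_left _ _)⟩
  · set E := Metric.closedBall (0 : SpaceTime d) (N : ℝ)
    have hEm : MeasurableSet E := measurableSet_closedBall
    have hDE : MeasurableSet (D ∩ E) := hD.measurableSet.inter hEm
    have hβ' : ENNReal.ofReal (16 * β) ≠ ⊤ := ENNReal.ofReal_ne_top
    -- The velocity is at most `1 / λ` plus a multiple of the energy density, so finite energy makes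
    -- it integrable up to and across the slits.
    have h := lintegral_slice_le hA.measurableSet hDE hEm (F := fun p => ‖v₁ p‖ₑ)
      (G := fun p => ENNReal.ofReal (lam⁻¹ * (wellPotential β (mass J) (u p) +
        1 / (2 * β) * Psi (u p) (lam * v p)))) (b := ENNReal.ofReal lam⁻¹) hβ' (by
      filter_upwards [hv₁v, hnot] with p hp hpS hpD
      have hpA : p ∈ A := (hDA hpD.1).resolve_right hpS
      have hd := abs_le_localDensity (V := lam * v p) hβ hJ (hu p hpA)
      rw [Set.indicator_of_mem hpA, Set.indicator_of_mem hpD.2, hp hpA,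
        Real.enorm_eq_ofReal_abs, ← ENNReal.ofReal_mul (by positivity)]
      refine le_trans (ENNReal.ofReal_le_ofReal ?_) ENNReal.ofReal_add_le
      rw [abs_mul, abs_of_pos hl] at hd
      calc |v p| = lam⁻¹ * (lam * |v p|) := by field_simp
        _ ≤ lam⁻¹ * (1 + 16 * β * (wellPotential β (mass J) (u p) +
            1 / (2 * β) * Psi (u p) (lam * v p))) := by gcongr
        _ = _ := by ring)
    have e : ∫⁻ p in D ∩ E, ‖v₁ p‖ₑ =
        ∫⁻ τ : ℝ, ∫⁻ z in slice (D ∩ E) τ, ‖v₁ (τ, z)‖ₑ := by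
      rw [← lintegral_indicator hDE, Measure.volume_eq_prod,
        lintegral_prod _ (hv₁.enorm.indicator hDE).aemeasurable]
      refine lintegral_congr fun τ => ?_
      rw [← lintegral_indicator (measurableSet_slice hDE τ)]
      rfl
    rw [e]
    refine h.trans_lt (ENNReal.add_lt_top.2 ⟨ENNReal.mul_lt_top hβ'.lt_top hE,
      ENNReal.mul_lt_top ENNReal.ofReal_lt_top ?_⟩)
    exact (isCompact_closedBall _ _).measure_lt_top

end Slits

/-! ### Traces -/

namespace IsSlitField

variable {k : ℕ} {M : ℝ} {u u₁ v₁ : SpaceTime d → ℝ} {A D : Set (SpaceTime d)}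
  {t : Fin k → Space d → ℝ} {Q : Fin k → Set (Space d)}

/-- On almost every line a punctured neighbourhood of each time lies in `A`, where `u` and its
representative agree almost everywhere; essential limits do not notice the difference. -/
theorem ae_tendsto (H : IsSlitField M u₁ v₁ A D t Q) (hu : ∀ᵐ p, p ∈ A → u₁ p = u p) :
    ∀ᵐ z, ∀ x ∈ timeLine D z,
      Tendsto (fun τ => u (τ, z)) (futureFilter (x, z))
        (𝓝 (meanLim 1 (fun τ => u₁ (τ, z)) x)) ∧
      Tendsto (fun τ => u (τ, z)) (pastFilter (x, z))
        (𝓝 (meanLim (-1) (fun τ => u₁ (τ, z)) x)) := by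
  filter_upwards [H.ae_isPiecewisePrimitive, ae_ae_of_ae hu, H.ae_mem] with z hz hzu hzm x hx
  have hev : ∀ᶠ τ in 𝓝[≠] x, (τ, z) ∈ A := by
    have h1 : ∀ᶠ τ in 𝓝 x, τ ∈ timeLine D z := (isOpen_timeLine H.isOpen z).mem_nhds hx
    have h2 : ∀ᶠ τ in 𝓝[≠] x, τ ∉ (slitTimes t Q z).erase x := by
      refine nhdsWithin_le_nhds ?_
      exact ((slitTimes t Q z).erase x).finite_toSet.isClosed.isOpen_compl.mem_nhds (by simp)
    filter_upwards [nhdsWithin_le_nhds h1, h2, self_mem_nhdsWithin] with τ h1 h2 h3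
    refine hzm τ h1 fun i hi he => h2 ?_
    exact Finset.mem_erase.2 ⟨h3, mem_slitTimes.2 ⟨i, hi, he.symm⟩⟩
  have hgen : ∀ l : Filter ℝ, l ≤ 𝓝[≠] x → ∀ y,
      Tendsto (fun τ => u₁ (τ, z)) (l ⊓ ae volume) (𝓝 y) →
        Tendsto (fun τ => u (τ, z)) (l ⊓ ae volume) (𝓝 y) := by
    intro l hl y h
    refine h.congr' ?_
    filter_upwards [mem_inf_of_left (hl hev), mem_inf_of_right hzu] with τ h1 h2
    exact h2 h1
  exact ⟨hgen _ (nhdsWithin_mono _ fun y hy => hy.ne') _ (hz.tendsto_future hx),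
    hgen _ (nhdsWithin_mono _ fun y hy => hy.ne) _ (hz.tendsto_past hx)⟩

theorem ae_hasTraces (H : IsSlitField M u₁ v₁ A D t Q) (hu : ∀ᵐ p, p ∈ A → u₁ p = u p) :
    ∀ᵐ z, (∀ x ∈ timeLine D z, HasTraces u (x, z)) ∧
      ∀ i, z ∈ Q i → |futureTrace u (t i z, z) - pastTrace u (t i z, z)| = slitJump u₁ t i z := by
  filter_upwards [H.ae_tendsto hu] with z hz
  refine ⟨fun x hx => ⟨⟨_, (hz x hx).1⟩, ⟨_, (hz x hx).2⟩⟩, fun i hi => ?_⟩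
  have h := hz (t i z) (H.mem i z hi)
  rw [futureTrace, pastTrace, h.1.limUnder_eq, h.2.limUnder_eq, slitJump]

end IsSlitField

/-! ### Temporal distance -/

theorem timeDist_le {p : SpaceTime d} {S : Set (SpaceTime d)} {τ : ℝ} (h : (τ, p.2) ∈ S) :
    timeDist p S ≤ ENNReal.ofReal |p.1 - τ| := by
  rw [abs_sub_comm]
  exact iInf₂_le (τ - p.1) (by simpa using h)

theorem timeDist_eq_zero {p : SpaceTime d} {S : Set (SpaceTime d)} (h : p ∈ S) :
    timeDist p S = 0 := by
  simpa using timeDist_le (p := p) (τ := p.1) h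

theorem timeDist_pos {p : SpaceTime d} {S U : Set (SpaceTime d)} (hU : IsOpen U) (hp : p ∈ U)
    (hSU : Disjoint U S) : 0 < timeDist p S := by
  obtain ⟨ε, hε, hb⟩ := Metric.isOpen_iff.1 hU p hp
  refine lt_of_lt_of_le (ENNReal.ofReal_pos.2 hε) (le_iInf₂ fun σ hσ => ?_)
  refine ENNReal.ofReal_le_ofReal (not_lt.1 fun hlt => ?_)
  refine Set.disjoint_left.1 hSU (hb ?_) hσ
  rw [Metric.mem_ball, Prod.dist_eq, max_lt_iff]
  simpa [Real.dist_eq] using And.intro hlt hε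

section Slits

variable {k : ℕ} {P : Fin k → Set (SpaceTime d)} {n : Fin k → Normal d} {c : Fin k → ℝ}
  {A D : Set (SpaceTime d)} {ν : SpaceTime d → Normal d} {u : SpaceTime d → ℝ}

/-- Avoiding the pieces is not enough, since they need not be closed. The full planes containing
them are closed and still null in space-time. -/
theorem ae_timeDist_pos (hn : ∀ i, ‖n i‖ = 1)
    (hPc : ∀ i, ∀ p ∈ P i, inner ℝ (n i) (WithLp.toLp 2 p) = c i) :
    ∀ᵐ p, 0 < timeDist p (⋃ i, P i) := by
  have hcl : ∀ i, IsClosed {p : SpaceTime d | inner ℝ (n i) (WithLp.toLp 2 p) = c i} := fun i =>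
    isClosed_eq (continuous_const.inner (WithLp.prod_continuous_toLp 2 ℝ (Space d)))
      continuous_const
  filter_upwards [ae_notMem_iUnion (P := fun i => {p | inner ℝ (n i) (WithLp.toLp 2 p) = c i})
    (fun i => (hcl i).measurableSet) hn fun i p hp => hp] with p hp
  refine timeDist_pos (isClosed_iUnion_of_finite hcl).isOpen_compl hp ?_
  exact (Set.disjoint_compl_left_iff_subset.2 (Set.iUnion_mono hPc))

/-- Integrals over the projection of a slit are controlled by surface integrals. -/
theorem lintegral_planeSlit_le (hP : ∀ i, MeasurableSet (P i))
    (hPc : ∀ i, ∀ p ∈ P i, inner ℝ (n i) (WithLp.toLp 2 p) = c i)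
    (hν : ∀ i, ∀ᵐ p ∂(hausdorff d).restrict (P i), ν p = n i ∨ ν p = -n i)
    (hD : IsOpen D) {i : Fin k} {g : Space d → ℝ} {f : SpaceTime d → ℝ}
    (hg : ∀ᵐ z, z ∈ planeSlit P n c D i → f (planeTime (n i) (c i) z, z) = g z) :
    ∫⁻ z in planeSlit P n c D i, ENNReal.ofReal (g z) ≤ ‖(n i).fst⁻¹‖ₑ *
      ∫⁻ p in (⋃ j, P j) ∩ D, ENNReal.ofReal (f p * |(ν p).fst|) ∂(hausdorff d) := by
  by_cases h0 : (n i).fst = 0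
  · have : planeSlit P n c D i = ∅ := Set.eq_empty_iff_forall_notMem.2 fun z hz => hz.1 h0
    simp [this]
  have hset : planeSlit P n c D i = {z | (planeTime (n i) (c i) z, z) ∈ P i ∩ D} := by
    ext z
    exact and_iff_right h0
  have hPt : ∀ p ∈ P i ∩ D, p.1 = planeTime (n i) (c i) p.2 := fun p hp =>
    eq_planeTime h0 (hPc i p hp.1)
  have hm : MeasurableSet (P i ∩ D) := (hP i).inter hD.measurableSet
  have hae := ae_hausdorff_notMem hPt hm (ae_iff.1 hg)
  have hν' := ae_restrict_of_ae_restrict_of_subset (Set.inter_subset_left (t := D)) (hν i)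
  calc ∫⁻ z in planeSlit P n c D i, ENNReal.ofReal (g z)
      ≤ ∫⁻ p in P i ∩ D, ENNReal.ofReal (g p.2) ∂(hausdorff d) := by
        rw [hset]
        exact lintegral_le_hausdorff _ _ _
    _ = ∫⁻ p in P i ∩ D, ‖(n i).fst⁻¹‖ₑ * ENNReal.ofReal (f p * |(ν p).fst|) ∂(hausdorff d) := by
        refine lintegral_congr_ae ?_
        filter_upwards [hae, hν', ae_restrict_mem hm] with p h1 h2 h3
        have hp : (planeTime (n i) (c i) p.2, p.2) = p := Prod.ext (hPt p h3).symm rfl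
        have hz : p.2 ∈ planeSlit P n c D i := by
          rw [hset]
          show (planeTime (n i) (c i) p.2, p.2) ∈ P i ∩ D
          rwa [hp]
        have h4 := not_not.1 h1 hz
        rw [hp] at h4
        -- On a planar piece `|ν_t|` is constant, so inserting it costs exactly the factor
        -- `|n_t|⁻¹`.
        have h5 : |(ν p).fst| = |(n i).fst| := by
          rcases h2 with h | h
          · rw [h]
          · rw [h, WithLp.neg_fst, abs_neg]
        rw [h5, Real.enorm_eq_ofReal_abs, ← ENNReal.ofReal_mul (abs_nonneg _), abs_inv, ← h4]
        congr 1
        have := abs_ne_zero.2 h0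
        field_simp
    _ = ‖(n i).fst⁻¹‖ₑ *
        ∫⁻ p in P i ∩ D, ENNReal.ofReal (f p * |(ν p).fst|) ∂(hausdorff d) :=
        lintegral_const_mul' _ _ enorm_ne_top
    _ ≤ _ := by
        gcongr
        exact Set.subset_iUnion P i

/-- A property holding at almost all points of each slit holds almost everywhere on the part of
the surface which is not time-like. -/
theorem ae_hausdorff_of_ae (hP : ∀ i, MeasurableSet (P i))
    (hPc : ∀ i, ∀ p ∈ P i, inner ℝ (n i) (WithLp.toLp 2 p) = c i)
    (hν : ∀ i, ∀ᵐ p ∂(hausdorff d).restrict (P i), ν p = n i ∨ ν p = -n i)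
    (hD : IsOpen D) {q : SpaceTime d → Prop} (hq : ∀ᵐ z, ∀ τ ∈ timeLine D z, q (τ, z)) :
    ∀ᵐ p ∂(hausdorff d).restrict ((⋃ i, P i) ∩ D), (ν p).fst ≠ 0 → q p := by
  rw [Set.iUnion_inter, ae_restrict_iUnion_iff]
  intro i
  have hm : MeasurableSet (P i ∩ D) := (hP i).inter hD.measurableSet
  have hν' := ae_restrict_of_ae_restrict_of_subset (Set.inter_subset_left (t := D)) (hν i)
  by_cases h0 : (n i).fst = 0
  · filter_upwards [hν'] with p hp hne
    rcases hp with h | h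
    · rw [h] at hne
      exact absurd h0 hne
    · rw [h, WithLp.neg_fst, neg_ne_zero] at hne
      exact absurd h0 hne
  · have hPt : ∀ p ∈ P i ∩ D, p.1 = planeTime (n i) (c i) p.2 := fun p hp =>
      eq_planeTime h0 (hPc i p hp.1)
    filter_upwards [ae_hausdorff_notMem hPt hm (ae_iff.1 hq), ae_restrict_mem hm] with p h1 h2 _
    exact not_not.1 h1 p.1 h2.2

end Slits

/-! ### The patched field -/

section Patch

open Classical in
/-- The field `u`, replaced by the field `w` at temporal distance less than `lam` from `S`. -/
def patch (lam : ℝ) (S : Set (SpaceTime d)) (u w : SpaceTime d → ℝ) (p : SpaceTime d) : ℝ :=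
  if ENNReal.ofReal lam ≤ timeDist p S then u p else w p

variable {k : ℕ} {P : Fin k → Set (SpaceTime d)} {n : Fin k → Normal d} {c : Fin k → ℝ}
  {A D : Set (SpaceTime d)} {u v u₁ v₁ : SpaceTime d → ℝ} {lam M : ℝ}

theorem slitNhd_planeSlit_subset (lam : ℝ) :
    slitNhd D (fun i => planeTime (n i) (c i)) (planeSlit P n c D) lam ⊆
      {p | timeDist p (⋃ i, P i) ≤ ENNReal.ofReal lam} := by
  rintro p ⟨-, i, hi, hlt⟩
  exact (timeDist_le (Set.mem_iUnion.2 ⟨i, hi.2.1⟩)).trans (ENNReal.ofReal_le_ofReal hlt.le)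

theorem notMem_slitNhd {p : SpaceTime d}
    (h : ENNReal.ofReal lam ≤ timeDist p (⋃ i, P i)) :
    p ∉ slitNhd D (fun i => planeTime (n i) (c i)) (planeSlit P n c D) lam := by
  rintro ⟨-, i, hi, hlt⟩
  have := h.trans (timeDist_le (Set.mem_iUnion.2 ⟨i, hi.2.1⟩))
  rw [ENNReal.ofReal_le_ofReal_iff (abs_nonneg _)] at this
  exact absurd hlt (not_lt.2 this)

/-- `patch` exists to have equality with `u` at every distant point, whereas `cut` is built from a
representative. Far from the surface the barrier is inactive, so the two differ on a null set only.
-/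
theorem IsSlitField.ae_patch_eq_cut
    (H : IsSlitField M u₁ v₁ A D (fun i => planeTime (n i) (c i)) (planeSlit P n c D))
    (hl : 0 < lam) (hDA : ∀ᵐ p, p ∈ D → p ∈ A) (hu : ∀ᵐ p, p ∈ A → u₁ p = u p) :
    ∀ᵐ p, p ∈ D → patch lam (⋃ i, P i) u (cut (2 / lam) u₁ D (fun i => planeTime (n i) (c i))
      (planeSlit P n c D)) p = cut (2 / lam) u₁ D (fun i => planeTime (n i) (c i))
      (planeSlit P n c D) p := by
  filter_upwards [hDA, hu] with p h1 h2 hpD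
  unfold patch
  split_ifs with h
  · rw [cut_eq_of_notMem hpD fun hc => notMem_slitNhd h (H.cutSet_subset hl hc), h2 (h1 hpD)]
  · rfl

/-- Points of the surface have temporal distance zero, so `u` itself is read only inside `A`, where
its bound is available. -/
theorem abs_patch_le
    (H : IsSlitField M u₁ v₁ A D (fun i => planeTime (n i) (c i)) (planeSlit P n c D))
    (hl : 0 < lam) (hDA : D ⊆ A ∪ ⋃ i, P i) (hu : ∀ p ∈ A, |u p| ≤ M) {p : SpaceTime d}
    (hp : p ∈ D) : |patch lam (⋃ i, P i) u (cut (2 / lam) u₁ D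
      (fun i => planeTime (n i) (c i)) (planeSlit P n c D)) p| ≤ M := by
  unfold patch
  split_ifs with h
  · refine hu p ((hDA hp).resolve_right fun hS => ?_)
    rw [timeDist_eq_zero hS, nonpos_iff_eq_zero, ENNReal.ofReal_eq_zero] at h
    linarith
  · exact H.abs_cut_le (by positivity) p

end Patch

end SpinPatch

end

/-! ### Assembly of the defect estimate. -/

theorem proposition4p7 {d : ℕ} (β : ℝ) (hβ : 0 < β) (J : SpinPatch.Space d → ℝ)
    (hJ_nonneg : ∀ x, 0 ≤ J x) (hJ_int : Integrable J)
    (hJ_moment : Integrable (fun x => ‖x‖ * J x))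
    (hJ_super : 1 < β * SpinPatch.mass J)
    (S : Set (SpinPatch.SpaceTime d)) (ν : SpinPatch.SpaceTime d → SpinPatch.Normal d)
    (hS : SpinPatch.IsPlanarUnion S ν) :
    ∃ C : ℝ≥0, ∀ (lam : ℝ), 0 < lam →
      ∀ (A : Set (SpinPatch.SpaceTime d)), IsOpen A →
      ∀ (u v : SpinPatch.SpaceTime d → ℝ),
        (∀ p ∈ A, u p ∈ Set.Icc (-SpinPatch.spinEq β (SpinPatch.mass J))
          (SpinPatch.spinEq β (SpinPatch.mass J))) →
        SpinPatch.HasWeakTimeDeriv u v A →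
        SpinPatch.energy β J lam u v A < ⊤ →
        (∀ᵐ p ∂(SpinPatch.hausdorff d).restrict (S ∩ interior (A ∪ S)),
          (ν p).fst ≠ 0 → SpinPatch.HasTraces u p) ∧
        ∃ u' v' : SpinPatch.SpaceTime d → ℝ,
          (∀ p ∈ interior (A ∪ S), u' p ∈ Set.Icc (-SpinPatch.spinEq β (SpinPatch.mass J))
            (SpinPatch.spinEq β (SpinPatch.mass J))) ∧
          SpinPatch.HasWeakTimeDeriv u' v' (interior (A ∪ S)) ∧
          (∀ p ∈ interior (A ∪ S),
            ENNReal.ofReal lam ≤ SpinPatch.timeDist p S → u' p = u p) ∧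
          ∀ δ : ℝ, 0 < δ → ∀ B : Set (SpinPatch.SpaceTime d), MeasurableSet B → B ⊆ A →
            SpinPatch.localEnergy β J lam u' v' (interior (A ∪ S)) +
                SpinPatch.absDiff (SpinPatch.defect J lam u' B B) (SpinPatch.defect J lam u B B) ≤
              SpinPatch.localEnergy β J lam u v A +
                (C * (∫⁻ p in S ∩ interior (A ∪ S), ENNReal.ofReal
                    ((|SpinPatch.futureTrace u p - SpinPatch.pastTrace u p| + lam + δ) *
                      |(ν p).fst|) ∂(SpinPatch.hausdorff d)) +
                  C * ENNReal.ofReal δ⁻¹ *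
                    (ENNReal.ofReal lam⁻¹ *
                      ∫⁻ p in A ∩ {p | 0 < SpinPatch.timeDist p S ∧
                          SpinPatch.timeDist p S ≤ ENNReal.ofReal lam},
                        ENNReal.ofReal (SpinPatch.Psi0 (lam * v p)))) := by
  open SpinPatch in
  obtain ⟨k, P, n, c, rfl, hS⟩ := hS
  have hP := fun i => (hS i).1
  have hn := fun i => (hS i).2.1
  have hPc := fun i => (hS i).2.2.1
  have hν := fun i => (hS i).2.2.2
  have hJ0 : 0 < mass J := pos_of_mul_pos_right (zero_lt_one.trans hJ_super) hβ.le
  -- A vertical piece contributes `0⁻¹ = 0`, in accordance with its empty slit.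
  set K : ℝ≥0 := ∑ i, ‖(n i).fst⁻¹‖₊ with hK
  -- The factor 3 is 1 from the local and 2 from the nonlocal energy, each times `Ĵ |E| / λ`. The
  -- summands are the surface and `Ψ₀` coefficients in `volume_cutSet_le`, added so that one
  -- constant serves both terms.
  refine ⟨3 * (mass J).toNNReal * ((3 * k + 2) * K + 8 * k), ?_⟩
  intro lam hl A hA u v hu H hE
  set S := ⋃ i, P i with hSdef
  set D := interior (A ∪ S) with hDdef
  have hD : IsOpen D := isOpen_interior
  have hDA : D ⊆ A ∪ S := interior_subset
  have hAD : A ⊆ D := interior_maximal Set.subset_union_left hA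
  have hu1 : ∀ p ∈ A, |u p| ≤ spinEq β (mass J) := fun p hp => abs_le.2 (hu p hp)
  have hs1 := (spinEq_lt_one hJ_super).le
  have hloc : localEnergy β J lam u v A < ⊤ := lt_of_le_of_lt le_self_add hE
  obtain ⟨u₁, v₁, hu₁, hv₁, HF⟩ :=
    exists_isSlitField hβ hJ_super hl hP hn hPc hA hD hDA hu H hloc
  have hpos := ae_timeDist_pos hn hPc
  have hmem : ∀ᵐ p, p ∈ D → p ∈ A := by
    filter_upwards [ae_notMem_iUnion hP hn hPc] with p hp hpD
    exact (hDA hpD).resolve_right hp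
  have htr := HF.ae_hasTraces hu₁
  refine ⟨ae_hausdorff_of_ae hP hPc hν hD (htr.mono fun z hz => hz.1), ?_⟩
  set t : Fin k → Space d → ℝ := fun i => planeTime (n i) (c i) with ht
  set Q := planeSlit P n c D with hQ
  set E := cutSet (2 / lam) u₁ D t Q with hEdef
  have hEm : MeasurableSet E := HF.measurableSet_cutSet
  have hκ : 0 ≤ 2 / lam := by positivity
  set u' := patch lam S u (cut (2 / lam) u₁ D t Q) with hu'
  set v' := cutDeriv (2 / lam) u₁ v₁ D t Q with hv'
  have hu'D : ∀ p ∈ D, |u' p| ≤ spinEq β (mass J) := fun p hp => abs_patch_le HF hl hDA hu1 hp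
  have hcut : ∀ᵐ p, p ∈ D → u' p = cut (2 / lam) u₁ D t Q p := HF.ae_patch_eq_cut hl hmem hu₁
  refine ⟨u', v', fun p hp => abs_le.1 (hu'D p hp), ?_, fun p _ h => if_pos h, ?_⟩
  · exact (HF.hasWeakTimeDeriv_cut hκ).congr hD hcut (ae_of_all _ fun p _ => rfl)
  intro δ hδ B hB hBA
  have heq : ∀ᵐ p, p ∈ D → p ∉ E → p ∈ A ∧ u' p = u p ∧ v' p = v p := by
    filter_upwards [hmem, hcut, hu₁, hv₁] with p h1 h2 h3 h4 hpD hpE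
    refine ⟨h1 hpD, ?_, ?_⟩
    · rw [h2 hpD, IsSlitField.cut_eq_of_notMem hpD hpE, h3 (h1 hpD)]
    · rw [hv', IsSlitField.cutDeriv_eq_of_notMem hpD hpE, h4 (h1 hpD)]
  have hen : localEnergy β J lam u' v' D ≤
      localEnergy β J lam u v A + ENNReal.ofReal (lam⁻¹ * mass J) * volume E := by
    refine localEnergy_le hA.measurableSet hD.measurableSet hEm hl.le heq (ae_of_all _ ?_)
    intro p hpD hpE
    -- On `E` the velocity is bounded by the cone slope `2 / λ`, so the rescaled velocity is at most
    -- 2.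
    refine localDensity_le hβ hJ_super (abs_le.1 (hu'D p hpD)) ?_
    have := IsSlitField.abs_cutDeriv_le_of_mem (v := v₁) hκ hpE
    rw [abs_mul, abs_of_pos hl]
    rwa [le_div_iff₀' hl] at this
  have hdef := absDiff_defect_le hJ_nonneg hJ_int hl hB hEm
    (fun p hp => (hu1 p (hBA hp)).trans hs1) (fun p hp => (hu'D p (hAD (hBA hp))).trans hs1)
    (heq.mono fun p hp hpB hpE => (hp (hAD (hBA hpB)) hpE).2.1)
  set X := ∫⁻ p in S ∩ D, ENNReal.ofReal
    ((|futureTrace u p - pastTrace u p| + lam + δ) * |(ν p).fst|) ∂(hausdorff d) with hX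
  set I := ENNReal.ofReal lam⁻¹ * ∫⁻ p in A ∩ {p | 0 < timeDist p S ∧
    timeDist p S ≤ ENNReal.ofReal lam}, ENNReal.ofReal (Psi0 (lam * v p)) with hI
  have hY : ∑ i, ∫⁻ z in Q i, ENNReal.ofReal (slitJump u₁ t i z + lam + δ) ≤ K * X := by
    have : ∀ i, ∫⁻ z in Q i, ENNReal.ofReal (slitJump u₁ t i z + lam + δ) ≤
        ‖(n i).fst⁻¹‖ₑ * X := fun i => by
      refine lintegral_planeSlit_le hP hPc hν hD ?_
      filter_upwards [htr] with z hz hzQ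
      exact congrArg (fun x => x + lam + δ) (hz.2 i hzQ)
    refine (Finset.sum_le_sum fun i _ => this i).trans (le_of_eq ?_)
    rw [← Finset.sum_mul, hK, ENNReal.ofNNReal_finsetSum]
    rfl
  have hI' : ENNReal.ofReal lam⁻¹ * ∫⁻ p in slitNhd D t Q lam,
      ENNReal.ofReal (Psi0 (lam * v₁ p)) ≤ I := by
    refine mul_le_mul_right ?_ _
    have hm : MeasurableSet (slitNhd D t Q lam) := HF.measurableSet_slitNhd lam
    calc _ = ∫⁻ p in slitNhd D t Q lam, ENNReal.ofReal (Psi0 (lam * v p)) := by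
          refine setLIntegral_congr_fun_ae hm ?_
          filter_upwards [hmem, hv₁] with p h1 h2 hp
          rw [h2 (h1 hp.1)]
      _ ≤ _ := by
          refine lintegral_mono' (Measure.restrict_mono' ?_ le_rfl) le_rfl
          filter_upwards [hmem, hpos] with p h1 h2 hp
          exact ⟨h1 hp.1, h2, slitNhd_planeSlit_subset lam hp⟩
  have hvol := HF.volume_cutSet_le hl hδ
  have hvol' : ENNReal.ofReal (lam⁻¹ * mass J) * volume E ≤
      ENNReal.ofReal (mass J) * ((3 * k + 2) * (K * X) + 8 * k * (ENNReal.ofReal δ⁻¹ * I)) := by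
    calc _ ≤ ENNReal.ofReal (lam⁻¹ * mass J) * (ENNReal.ofReal lam *
          ((3 * k + 2) * (K * X) + 8 * k * (ENNReal.ofReal δ⁻¹ * I))) := by
          refine mul_le_mul_right (hvol.trans ?_) _
          gcongr
      _ = _ := by
          rw [← mul_assoc, ← ENNReal.ofReal_mul (by positivity)]
          congr 2
          field_simp
  calc _ ≤ localEnergy β J lam u v A + ENNReal.ofReal (lam⁻¹ * mass J) * volume E +
        2 * ENNReal.ofReal (lam⁻¹ * mass J) * volume E := add_le_add hen hdef
    _ = localEnergy β J lam u v A + 3 * (ENNReal.ofReal (lam⁻¹ * mass J) * volume E) := by ring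
    _ ≤ localEnergy β J lam u v A + 3 * (ENNReal.ofReal (mass J) *
        ((3 * k + 2) * (K * X) + 8 * k * (ENNReal.ofReal δ⁻¹ * I))) := by gcongr
    _ ≤ _ := by
        refine add_le_add le_rfl ?_
        have e : ENNReal.ofReal (mass J) = ((mass J).toNNReal : ℝ≥0∞) := rfl
        rw [e]
        push_cast
        set m : ℝ≥0∞ := ((mass J).toNNReal : ℝ≥0∞)
        calc _ = 3 * m * ((3 * k + 2) * K) * X + 3 * m * (8 * k) * ENNReal.ofReal δ⁻¹ * I := by
              ring
          _ ≤ _ := by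
              gcongr
              · exact le_self_add
              · exact le_add_self
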